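/- Let $H$ and $G$ be real Hilbert spaces, $G$ identified with its dual, let $A:D(A)\subset H\to H$ be a linear operator and $C_{21},\Pi\in\mathcal L(H)$. Write $|\cdot|$ and $\langle\cdot,\cdot\rangle$ for the norm and scalar product of $H$. Assume (A1) $A$ is self-adjoint and positive ($\langle Au,u\rangle\ge 0$ on $D(A)$), there is $\omega>0$ with $|Au|\ge\omega|u|$ for all $u\in D(A)$, and $A$ has a compact resolvent. For $k=1,2$ let $H_k=D(A^{k/2})$ with the norm $|A^{k/2}\cdot|$, let $H_0=H$, and let $H_{-k}$ be the dual space of $H_k$ with pivot space $H$; its norm is $|A^{-k/2}\cdot|$. For a pair $W=(w,w')$ put $e_k(W)=\frac12\big(|A^{k/2}w|^2+|A^{(k-1)/2}w'|^2\big)$. Assume further (A2) $C_{21}^*$ maps $H_1$ boundedly into $H_1$; with $\beta=\|C_{21}\|$ one has $|C_{21}w|^2\le\beta\langle C_{21}w,w\rangle$ for all $w\in H$; and there is $\alpha>0$ with $\alpha|\Pi w|^2\le\langle C_{21}w,w\rangle$ for all $w\in H$. (A3) There is $T_0>0$ such that for every $T>T_0$ there is $c>0$ such that every solution $W=(w,w')\in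 C([0,T];H_1\times H)$ of $w''+Aw=0$ satisfies $\int_0^T|\Pi w'|^2\,dt\ge c\,e_1(W)(0)$. For an operator $\mathbf B^*\in\mathcal L(H_2\times H;G)$ consider the following conditions, in which $\mathbf B^*(w,w')$ denotes the function $g\in L^2(0,T;G)$ with $\mathbf B^*\big(\int_0^t w\,ds,\int_0^t w'\,ds\big)=\int_0^t g\,ds$ for all $t\in[0,T]$ (it is $\mathbf B^*(w(t),w'(t))$ when $(w,w')$ is continuous with values in $H_2\times H$). (A4) For every $T>0$ there is $c>0$ such that for every $f\in L^2(0,T;H)$ and every solution $W=(w,w')\in C([0,T];H_1\times H)$ of $w''+Aw=f$ the observation $\mathbf B^*(w,w')\in L^2(0,T;G)$ exists and $$\int_0^T\|\mathbf B^*(w,w')\|_G^2\,dt\le c\Big(e_1(W)(0)+e_1(W)(T)+\int_0^Te_1(W)\,dt+\int_0^T|f|^2\,dt\Big).$$ (A5) There is $T_0>0$ such that for every $T>T_0$ there is $c>0$ such that every solution $W=(w,w')\in C([0,T];H_1\times H)$ of $w''+Aw=0$ satisfies $\int_0^T\|\mathbf B^*(w,w')\|_G^2\,dt\ge c\,e_1(W)(0)$.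 Call $T_3>0$ an observability time (for $\mathbf B^*$) if for every $T>T_3$ there are $d_1,d_2>0$ such that all solutions of $u_1''+Au_1=0$, $u_2''+Au_2+C_{21}u_1=0$ on $[0,T]$ with data in $H_1^2\times H^2$ satisfy, with $U_i=(u_i,u_i')$, $$e_0(U_1)(0)\le d_1\int_0^T\|\mathbf B^*U_2\|_G^2\,dt,\qquad e_1(U_2)(0)\le d_2\int_0^T\|\mathbf B^*U_2\|_G^2\,dt .$$ Consider the control system $$y_1''+Ay_1+C_{21}^*y_2=0,\qquad y_2''+Ay_2=Bv,\qquad (y_1,y_2,y_1',y_2')(0)=Y_0, \tag{1}$$ and the dual system $$w_1''+Aw_1=0,\qquad w_2''+Aw_2+C_{21}w_1=0. \tag{2}$$ Let $X_{-1}=H_{-1}\times H\times H_{-2}\times H_{-1}$, $X_{-1}^*=H_2\times H_1\times H_1\times H$, $X_1=H\times H_1\times H_{-1}\times H$, $X_1^*=H_1\times H\times H\times H_{-1}$, with the duality products $$[Y,W]=\langle y_1',w_1\rangle-\langle y_1,w_1'\rangle+\langle y_2',w_2\rangle-\langle y_2,w_2'\rangle,\qquad Y=(y_1,y_2,y_1',y_2'),\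 W=(w_1,w_2,w_1',w_2').$$ With $X=X_{-1}$ or $X=X_1$, a solution by transposition of (1) in $X^*$ is a function $Y\in C([0,\infty);X^*)$ such that, for all $\tau>0$ and all solutions $W\in C([0,\tau];X)$ of (2), $$\int_0^\tau\langle v,B^*w_2\rangle_G\,dt=[Y(\tau),W(\tau)]-[Y_0,W(0)].$$ Then the following hold. (i) (Bounded control operator.) Let $B\in\mathcal L(G,H)$ be such that $\mathbf B^*(w,w')=B^*w'$ satisfies (A4) and (A5). Then observability times exist, and for every observability time $T_3$, every $T>T_3$ and every $Y_0\in X_{-1}^*$ there is a control $v\in L^2((0,T);G)$ such that (1), with $v$ extended by zero to $(0,\infty)$, has exactly one solution by transposition $Y$ in $X_{-1}^*$, and this solution satisfies $Y(0)=Y_0$ and $Y(T)=0$. (ii) (Unbounded control operator.) Let $B\in\mathcal L(G,H_2')$, where $H_2'=H_{-2}$, be such that $\mathbf B^*(w,w')=B^*w$ satisfies (A4) and (A5). Then observability times exist, and for every observability time $T_3$, every $T>T_3$ and every $Y_0\in X_1^*$ there is a control $v\in L^2((0,T);G)$ such that (1), with $v$ extended by zero to $(0,\infty)$, has exactly one solution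 by transposition $Y$ in $X_1^*$, and this solution satisfies $Y(0)=Y_0$ and $Y(T)=0$. (Here $B^*w_2\in L^2(0,\tau;G)$ in the definition of the solution is understood in the integrated sense above.) -/

import Mathlib

open MeasureTheory Set
open scoped NNReal

noncomputable section

namespace Cascade

universe u v

variable {H : Type u} [NormedAddCommGroup H] [InnerProductSpace ℝ H] [CompleteSpace H]
variable {G : Type v} [NormedAddCommGroup G] [InnerProductSpace ℝ G] [CompleteSpace G]

/-! ### The operator `A` and its powers -/

/-- Assumption (A1): `A` is a positive self-adjoint operator in `H`, bounded from below, with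
compact resolvent. -/
structure A1 (A : H →ₗ.[ℝ] H) : Prop where
  selfAdjoint : IsSelfAdjoint A
  nonneg : ∀ u : A.domain, 0 ≤ inner ℝ (A u) (u : H)
  coercive : ∃ ω : ℝ, 0 < ω ∧ ∀ u : A.domain, ω * ‖(u : H)‖ ≤ ‖A u‖
  compactResolvent : ∃ (μ : ℝ) (R : H →L[ℝ] H), IsCompactOperator R ∧
    (∀ x : H, ∃ h : R x ∈ A.domain, A ⟨R x, h⟩ - μ • R x = x) ∧
    ∀ u : A.domain, R (A u - μ • (u : H)) = u

/-- The eigenspace `ker (A - l)`. -/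
def eigenspace (A : H →ₗ.[ℝ] H) (l : ℝ) : Submodule ℝ H where
  carrier := {x | ∃ h : x ∈ A.domain, A ⟨x, h⟩ = l • x}
  zero_mem' := ⟨A.domain.zero_mem, by
    have : (⟨0, A.domain.zero_mem⟩ : A.domain) = 0 := rfl
    rw [this, A.map_zero, smul_zero]⟩
  add_mem' := by
    rintro x y ⟨hx, ex⟩ ⟨hy, ey⟩
    refine ⟨A.domain.add_mem hx hy, ?_⟩
    have : (⟨x + y, A.domain.add_mem hx hy⟩ : A.domain) = ⟨x, hx⟩ + ⟨y, hy⟩ := rfl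
    rw [this, A.map_add, ex, ey, smul_add]
  smul_mem' := by
    rintro c x ⟨hx, ex⟩
    refine ⟨A.domain.smul_mem c hx, ?_⟩
    have : (⟨c • x, A.domain.smul_mem c hx⟩ : A.domain) = c • ⟨x, hx⟩ := rfl
    rw [this, A.map_smul, ex, smul_comm]

/-- The orthogonal projection of `H` onto `ker (A - l)` (a closed subspace when `A` is
self-adjoint, so that taking the closure changes nothing). -/
def eigenProj (A : H →ₗ.[ℝ] H) (l : ℝ) : H →L[ℝ] H :=
  (eigenspace A l).topologicalClosure.starProjection

/-- The fractional power `A ^ s` of a positive self-adjoint operator with compact resolvent,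
`A ^ s u = ∑ l ^ s P_l u`, the sum being over the eigenvalues `l ≥ 0` (`P_l = 0` if `l` is not an
eigenvalue); its domain is the set of `u` for which the series converges unconditionally, that is
`∑ l ^ (2 s) ‖P_l u‖ ^ 2 < ∞`. -/
def fracPow (A : H →ₗ.[ℝ] H) (s : ℝ) : H →ₗ.[ℝ] H where
  domain :=
    { carrier := {x | Summable fun l : ℝ≥0 => ((l : ℝ) ^ s) • eigenProj A l x}
      zero_mem' := by simp [summable_zero]
      add_mem' := by
        intro x y hx hy
        simpa [smul_add] using Summable.add hx hy
      smul_mem' := by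
        intro c x hx
        have := Summable.const_smul c hx
        simpa [smul_comm c] using this }
  toFun :=
    { toFun := fun x => ∑' l : ℝ≥0, ((l : ℝ) ^ s) • eigenProj A l (x : H)
      map_add' := by
        intro x y
        rw [← Summable.tsum_add x.2 y.2]
        simp [smul_add]
      map_smul' := by
        intro c x
        have h := Summable.tsum_const_smul c x.2
        simp only [RingHom.id_apply]
        rw [← h]
        simp [smul_comm c] }

/-! ### The spaces `H_k`, `k = ±1, ±2` -/

/-- The domain of an operator `S` in `H`, normed by `u ↦ |S u|`. -/
def DomSpace (S : H →ₗ.[ℝ] H) : Type u := S.domain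

namespace DomSpace

variable {S : H →ₗ.[ℝ] H}

instance : AddCommGroup (DomSpace S) := inferInstanceAs (AddCommGroup S.domain)

instance : Module ℝ (DomSpace S) := inferInstanceAs (Module ℝ S.domain)

/-- `S` as a linear map on its domain. -/
def op (S : H →ₗ.[ℝ] H) : DomSpace S →ₗ[ℝ] H := S.toFun

instance : SeminormedAddCommGroup (DomSpace S) :=
  SeminormedAddCommGroup.induced (DomSpace S) H (op S)

instance : NormedSpace ℝ (DomSpace S) := NormedSpace.induced ℝ (DomSpace S) H (op S)

/-- An element of the domain, as an element of the normed space `DomSpace S`. -/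
def mk (x : H) (h : x ∈ S.domain) : DomSpace S := (⟨x, h⟩ : S.domain)

/-- The inclusion of the domain in `H`. -/
def val (x : DomSpace S) : H := ((show S.domain from x) : H)

end DomSpace

/-- `H_1 = D(A^{1/2})` with the norm `|A^{1/2} u|`. -/
abbrev H1 (A : H →ₗ.[ℝ] H) : Type u := DomSpace (fracPow A (1 / 2))

/-- `H_2 = D(A)` with the norm `|A u|`. -/
abbrev H2 (A : H →ₗ.[ℝ] H) : Type u := DomSpace A

/-- `H_{-1}`, the dual space of `H_1`. An element `h` of the pivot space `H` corresponds to the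
functional `φ ↦ ⟨h, φ⟩`. -/
abbrev Hneg1 (A : H →ₗ.[ℝ] H) : Type u := StrongDual ℝ (H1 A)

/-- `H_{-2}`, the dual space of `H_2`. -/
abbrev Hneg2 (A : H →ₗ.[ℝ] H) : Type u := StrongDual ℝ (H2 A)

/-- The energy `e_1 = (|A^{1/2} w|² + |w'|²) / 2`. -/
def energy1 {A : H →ₗ.[ℝ] H} (w : H1 A) (w' : H) : ℝ := (‖w‖ ^ 2 + ‖w'‖ ^ 2) / 2

/-- The weakened energy `e_0 = (|w|² + |A^{-1/2} w'|²) / 2` of a pair in `H × H`. -/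
def energy0 (A : H →ₗ.[ℝ] H) (w w' : H) : ℝ :=
  (‖w‖ ^ 2 + ‖∑' l : ℝ≥0, ((l : ℝ) ^ (-(1 / 2) : ℝ)) • eigenProj A l w'‖ ^ 2) / 2

/-! ### Solutions of the wave equation `w'' + A w = f` at three levels of regularity

In all three definitions `q` is the time derivative `w'`, and the equations are integrated in time
and tested against all vectors for which every term makes sense. -/

/-- `(w, q) ∈ C([0,T]; H_1 × H)` solves `w' = q`, `q' + A w = f` with `f ∈ L²(0,T;H)`. -/
structure IsWave1 (A : H →ₗ.[ℝ] H) (T : ℝ) (f : ℝ → H) (w : ℝ → H1 A) (q : ℝ → H) : Prop where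
  cont_w : ContinuousOn w (Icc 0 T)
  cont_q : ContinuousOn q (Icc 0 T)
  eq_w : ∀ t ∈ Icc 0 T, (w t).val = (w 0).val + ∫ s in (0 : ℝ)..t, q s
  eq_q : ∀ φ : A.domain, ∀ t ∈ Icc 0 T,
    inner ℝ (q t) (φ : H) = inner ℝ (q 0) (φ : H) +
      ∫ s in (0 : ℝ)..t, (inner ℝ (f s) (φ : H) - inner ℝ (w s).val (A φ))

/-- `(w, q) ∈ C([0,T]; H × H_{-1})` solves `w' = q`, `q' + A w = F`, where `F s φ` is the duality
product of the source at time `s` with `φ ∈ H_1`. -/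
structure IsWave0 (A : H →ₗ.[ℝ] H) (T : ℝ) (F : ℝ → H1 A → ℝ)
    (w : ℝ → H) (q : ℝ → Hneg1 A) : Prop where
  cont_w : ContinuousOn w (Icc 0 T)
  cont_q : ContinuousOn q (Icc 0 T)
  eq_w : ∀ (φ : H) (h1 : φ ∈ (fracPow A (1 / 2)).domain), ∀ t ∈ Icc 0 T,
    inner ℝ (w t) φ = inner ℝ (w 0) φ + ∫ s in (0 : ℝ)..t, q s (DomSpace.mk φ h1)
  eq_q : ∀ (φ : H) (h1 : φ ∈ (fracPow A (1 / 2)).domain) (h2 : φ ∈ A.domain),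
    ∀ t ∈ Icc 0 T, q t (DomSpace.mk φ h1) = q 0 (DomSpace.mk φ h1) +
      ∫ s in (0 : ℝ)..t, (F s (DomSpace.mk φ h1) - inner ℝ (w s) (A ⟨φ, h2⟩))

/-- `(w, q) ∈ C([0,T]; H_{-1} × H_{-2})` solves `w' = q`, `q' + A w = 0`. -/
structure IsWaveNeg1 (A : H →ₗ.[ℝ] H) (T : ℝ) (w : ℝ → Hneg1 A) (q : ℝ → Hneg2 A) : Prop where
  cont_w : ContinuousOn w (Icc 0 T)
  cont_q : ContinuousOn q (Icc 0 T)
  eq_w : ∀ (φ : H) (h1 : φ ∈ (fracPow A (1 / 2)).domain) (h2 : φ ∈ A.domain), ∀ t ∈ Icc 0 T,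
    w t (DomSpace.mk φ h1) = w 0 (DomSpace.mk φ h1) +
      ∫ s in (0 : ℝ)..t, q s (DomSpace.mk φ h2)
  eq_q : ∀ (φ : H) (h2 : φ ∈ A.domain) (h3 : A ⟨φ, h2⟩ ∈ (fracPow A (1 / 2)).domain),
    ∀ t ∈ Icc 0 T, q t (DomSpace.mk φ h2) = q 0 (DomSpace.mk φ h2) -
      ∫ s in (0 : ℝ)..t, w s (DomSpace.mk (A ⟨φ, h2⟩) h3)

/-! ### The coupling operator and the observation operator -/

open Classical in
/-- The restriction of `C*` to `H_1`, for an operator with `C* H_1 ⊆ H_1` (as is assumed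
in (A2)). -/
def adjOnH1 (A : H →ₗ.[ℝ] H) (C : H →L[ℝ] H) (φ : H1 A) : H1 A :=
  if h : ContinuousLinearMap.adjoint C φ.val ∈ (fracPow A (1 / 2)).domain then
    DomSpace.mk (ContinuousLinearMap.adjoint C φ.val) h
  else 0

/-- Assumption (A2) on the coupling operator `C = C₂₁`, with `β = ‖C‖`. -/
structure A2 (A : H →ₗ.[ℝ] H) (C Pi : H →L[ℝ] H) : Prop where
  maps_H1 : ∀ φ : H1 A, ContinuousLinearMap.adjoint C φ.val ∈ (fracPow A (1 / 2)).domain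
  bounded_H1 : ∃ K : ℝ, ∀ φ : H1 A, ‖adjOnH1 A C φ‖ ≤ K * ‖φ‖
  sq_le : ∀ w : H, ‖C w‖ ^ 2 ≤ ‖C‖ * inner ℝ (C w) w
  partial_coercive : ∃ α : ℝ, 0 < α ∧ ∀ w : H, α * ‖Pi w‖ ^ 2 ≤ inner ℝ (C w) w

/-- Assumption (A3) on `Π`. -/
def A3 (A : H →ₗ.[ℝ] H) (Pi : H →L[ℝ] H) : Prop :=
  ∃ T₀ : ℝ, 0 < T₀ ∧ ∀ T : ℝ, T₀ < T → ∃ c : ℝ, 0 < c ∧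
    ∀ (w : ℝ → H1 A) (q : ℝ → H), IsWave1 A T (fun _ => 0) w q →
      c * energy1 (w 0) (q 0) ≤ ∫ t in (0 : ℝ)..T, ‖Pi (q t)‖ ^ 2

/-- `g ∈ L²(0,T;G)` is the observation `𝐁*(w, w')` of `(w, q) = (w, w')` on `(0,T)`, where
`𝐁* ∈ L(H_2 × H; G)`. Since `w` need not take values in `H_2`, this is understood in the integrated
sense `𝐁*(∫₀ᵗ (w, q)) = ∫₀ᵗ g` for all `t ∈ [0,T]`; it determines `g` almost everywhere, and it
says `g = 𝐁*(w, q)` almost everywhere if `(w, q)` is continuous with values in `H_2 × H`. -/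
structure IsObservation {A : H →ₗ.[ℝ] H} (Bs : H2 A × H →L[ℝ] G) (T : ℝ)
    (w : ℝ → H1 A) (q : ℝ → H) (g : ℝ → G) : Prop where
  memLp : MemLp g 2 (volume.restrict (Ioo 0 T))
  eq : ∀ t ∈ Icc 0 T, ∃ h : (∫ s in (0 : ℝ)..t, (w s).val) ∈ A.domain,
    Bs (DomSpace.mk (∫ s in (0 : ℝ)..t, (w s).val) h, ∫ s in (0 : ℝ)..t, q s) =
      ∫ s in (0 : ℝ)..t, g s

/-- Assumption (A4): `𝐁* ∈ L(H_2 × H; G)` is an admissible observation operator. -/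
def A4 (A : H →ₗ.[ℝ] H) (Bs : H2 A × H →L[ℝ] G) : Prop :=
  ∀ T : ℝ, 0 < T → ∃ c : ℝ, 0 < c ∧
    ∀ (f : ℝ → H) (w : ℝ → H1 A) (q : ℝ → H), MemLp f 2 (volume.restrict (Ioo 0 T)) →
      IsWave1 A T f w q →
      ∃ g : ℝ → G, IsObservation Bs T w q g ∧
        ∫ t in (0 : ℝ)..T, ‖g t‖ ^ 2 ≤
          c * (energy1 (w 0) (q 0) + energy1 (w T) (q T) +
            (∫ t in (0 : ℝ)..T, energy1 (w t) (q t)) + ∫ t in (0 : ℝ)..T, ‖f t‖ ^ 2)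

/-- Assumption (A5): observability of a single equation through `𝐁*`. -/
def A5 (A : H →ₗ.[ℝ] H) (Bs : H2 A × H →L[ℝ] G) : Prop :=
  ∃ T₀ : ℝ, 0 < T₀ ∧ ∀ T : ℝ, T₀ < T → ∃ c : ℝ, 0 < c ∧
    ∀ (w : ℝ → H1 A) (q : ℝ → H) (g : ℝ → G), IsWave1 A T (fun _ => 0) w q →
      IsObservation Bs T w q g →
      c * energy1 (w 0) (q 0) ≤ ∫ t in (0 : ℝ)..T, ‖g t‖ ^ 2

/-- `T₃ > 0` is an observability time of the cascade system `u₁'' + A u₁ = 0`,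
`u₂'' + A u₂ + C u₁ = 0` observed through `𝐁*(u₂, u₂')`: for every `T > T₃` there are constants
`d₁, d₂ > 0` such that all solutions with data in `H_1² × H²` satisfy
`e_0(u₁, u₁')(0) ≤ d₁ ∫₀ᵀ ‖𝐁*(u₂, u₂')‖²` and `e_1(u₂, u₂')(0) ≤ d₂ ∫₀ᵀ ‖𝐁*(u₂, u₂')‖²`. -/
def IsObservabilityTime (A : H →ₗ.[ℝ] H) (C : H →L[ℝ] H) (Bs : H2 A × H →L[ℝ] G)
    (T₃ : ℝ) : Prop :=
  0 < T₃ ∧ ∀ T : ℝ, T₃ < T → ∃ d₁ d₂ : ℝ, 0 < d₁ ∧ 0 < d₂ ∧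
    ∀ (u₁ u₂ : ℝ → H1 A) (q₁ q₂ : ℝ → H) (g : ℝ → G),
      IsWave1 A T (fun _ => 0) u₁ q₁ → IsWave1 A T (fun s => -C (u₁ s).val) u₂ q₂ →
      IsObservation Bs T u₂ q₂ g →
      energy0 A (u₁ 0).val (q₁ 0) ≤ d₁ * ∫ t in (0 : ℝ)..T, ‖g t‖ ^ 2 ∧
      energy1 (u₂ 0) (q₂ 0) ≤ d₂ * ∫ t in (0 : ℝ)..T, ‖g t‖ ^ 2

/-! ### The two classes of control operators -/

/-- For a bounded control operator `B ∈ L(G, H)`: `𝐁*(w, w') = B* w'`. -/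
def obsBounded (A : H →ₗ.[ℝ] H) (B : G →L[ℝ] H) : H2 A × H →L[ℝ] G :=
  (ContinuousLinearMap.adjoint B).comp (ContinuousLinearMap.snd ℝ (H2 A) H)

/-- For `B ∈ L(G, H_2')`, the dual operator `B* ∈ L(H_2, G)`, where `G` is identified with its dual:
`⟨B* φ, g⟩ = (B g)(φ)`. -/
def dualOp {A : H →ₗ.[ℝ] H} (B : G →L[ℝ] Hneg2 A) : H2 A →L[ℝ] G where
  toFun φ := (InnerProductSpace.toDual ℝ G).symm (B.flip φ)
  map_add' φ ψ := by simp
  map_smul' c φ := by simp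
  cont := (InnerProductSpace.toDual ℝ G).symm.continuous.comp B.flip.continuous

/-- For an unbounded control operator `B ∈ L(G, H_2')`: `𝐁*(w, w') = B* w`. -/
def obsUnbounded {A : H →ₗ.[ℝ] H} (B : G →L[ℝ] Hneg2 A) : H2 A × H →L[ℝ] G :=
  (dualOp B).comp (ContinuousLinearMap.fst ℝ (H2 A) H)

/-! ### The dual cascade system and solutions by transposition -/

/-- `(w₁, w₂, q₁, q₂) ∈ C([0,T]; X_{-1})`, `X_{-1} = H_{-1} × H × H_{-2} × H_{-1}`, solves
`w₁'' + A w₁ = 0`, `w₂'' + A w₂ + C w₁ = 0`, where `C w₁ ∈ H_{-1}` is the functional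
`φ ↦ w₁(C* φ)`. -/
def IsDualNeg1 (A : H →ₗ.[ℝ] H) (C : H →L[ℝ] H) (T : ℝ)
    (w₁ : ℝ → Hneg1 A) (w₂ : ℝ → H) (q₁ : ℝ → Hneg2 A) (q₂ : ℝ → Hneg1 A) : Prop :=
  IsWaveNeg1 A T w₁ q₁ ∧ IsWave0 A T (fun s φ => -w₁ s (adjOnH1 A C φ)) w₂ q₂

/-- `(w₁, w₂, q₁, q₂) ∈ C([0,T]; X_1)`, `X_1 = H × H_1 × H_{-1} × H`, solves
`w₁'' + A w₁ = 0`, `w₂'' + A w₂ + C w₁ = 0`. -/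
def IsDual1 (A : H →ₗ.[ℝ] H) (C : H →L[ℝ] H) (T : ℝ)
    (w₁ : ℝ → H) (w₂ : ℝ → H1 A) (q₁ : ℝ → Hneg1 A) (q₂ : ℝ → H) : Prop :=
  IsWave0 A T (fun _ _ => 0) w₁ q₁ ∧ IsWave1 A T (fun s => -C (w₁ s)) w₂ q₂

/-- `X_{-1}^* = H_2 × H_1 × H_1 × H`, with elements `(y₁, y₂, y₁', y₂')`. -/
abbrev XnegStar (A : H →ₗ.[ℝ] H) : Type u := H2 A × H1 A × H1 A × H

/-- `X_1^* = H_1 × H × H × H_{-1}`, with elements `(y₁, y₂, y₁', y₂')`. -/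
abbrev XposStar (A : H →ₗ.[ℝ] H) : Type u := H1 A × H × H × Hneg1 A

/-- The duality product
`⟨y₁', w₁⟩ - ⟨y₁, w₁'⟩ + ⟨y₂', w₂⟩ - ⟨y₂, w₂'⟩` of `X_{-1}^*` and `X_{-1}`. -/
def pairNeg {A : H →ₗ.[ℝ] H} (y : XnegStar A)
    (w₁ : Hneg1 A) (w₂ : H) (q₁ : Hneg2 A) (q₂ : Hneg1 A) : ℝ :=
  w₁ y.2.2.1 - q₁ y.1 + inner ℝ y.2.2.2 w₂ - q₂ y.2.1

/-- The duality product
`⟨y₁', w₁⟩ - ⟨y₁, w₁'⟩ + ⟨y₂', w₂⟩ - ⟨y₂, w₂'⟩` of `X_1^*` and `X_1`. -/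
def pairPos {A : H →ₗ.[ℝ] H} (y : XposStar A)
    (w₁ : H) (w₂ : H1 A) (q₁ : Hneg1 A) (q₂ : H) : ℝ :=
  inner ℝ y.2.2.1 w₁ - q₁ y.1 + y.2.2.2 w₂ - inner ℝ y.2.1 q₂

/-- `Y ∈ C([0,∞); X_{-1}^*)` is a solution by transposition of `y₁'' + A y₁ + C* y₂ = 0`,
`y₂'' + A y₂ = B v`, `Y(0) = Y₀`, for a bounded control operator `B ∈ L(G, H)`. -/
def IsTranspositionBounded (A : H →ₗ.[ℝ] H) (C : H →L[ℝ] H) (B : G →L[ℝ] H)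
    (v : ℝ → G) (Y₀ : XnegStar A) (Y : ℝ → XnegStar A) : Prop :=
  ContinuousOn Y (Ici 0) ∧
  ∀ T : ℝ, 0 < T → ∀ (w₁ : ℝ → Hneg1 A) (w₂ : ℝ → H) (q₁ : ℝ → Hneg2 A) (q₂ : ℝ → Hneg1 A),
    IsDualNeg1 A C T w₁ w₂ q₁ q₂ →
    ∫ t in (0 : ℝ)..T, inner ℝ (v t) (ContinuousLinearMap.adjoint B (w₂ t)) =
      pairNeg (Y T) (w₁ T) (w₂ T) (q₁ T) (q₂ T) - pairNeg Y₀ (w₁ 0) (w₂ 0) (q₁ 0) (q₂ 0)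

/-- `Y ∈ C([0,∞); X_1^*)` is a solution by transposition of `y₁'' + A y₁ + C* y₂ = 0`,
`y₂'' + A y₂ = B v`, `Y(0) = Y₀`, for an unbounded control operator `B ∈ L(G, H_2')`; here
`g = B* w₂ ∈ L²(0,T;G)`. -/
def IsTranspositionUnbounded (A : H →ₗ.[ℝ] H) (C : H →L[ℝ] H) (B : G →L[ℝ] Hneg2 A)
    (v : ℝ → G) (Y₀ : XposStar A) (Y : ℝ → XposStar A) : Prop :=
  ContinuousOn Y (Ici 0) ∧
  ∀ T : ℝ, 0 < T → ∀ (w₁ : ℝ → H) (w₂ : ℝ → H1 A) (q₁ : ℝ → Hneg1 A) (q₂ : ℝ → H),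
    IsDual1 A C T w₁ w₂ q₁ q₂ →
    ∃ g : ℝ → G, IsObservation (obsUnbounded B) T w₂ q₂ g ∧
      ∫ t in (0 : ℝ)..T, inner ℝ (v t) (g t) =
        pairPos (Y T) (w₁ T) (w₂ T) (q₁ T) (q₂ T) - pairPos Y₀ (w₁ 0) (w₂ 0) (q₁ 0) (q₂ 0)

end Cascade

end

/-! Coordinates. By (A1), `H` is the Hilbert sum of the eigenspaces of `A`, so `R = A ^ (-1/2)`,
`cos (t A ^ (1/2))` and `sin (t A ^ (1/2))` act by multipliers. A wave pair is read in `H × H` as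
`(A^{1/2} w, w')`, `(w, A^{-1/2} w')` or `(A^{-1/2} w, A^{-1} w')`, according to its regularity. In
all three readings the free equation is the same unitary group `G t = exp (t J R⁻¹)` with `J (a, b)
= (b, -a)`, and the weak solutions of the statement are exactly the mild ones (`isWave1_iff`,
`isWave0_iff`, `isWaveNeg1_iff`), which are unique. The cascade has the flow `(x₁, x₂) ↦ (G t x₁, G
t (x₂ + L t x₁))`, where `L t = ∫₀ᵗ G (-s) N G s ds` and the coupling `N` is bounded. At the lowest
level this uses the extension `D = A^{-1/2} C A^{1/2}` of `C`, bounded because `C*` is bounded on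
`H_1`.

Observability (`exists_time_observability`). On a window of length `τ`, (A5) for the free part of
`x₂` and (A4) for the response to `x₁` give `‖x₂‖² ≤ K (I + ‖x₁‖²)`, where `I` is the observed
energy; this holds at time `0` and at time `nτ`. On the other hand the quantity `⟨x₁(t), J x₂(t)⟩`
changes exactly by `-∫ ⟨C a, a⟩`, with `a` the first component of `G s x₁` (`integral_inner_le`). By
(A2) and (A3) this integral over `[0, nτ]` is at least `n c₀ ‖x₁‖²`. Hence `n c₀ ‖x₁‖ ≤ ‖x₂(0)‖ +
‖x₂(nτ)‖`, and for large `n` the term `K ‖x₁‖²` is absorbed.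

Control (`exists_control`). This is the Hilbert uniqueness method: the observation map `Φ` is
bounded by (A4) and bounded below by observability, so `Φ*` is onto, and a control `v` with `Φ* v =
-Y₀` steers `Y₀` to rest. The state at time `t` is the transposed inverse of the cascade flow
applied to `Y₀ + Φ* (1_{(0,t)} v)`. Since the dual flow reaches every vector, the state is unique.

For unbounded `B` this applies directly. For bounded `B` the transposition formula contains `B* w₂`
with `w₂` only in `H`, whereas the hypotheses concern `B* w'`. The time primitive of a dual solution
in `X_{-1}` is a dual solution in `X_1` whose velocity is `w₂` (`PhaseGroup.IsCascade.primitive`),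
and the change of data is an isomorphism, so observability is transferred. -/

set_option linter.unusedSectionVars false

noncomputable section

namespace Cascade

universe u v

/-! ### Multiplier operators on a Hilbert sum -/

section Diagonal

variable {H : Type u} [NormedAddCommGroup H] [InnerProductSpace ℝ H] [CompleteSpace H]
variable {ι : Type*} {V : ι → Submodule ℝ H} [∀ i, CompleteSpace (V i)]

/-- The property that `H` is the Hilbert sum of the family of its closed subspaces `V i`. -/
abbrev IsDecomposition (V : ι → Submodule ℝ H) : Prop :=
  IsHilbertSum ℝ (fun i => V i) fun i => (V i).subtypeₗᵢ

lemma IsDecomposition.inner_eq_zero {V : ι → Submodule ℝ H} (hV : IsDecomposition V) {i j : ι} (hij : i ≠ j) {x y : H}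
    (hx : x ∈ V i) (hy : y ∈ V j) : inner ℝ x y = 0 :=
  hV.OrthogonalFamily hij ⟨x, hx⟩ ⟨y, hy⟩

lemma IsDecomposition.proj_of_ne (hV : IsDecomposition V) {i j : ι} (hij : i ≠ j) {x : H}
    (hx : x ∈ V i) : (V j).starProjection x = 0 := by
  rw [Submodule.starProjection_apply_eq_zero_iff, Submodule.mem_orthogonal]
  intro u hu
  exact hV.inner_eq_zero hij.symm hu hx

lemma IsDecomposition.proj_tsum (hV : IsDecomposition V) {y : ι → H} (hy : ∀ i, y i ∈ V i)
    {s : H} (hs : HasSum y s) (j : ι) : (V j).starProjection s = y j := by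
  have h1 := hs.mapL (V j).starProjection
  refine h1.unique ?_
  have : (V j).starProjection (y j) = y j := Submodule.starProjection_eq_self_iff.2 (hy j)
  conv => arg 2; rw [← this]
  exact hasSum_single j fun i hij => hV.proj_of_ne hij (hy i)

lemma IsDecomposition.hasSum_proj (hV : IsDecomposition V) (x : H) :
    HasSum (fun i => (V i).starProjection x) x := by
  have h := hV.hasSum_linearIsometryEquiv_symm (hV.linearIsometryEquiv x)
  rw [LinearIsometryEquiv.symm_apply_apply] at h
  have e : (fun i => (V i).starProjection x) =
      fun i => (V i).subtypeₗᵢ (hV.linearIsometryEquiv x i) :=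
    funext fun i => hV.proj_tsum (fun i => (hV.linearIsometryEquiv x i).2) h i
  rw [e]; exact h

lemma IsDecomposition.hasSum_norm_sq (hV : IsDecomposition V) (x : H) :
    HasSum (fun i => ‖(V i).starProjection x‖ ^ 2) (‖x‖ ^ 2) := by
  have h := (hV.hasSum_proj x).mapL (innerSL ℝ x)
  simp only [innerSL_apply_apply, real_inner_self_eq_norm_sq] at h
  have e : (fun i => ‖(V i).starProjection x‖ ^ 2) =
      fun i => inner ℝ x ((V i).starProjection x) := by
    funext i
    rw [← real_inner_self_eq_norm_sq, Submodule.inner_starProjection_left_eq_right,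
      Submodule.starProjection_eq_self_iff.2 (Submodule.starProjection_apply_mem _ _)]
  rw [e]; exact h

lemma IsDecomposition.ext (hV : IsDecomposition V) {x y : H}
    (h : ∀ i, (V i).starProjection x = (V i).starProjection y) : x = y :=
  (hV.hasSum_proj x).unique (by simpa [h] using hV.hasSum_proj y)

lemma IsDecomposition.summable_smul (hV : IsDecomposition V) (c : ι → ℝ) (x : H) :
    (Summable fun i => c i • (V i).starProjection x) ↔
      Summable fun i => c i ^ 2 * ‖(V i).starProjection x‖ ^ 2 := by
  have := hV.OrthogonalFamily.summable_iff_norm_sq_summable fun i =>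
    (⟨c i • (V i).starProjection x,
      (V i).smul_mem _ (Submodule.starProjection_apply_mem _ _)⟩ : V i)
  simpa [norm_smul, mul_pow] using this

lemma IsDecomposition.summable_smul_of_bound (hV : IsDecomposition V) {m : ι → ℝ} {M : ℝ}
    (hM : ∀ i, |m i| ≤ M) (x : H) : Summable fun i => m i • (V i).starProjection x := by
  rw [hV.summable_smul]
  refine Summable.of_nonneg_of_le (fun i => by positivity) (fun i => ?_)
    ((hV.hasSum_norm_sq x).summable.mul_left (M ^ 2))
  have := sq_le_sq' (by linarith [neg_abs_le (m i), hM i]) ((le_abs_self (m i)).trans (hM i))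
  gcongr

lemma IsDecomposition.hasSum_norm_sq_smul (hV : IsDecomposition V) {m : ι → ℝ} {M : ℝ}
    (hM : ∀ i, |m i| ≤ M) (x : H) :
    HasSum (fun i => m i ^ 2 * ‖(V i).starProjection x‖ ^ 2)
      (‖∑' i, m i • (V i).starProjection x‖ ^ 2) := by
  convert hV.hasSum_norm_sq (∑' i, m i • (V i).starProjection x) using 2 with i
  rw [hV.proj_tsum (fun i => (V i).smul_mem _ (Submodule.starProjection_apply_mem _ _))
    (hV.summable_smul_of_bound hM x).hasSum i, norm_smul, mul_pow, Real.norm_eq_abs, sq_abs]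

/-- The operator which acts on `V i` as the multiplication by `m i`, for bounded `m`. -/
def IsDecomposition.diag (hV : IsDecomposition V) (m : ι → ℝ) {M : ℝ} (hM : ∀ i, |m i| ≤ M) :
    H →L[ℝ] H :=
  LinearMap.mkContinuous
    { toFun := fun x => ∑' i, m i • (V i).starProjection x
      map_add' := by
        intro x y
        rw [← (hV.summable_smul_of_bound hM x).tsum_add (hV.summable_smul_of_bound hM y)]
        simp [smul_add]
      map_smul' := by
        intro c x
        rw [RingHom.id_apply, ← (hV.summable_smul_of_bound hM x).tsum_const_smul c]
        simp [smul_comm c] } |M| (by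
      intro x
      refine abs_le_of_sq_le_sq' ?_ (by positivity) |>.2
      rw [mul_pow, sq_abs]
      refine hasSum_le (fun i => ?_) (hV.hasSum_norm_sq_smul hM x)
        ((hV.hasSum_norm_sq x).mul_left (M ^ 2))
      have := sq_le_sq' (by linarith [neg_abs_le (m i), hM i]) ((le_abs_self (m i)).trans (hM i))
      gcongr)

lemma IsDecomposition.diag_apply (hV : IsDecomposition V) (m : ι → ℝ) {M : ℝ}
    (hM : ∀ i, |m i| ≤ M) (x : H) : hV.diag m hM x = ∑' i, m i • (V i).starProjection x := rfl

lemma IsDecomposition.proj_diag (hV : IsDecomposition V) (m : ι → ℝ) {M : ℝ}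
    (hM : ∀ i, |m i| ≤ M) (x : H) (i : ι) :
    (V i).starProjection (hV.diag m hM x) = m i • (V i).starProjection x :=
  hV.proj_tsum (fun i => (V i).smul_mem _ (Submodule.starProjection_apply_mem _ _))
    (hV.summable_smul_of_bound hM x).hasSum i

lemma IsDecomposition.inner_diag (hV : IsDecomposition V) (m : ι → ℝ) {M : ℝ}
    (hM : ∀ i, |m i| ≤ M) (x y : H) :
    inner ℝ (hV.diag m hM x) y = inner ℝ x (hV.diag m hM y) := by
  have h1 := (hV.summable_smul_of_bound hM x).hasSum.mapL (innerSL ℝ y)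
  have h2 := (hV.summable_smul_of_bound hM y).hasSum.mapL (innerSL ℝ x)
  rw [real_inner_comm]
  refine h1.unique ?_
  have e : (fun i => innerSL ℝ y (m i • (V i).starProjection x)) =
      fun i => innerSL ℝ x (m i • (V i).starProjection y) := by
    funext i
    simp only [innerSL_apply_apply, inner_smul_right]
    rw [← Submodule.inner_starProjection_left_eq_right, real_inner_comm]
  rw [e]; exact h2

/-- By Parseval, the squared distance is a series of continuous terms dominated by `(2M)² ‖P_i x‖²`.
Only strong continuity can be expected, since the multipliers need not converge uniformly in `i`. -/
lemma IsDecomposition.continuous_diag (hV : IsDecomposition V) {m : ℝ → ι → ℝ} {M : ℝ}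
    (hM : ∀ t i, |m t i| ≤ M) (hm : ∀ i, Continuous fun t => m t i) (x : H) :
    Continuous fun t => hV.diag (m t) (hM t) x := by
  rw [continuous_iff_continuousAt]
  intro t₀
  have hb : ∀ t i, |m t i - m t₀ i| ≤ 2 * M := fun t i => by
    have := abs_sub (m t i) (m t₀ i); linarith [hM t i, hM t₀ i]
  have key : ∀ t, ‖hV.diag (m t) (hM t) x - hV.diag (m t₀) (hM t₀) x‖ ^ 2 =
      ∑' i, (m t i - m t₀ i) ^ 2 * ‖(V i).starProjection x‖ ^ 2 := by
    intro t
    rw [(hV.hasSum_norm_sq_smul (hb t) x).tsum_eq, hV.diag_apply, hV.diag_apply,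
      ← (hV.summable_smul_of_bound (hM t) x).tsum_sub (hV.summable_smul_of_bound (hM t₀) x)]
    simp [sub_smul]
  have hc : Continuous fun t => ∑' i, (m t i - m t₀ i) ^ 2 * ‖(V i).starProjection x‖ ^ 2 := by
    refine continuous_tsum (fun i => ?_)
      ((hV.hasSum_norm_sq x).summable.mul_left ((2 * M) ^ 2)) (fun i t => ?_)
    · have := hm i; fun_prop
    · rw [Real.norm_eq_abs, abs_of_nonneg (by positivity)]
      have := sq_le_sq' (by linarith [neg_abs_le (m t i - m t₀ i), hb t i])
        ((le_abs_self _).trans (hb t i))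
      gcongr
  rw [ContinuousAt, tendsto_iff_norm_sub_tendsto_zero]
  have h0 := (hc.sqrt).tendsto t₀
  simp only [← key, Real.sqrt_sq (norm_nonneg _)] at h0
  simpa using h0

end Diagonal

/-! ### Spectral decomposition of `A` and the wave propagators -/

section Spectral

variable {H : Type u} [NormedAddCommGroup H] [InnerProductSpace ℝ H] [CompleteSpace H]
variable {A : H →ₗ.[ℝ] H}

lemma A1.symmetric (hA : A1 A) (x y : A.domain) :
    inner ℝ (A x) (y : H) = inner ℝ (x : H) (A y) := by
  have h := LinearPMap.adjoint_isFormalAdjoint hA.selfAdjoint.dense_domain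
  rw [LinearPMap.isSelfAdjoint_def.1 hA.selfAdjoint] at h
  exact h x y

/-- Through the resolvent, the eigenspace is the fixed space of the bounded operator `(l - μ) R`. -/
lemma A1.isClosed_eigenspace (hA : A1 A) (l : ℝ) :
    IsClosed (eigenspace A l : Set H) := by
  obtain ⟨μ, R, -, h1, h2⟩ := hA.compactResolvent
  have : (eigenspace A l : Set H) = {x | R ((l - μ) • x) = x} := by
    ext x
    constructor
    · rintro ⟨hx, e⟩
      have := h2 ⟨x, hx⟩
      rw [e] at this
      simpa [sub_smul] using this
    · intro hx
      obtain ⟨h, e⟩ := h1 ((l - μ) • x)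
      have hx' : R ((l - μ) • x) = x := hx
      simp only [hx'] at h e
      refine ⟨h, ?_⟩
      rw [sub_eq_iff_eq_add] at e
      rw [e]; module
  rw [this]
  exact isClosed_eq (by fun_prop) continuous_id

lemma A1.inner_eigenspace (hA : A1 A) {l m : ℝ} (hlm : l ≠ m) {x y : H}
    (hx : x ∈ eigenspace A l) (hy : y ∈ eigenspace A m) : inner ℝ x y = 0 := by
  obtain ⟨hx, ex⟩ := hx
  obtain ⟨hy, ey⟩ := hy
  have := hA.symmetric ⟨x, hx⟩ ⟨y, hy⟩
  rw [ex, ey, inner_smul_left, inner_smul_right] at this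
  have h2 : (l - m) * inner ℝ x y = 0 := by
    simp only [conj_trivial] at this; linarith
  exact (mul_eq_zero.1 h2).resolve_left (sub_ne_zero.2 hlm)

lemma A1.le_of_mem_eigenspace (hA : A1 A) {ω : ℝ}
    (hω : ∀ u : A.domain, ω * ‖(u : H)‖ ≤ ‖A u‖) {l : ℝ} {x : H} (hx : x ∈ eigenspace A l)
    (h0 : x ≠ 0) : ω ≤ l := by
  obtain ⟨hx, ex⟩ := hx
  have h1 := hA.nonneg ⟨x, hx⟩
  have h2 := hω ⟨x, hx⟩
  rw [ex, inner_smul_left, real_inner_self_eq_norm_sq] at h1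
  rw [ex, norm_smul] at h2
  have hp : 0 < ‖x‖ := norm_pos_iff.2 h0
  have hl : 0 ≤ l := by
    by_contra hl
    have : l * ‖x‖ ^ 2 < 0 := mul_neg_of_neg_of_pos (not_le.1 hl) (by positivity)
    simp at h1; linarith
  rw [Real.norm_of_nonneg hl] at h2
  exact le_of_mul_le_mul_right h2 hp

/-- The spectral theorem for the compact symmetric resolvent `R` gives completeness: an eigenvector
of `R` for `κ` is an eigenvector of `A` for `μ + κ⁻¹`. -/
lemma A1.orthogonal_eigenspaces (hA : A1 A) {x : H}
    (hx : ∀ l : ℝ≥0, ∀ y ∈ eigenspace A l, inner ℝ y x = 0) : x = 0 := by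
  obtain ⟨μ, R, hR, h1, h2⟩ := hA.compactResolvent
  have hsymm : (R : H →ₗ[ℝ] H).IsSymmetric := by
    intro x y
    obtain ⟨hx, ex⟩ := h1 x
    obtain ⟨hy, ey⟩ := h1 y
    have := hA.symmetric ⟨R x, hx⟩ ⟨R y, hy⟩
    change inner ℝ (R x) y = inner ℝ x (R y)
    conv_lhs => rw [← ey]
    conv_rhs => rw [← ex]
    rw [inner_sub_left, inner_sub_right, this, inner_smul_left, inner_smul_right]
    simp
  have hbot := ContinuousLinearMap.orthogonalComplement_iSup_eigenspaces_eq_bot hR hsymm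
  rw [← Submodule.mem_bot ℝ, ← hbot, Submodule.mem_orthogonal]
  intro u hu
  have hle : (⨆ κ, Module.End.eigenspace (R : Module.End ℝ H) κ) ≤ (ℝ ∙ x)ᗮ := by
    refine iSup_le fun κ y hy => ?_
    rw [Submodule.mem_orthogonal_singleton_iff_inner_right, real_inner_comm]
    rw [Module.End.mem_eigenspace_iff] at hy
    change R y = κ • y at hy
    by_cases hy0 : y = 0
    · simp [hy0]
    obtain ⟨hRy, e⟩ := h1 y
    -- `R` is injective: `R y = 0` forces `y = A (R y) - μ R y = 0`.
    have hκ : κ ≠ 0 := by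
      rintro rfl
      rw [zero_smul] at hy
      have : (⟨R y, hRy⟩ : A.domain) = 0 := Subtype.ext hy
      rw [this, A.map_zero, hy] at e
      simp at e; exact hy0 e.symm
    have hyd : y ∈ A.domain := by
      have := A.domain.smul_mem κ⁻¹ hRy
      rwa [hy, smul_smul, inv_mul_cancel₀ hκ, one_smul] at this
    have hye : y ∈ eigenspace A (μ + κ⁻¹) := by
      refine ⟨hyd, ?_⟩
      have e2 : (⟨R y, hRy⟩ : A.domain) = κ • ⟨y, hyd⟩ := Subtype.ext hy
      rw [e2, A.map_smul, hy] at e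
      have e3 : κ • A ⟨y, hyd⟩ = y + κ • μ • y := by
        rw [sub_eq_iff_eq_add] at e
        rw [e]; module
      calc A ⟨y, hyd⟩ = κ⁻¹ • κ • A ⟨y, hyd⟩ := by rw [smul_smul, inv_mul_cancel₀ hκ, one_smul]
        _ = (μ + κ⁻¹) • y := by
          rw [e3, smul_add, smul_smul, inv_mul_cancel₀ hκ]; module
    obtain ⟨ω, hω0, hω⟩ := hA.coercive
    have hl : 0 ≤ μ + κ⁻¹ := hω0.le.trans (hA.le_of_mem_eigenspace hω hye hy0)
    exact hx ⟨_, hl⟩ y hye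
  have := hle hu
  rwa [Submodule.mem_orthogonal_singleton_iff_inner_right, real_inner_comm] at this

/-- The spectral subspaces of `A`. -/
def specSpace (A : H →ₗ.[ℝ] H) (l : ℝ≥0) : Submodule ℝ H :=
  (eigenspace A l).topologicalClosure

instance (l : ℝ≥0) : CompleteSpace (specSpace A l) :=
  inferInstanceAs (CompleteSpace (eigenspace A l).topologicalClosure)

lemma A1.specSpace_eq (hA : A1 A) (l : ℝ≥0) : specSpace A l = eigenspace A l :=
  (hA.isClosed_eigenspace l).submodule_topologicalClosure_eq

lemma A1.isDecomposition (hA : A1 A) : IsDecomposition (specSpace A) := by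
  refine IsHilbertSum.mkInternal (F := specSpace A) ?_ ?_
  · rintro l m hlm ⟨x, hx⟩ ⟨y, hy⟩
    rw [hA.specSpace_eq] at hx hy
    exact hA.inner_eigenspace (fun h => hlm (NNReal.coe_injective h)) hx hy
  · rw [top_le_iff, Submodule.topologicalClosure_eq_top_iff, eq_bot_iff]
    intro x hx
    rw [Submodule.mem_orthogonal] at hx
    rw [Submodule.mem_bot]
    refine hA.orthogonal_eigenspaces fun l y hy => hx y ?_
    refine (le_iSup (specSpace A) l) ?_
    rw [hA.specSpace_eq]; exact hy

variable (A) in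
/-- The operators `A ^ (-1/2)`, `cos (t A ^ (1/2))`, `sin (t A ^ (1/2))`, and the properties of
these operators which characterise the solutions of the wave equation. -/
structure WaveCalculus where
  /-- `A ^ (-1/2)` -/
  R : H →L[ℝ] H
  /-- `cos (t A ^ (1/2))` -/
  Cos : ℝ → H →L[ℝ] H
  /-- `sin (t A ^ (1/2))` -/
  Sin : ℝ → H →L[ℝ] H
  R_symm : ∀ x y, inner ℝ (R x) y = inner ℝ x (R y)
  mem_half : ∀ x, R x ∈ (fracPow A (1 / 2)).domain
  half_R : ∀ x, fracPow A (1 / 2) ⟨R x, mem_half x⟩ = x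
  R_half : ∀ u : (fracPow A (1 / 2)).domain, R (fracPow A (1 / 2) u) = u
  mem_A : ∀ x, R (R x) ∈ A.domain
  A_R : ∀ x, A ⟨R (R x), mem_A x⟩ = x
  R_A : ∀ u : A.domain, R (R (A u)) = u
  tsum_neg_half : ∀ x, ∑' l : ℝ≥0, ((l : ℝ) ^ (-(1 / 2) : ℝ)) • eigenProj A l x = R x
  Cos_symm : ∀ t x y, inner ℝ (Cos t x) y = inner ℝ x (Cos t y)
  Sin_symm : ∀ t x y, inner ℝ (Sin t x) y = inner ℝ x (Sin t y)
  R_Cos : ∀ t x, R (Cos t x) = Cos t (R x)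
  R_Sin : ∀ t x, R (Sin t x) = Sin t (R x)
  Cos_zero : ∀ x, Cos 0 x = x
  Sin_zero : ∀ x, Sin 0 x = 0
  Cos_neg : ∀ t x, Cos (-t) x = Cos t x
  Sin_neg : ∀ t x, Sin (-t) x = -Sin t x
  Cos_add : ∀ s t x, Cos (s + t) x = Cos s (Cos t x) - Sin s (Sin t x)
  Sin_add : ∀ s t x, Sin (s + t) x = Sin s (Cos t x) + Cos s (Sin t x)
  continuous_Cos : ∀ x, Continuous fun t => Cos t x
  continuous_Sin : ∀ x, Continuous fun t => Sin t x
  R_Cos_eq : ∀ t x, R (Cos t x) = R x - ∫ s in (0 : ℝ)..t, Sin s x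
  R_Sin_eq : ∀ t x, R (Sin t x) = ∫ s in (0 : ℝ)..t, Cos s x

/-- Testing against an eigenvector `φ`, symmetry gives `⟨A u, φ⟩ = l ⟨u, φ⟩`. -/
lemma A1.proj_apply (hA : A1 A) (u : A.domain) (l : ℝ≥0) :
    (specSpace A l).starProjection (A u) = (l : ℝ) • (specSpace A l).starProjection (u : H) := by
  refine (Submodule.eq_starProjection_of_mem_of_inner_eq_zero
    ((specSpace A l).smul_mem _ (Submodule.starProjection_apply_mem _ _)) ?_)
  intro φ hφ
  have h1 : inner ℝ ((u : H) - (specSpace A l).starProjection (u : H)) φ = 0 :=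
    Submodule.starProjection_inner_eq_zero _ φ hφ
  rw [hA.specSpace_eq] at hφ
  obtain ⟨hd, e⟩ := hφ
  have h2 := hA.symmetric u ⟨φ, hd⟩
  rw [e, inner_smul_right] at h2
  rw [inner_sub_left] at h1 ⊢
  rw [h2, real_inner_smul_left]
  linear_combination (l : ℝ) * h1

lemma A1.proj_eq_zero (hA : A1 A) {ω : ℝ}
    (hω : ∀ u : A.domain, ω * ‖(u : H)‖ ≤ ‖A u‖) {l : ℝ≥0} (hl : (l : ℝ) < ω) (x : H) :
    (specSpace A l).starProjection x = 0 := by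
  by_contra h0
  have := hA.le_of_mem_eigenspace hω ((hA.specSpace_eq l).le
    (Submodule.starProjection_apply_mem (specSpace A l) x)) h0
  linarith

theorem A1.waveCalculus (hA : A1 A) : Nonempty (WaveCalculus A) := by
  obtain ⟨ω, hω0, hω⟩ := hA.coercive
  have hV := hA.isDecomposition
  -- The spectral spaces with `l < ω` vanish, so replacing `l` by `max l ω` changes no operator and
  -- makes `1 / σ` bounded on the whole index set.
  let σ : ℝ≥0 → ℝ := fun l => √(max (l : ℝ) ω)
  have hσ : ∀ l, 0 < σ l := fun l => Real.sqrt_pos.2 (lt_max_of_lt_right hω0)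
  have hσb : ∀ l, |(σ l)⁻¹| ≤ (√ω)⁻¹ := fun l => by
    rw [abs_of_pos (inv_pos.2 (hσ l))]
    exact inv_anti₀ (Real.sqrt_pos.2 hω0) (Real.sqrt_le_sqrt (le_max_right _ _))
  have hσl : ∀ (l : ℝ≥0), (l : ℝ) < ω ∨ (l : ℝ) = σ l ^ 2 := fun l => by
    rcases lt_or_ge (l : ℝ) ω with h | h
    · exact Or.inl h
    · right
      simp only [σ]
      rw [max_eq_left h, Real.sq_sqrt l.coe_nonneg]
  have hpow : ∀ (l : ℝ≥0), (l : ℝ) = σ l ^ 2 → ((l : ℝ) ^ (1 / 2 : ℝ) = σ l) ∧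
      ((l : ℝ) ^ (-(1 / 2) : ℝ) = (σ l)⁻¹) := fun l h => by
    have : (l : ℝ) ^ (1 / 2 : ℝ) = σ l := by
      rw [h, ← Real.sqrt_eq_rpow, Real.sqrt_sq (hσ l).le]
    exact ⟨this, by rw [Real.rpow_neg l.coe_nonneg, this]⟩
  have hcb : ∀ t l, |Real.cos (t * σ l)| ≤ 1 := fun t l => Real.abs_cos_le_one _
  have hsb : ∀ t l, |Real.sin (t * σ l)| ≤ 1 := fun t l => Real.abs_sin_le_one _
  let R := hV.diag (fun l => (σ l)⁻¹) hσb
  let Co := fun t => hV.diag (fun l => Real.cos (t * σ l)) (hcb t)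
  let Si := fun t => hV.diag (fun l => Real.sin (t * σ l)) (hsb t)
  have pR : ∀ x l, (specSpace A l).starProjection (R x) =
      (σ l)⁻¹ • (specSpace A l).starProjection x := fun x l => hV.proj_diag _ _ x l
  have pC : ∀ t x l, (specSpace A l).starProjection (Co t x) =
      Real.cos (t * σ l) • (specSpace A l).starProjection x := fun t x l => hV.proj_diag _ _ x l
  have pS : ∀ t x l, (specSpace A l).starProjection (Si t x) =
      Real.sin (t * σ l) • (specSpace A l).starProjection x := fun t x l => hV.proj_diag _ _ x l
  have cC : ∀ x, Continuous fun t => Co t x :=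
    hV.continuous_diag hcb (fun l => by fun_prop)
  have cS : ∀ x, Continuous fun t => Si t x :=
    hV.continuous_diag hsb (fun l => by fun_prop)
  have hR_A : ∀ u : A.domain, R (R (A u)) = u := fun u => by
    refine hV.ext fun l => ?_
    rw [pR, pR, hA.proj_apply]
    rcases hσl l with h | h
    · simp [hA.proj_eq_zero hω h]
    · rw [h, smul_smul, smul_smul]
      have := (hσ l).ne'
      field_simp
      simp
  have hRs : ∀ x y, inner ℝ (R x) y = inner ℝ x (R y) := hV.inner_diag _ _
  -- Self-adjointness supplies the domain: `⟨x, u⟩ = ⟨R R x, A u⟩` for all `u` in the domain puts `R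
  -- R x` in the domain of the adjoint, which is `A`.
  have hA_R : ∀ x, ∃ h : R (R x) ∈ A.domain, A ⟨R (R x), h⟩ = x := fun x => by
    have hw : ∀ u : A.domain, inner ℝ x (u : H) = inner ℝ (R (R x)) (A u) := fun u => by
      rw [hRs, hRs, hR_A]
    have hmem := LinearPMap.mem_adjoint_domain_of_exists (T := A) (R (R x)) ⟨x, hw⟩
    have h : ∃ h : R (R x) ∈ A.adjoint.domain, A.adjoint ⟨R (R x), h⟩ = x :=
      ⟨hmem, LinearPMap.adjoint_apply_eq hA.selfAdjoint.dense_domain ⟨_, hmem⟩ hw⟩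
    rwa [LinearPMap.isSelfAdjoint_def.1 hA.selfAdjoint] at h
  have hterm : ∀ x (l : ℝ≥0), ((l : ℝ) ^ (1 / 2 : ℝ)) • eigenProj A l (R x) =
      (specSpace A l).starProjection x := fun x l => by
    change _ • (specSpace A l).starProjection (R x) = _
    rcases hσl l with h | h
    · simp [hA.proj_eq_zero hω h]
    · rw [pR, (hpow l h).1, smul_smul, mul_inv_cancel₀ (hσ l).ne', one_smul]
  have hmem : ∀ x, R x ∈ (fracPow A (1 / 2)).domain := fun x => by
    change Summable fun l : ℝ≥0 => ((l : ℝ) ^ (1 / 2 : ℝ)) • eigenProj A l (R x)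
    simp only [hterm]
    exact (hV.hasSum_proj x).summable
  refine ⟨{
    R := R, Cos := Co, Sin := Si
    R_symm := hRs
    mem_half := hmem
    half_R := fun x => ?_
    R_half := fun u => ?_
    mem_A := fun x => (hA_R x).1
    A_R := fun x => (hA_R x).2
    R_A := hR_A
    tsum_neg_half := fun x => ?_
    Cos_symm := fun t => hV.inner_diag _ _
    Sin_symm := fun t => hV.inner_diag _ _
    R_Cos := fun t x => hV.ext fun l => by rw [pR, pC, pC, pR, smul_comm]
    R_Sin := fun t x => hV.ext fun l => by rw [pR, pS, pS, pR, smul_comm]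
    Cos_zero := fun x => hV.ext fun l => by simp [pC]
    Sin_zero := fun x => hV.ext fun l => by simp [pS]
    Cos_neg := fun t x => hV.ext fun l => by simp [pC]
    Sin_neg := fun t x => hV.ext fun l => by simp [pS]
    Cos_add := fun s t x => hV.ext fun l => by
      rw [map_sub, pC, pC, pC, pS, pS, add_mul, Real.cos_add]; module
    Sin_add := fun s t x => hV.ext fun l => by
      rw [map_add, pS, pS, pC, pC, pS, add_mul, Real.sin_add]; module
    continuous_Cos := cC
    continuous_Sin := cS
    R_Cos_eq := fun t x => hV.ext fun l => ?_
    R_Sin_eq := fun t x => hV.ext fun l => ?_ }⟩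
  · change ∑' l : ℝ≥0, ((l : ℝ) ^ (1 / 2 : ℝ)) • eigenProj A l (R x) = x
    simp only [hterm]
    exact (hV.hasSum_proj x).tsum_eq
  · have hs : Summable fun l : ℝ≥0 => ((l : ℝ) ^ (1 / 2 : ℝ)) • eigenProj A l u := u.2
    refine hV.ext fun l => ?_
    have h2 := hV.proj_tsum (fun l => (specSpace A l).smul_mem ((l : ℝ) ^ (1 / 2 : ℝ))
      (Submodule.starProjection_apply_mem _ _)) hs.hasSum l
    rw [pR]
    change _ • (specSpace A l).starProjection
      (∑' l : ℝ≥0, ((l : ℝ) ^ (1 / 2 : ℝ)) • eigenProj A l (u : H)) = _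
    rw [h2]
    rcases hσl l with h | h
    · simp [hA.proj_eq_zero hω h]
    · rw [(hpow l h).1, smul_smul, inv_mul_cancel₀ (hσ l).ne', one_smul]
  · change _ = ∑' l, (σ l)⁻¹ • (specSpace A l).starProjection x
    refine tsum_congr fun l => ?_
    change _ • (specSpace A l).starProjection x = _
    rcases hσl l with h | h
    · simp [hA.proj_eq_zero hω h]
    · rw [(hpow l h).2]
  · rw [map_sub, ← ContinuousLinearMap.intervalIntegral_comp_comm _
      ((cS x).intervalIntegrable _ _), pR, pR, pC]
    simp only [pS]
    rw [intervalIntegral.integral_smul_const, smul_smul, ← sub_smul]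
    congr 1
    have h0 := (hσ l).ne'
    rw [intervalIntegral.integral_comp_mul_right (fun x => Real.sin x) h0, integral_sin]
    simp only [zero_mul, Real.cos_zero, smul_eq_mul]
    ring
  · rw [← ContinuousLinearMap.intervalIntegral_comp_comm _
      ((cC x).intervalIntegrable _ _), pR, pS]
    simp only [pC]
    rw [intervalIntegral.integral_smul_const, smul_smul]
    congr 1
    have h0 := (hσ l).ne'
    rw [intervalIntegral.integral_comp_mul_right (fun x => Real.cos x) h0, integral_cos]
    simp

end Spectral

/-! ### Abstract unitary groups, mild solutions and cascades -/

section AbstractGroup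

variable (E : Type*) [NormedAddCommGroup E] [InnerProductSpace ℝ E]

/-- A unitary group `G t = exp (t J R⁻¹)` on `E`, where `J` is skew-adjoint and isometric and `R` is
a bounded injective self-adjoint operator which commutes with `J`. -/
structure PhaseGroup where
  /-- the inverse of the modulus of the generator -/
  R : E →L[ℝ] E
  /-- the phase of the generator -/
  J : E →L[ℝ] E
  /-- the group -/
  G : ℝ → E →L[ℝ] E
  R_symm : ∀ x y, inner ℝ (R x) y = inner ℝ x (R y)
  R_inj : Function.Injective R
  J_skew : ∀ x y, inner ℝ (J x) y = -inner ℝ x (J y)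
  norm_J : ∀ x, ‖J x‖ = ‖x‖
  R_J : ∀ x, R (J x) = J (R x)
  G_J : ∀ t x, G t (J x) = J (G t x)
  G_R : ∀ t x, G t (R x) = R (G t x)
  G_symm : ∀ t x y, inner ℝ (G t x) y = inner ℝ x (G (-t) y)
  G_add : ∀ s t x, G (s + t) x = G s (G t x)
  G_zero : ∀ x, G 0 x = x
  continuous_G : ∀ x, Continuous fun t => G t x
  R_G_eq : ∀ t x, R (G t x) = R x + ∫ s in (0 : ℝ)..t, J (G s x)

variable {E}

namespace PhaseGroup

variable (P : PhaseGroup E)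

lemma G_neg_G (t : ℝ) (x : E) : P.G (-t) (P.G t x) = x := by
  rw [← P.G_add, neg_add_cancel, P.G_zero]

lemma G_G_neg (t : ℝ) (x : E) : P.G t (P.G (-t) x) = x := by
  rw [← P.G_add, add_neg_cancel, P.G_zero]

lemma inner_G (t : ℝ) (x y : E) : inner ℝ (P.G t x) (P.G t y) = inner ℝ x y := by
  rw [P.G_symm, P.G_neg_G]

lemma norm_G (t : ℝ) (x : E) : ‖P.G t x‖ = ‖x‖ := by
  rw [norm_eq_sqrt_real_inner, P.inner_G, ← norm_eq_sqrt_real_inner]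

/-- A strongly continuous family of isometries is jointly continuous in time and vector. -/
lemma continuous_G_apply {X : Type*} [TopologicalSpace X] {f : X → ℝ} {y : X → E}
    (hf : Continuous f) (hy : Continuous y) : Continuous fun s => P.G (f s) (y s) := by
  rw [continuous_iff_continuousAt]
  intro s₀
  rw [ContinuousAt, tendsto_iff_norm_sub_tendsto_zero]
  have h1 : Filter.Tendsto (fun s => ‖y s - y s₀‖ + ‖P.G (f s) (y s₀) - P.G (f s₀) (y s₀)‖)
      (nhds s₀) (nhds 0) := by
    have : Continuous fun s => ‖y s - y s₀‖ + ‖P.G (f s) (y s₀) - P.G (f s₀) (y s₀)‖ := by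
      have := (P.continuous_G (y s₀)).comp hf
      fun_prop
    simpa using this.tendsto s₀
  refine squeeze_zero (fun _ => norm_nonneg _) (fun s => ?_) h1
  calc ‖P.G (f s) (y s) - P.G (f s₀) (y s₀)‖
      = ‖P.G (f s) (y s - y s₀) + (P.G (f s) (y s₀) - P.G (f s₀) (y s₀))‖ := by
        rw [map_sub]; congr 1; abel
    _ ≤ _ := (norm_add_le _ _).trans (by rw [P.norm_G])

/-- `x` solves `x' = J R⁻¹ x + F` on `[0, T]`; the equation is integrated in time and multiplied
by `R`. -/
structure IsMild (T : ℝ) (F x : ℝ → E) : Prop where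
  cont : ContinuousOn x (Icc 0 T)
  eq : ∀ t ∈ Icc 0 T, P.R (x t) = P.R (x 0) + ∫ s in (0 : ℝ)..t, (P.J (x s) + P.R (F s))

variable {P}

lemma intervalIntegrable_of_continuousOn {F : Type*} [NormedAddCommGroup F] {T t : ℝ} {f : ℝ → F}
    (hf : ContinuousOn f (Icc 0 T)) (ht : t ∈ Icc 0 T) : IntervalIntegrable f volume 0 t :=
  (hf.mono (by rw [uIcc_of_le ht.1]; exact Icc_subset_Icc_right ht.2)).intervalIntegrable

lemma IsMild.congr {T : ℝ} {F F' x x' : ℝ → E} (h : P.IsMild T F x) (hF : EqOn F F' (Icc 0 T))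
    (hx : EqOn x x' (Icc 0 T)) : P.IsMild T F' x' := by
  refine ⟨h.cont.congr hx.symm, fun t ht => ?_⟩
  have h0 : (0 : ℝ) ∈ Icc 0 T := ⟨le_rfl, ht.1.trans ht.2⟩
  rw [← hx ht, ← hx h0, h.eq t ht]
  congr 1
  refine intervalIntegral.integral_congr fun s hs => ?_
  rw [uIcc_of_le ht.1] at hs
  have hs' : s ∈ Icc 0 T := ⟨hs.1, hs.2.trans ht.2⟩
  simp only [hx hs', hF hs']

variable (P) in
lemma continuous_duhamel_integrand (N : E →L[ℝ] E) (x : E) :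
    Continuous fun s => P.G (-s) (N (P.G s x)) :=
  P.continuous_G_apply continuous_neg (N.continuous.comp (P.continuous_G x))

variable (P) in
lemma norm_duhamel_integrand_le (N : E →L[ℝ] E) (x : E) (s : ℝ) :
    ‖P.G (-s) (N (P.G s x))‖ ≤ ‖N‖ * ‖x‖ := by
  rw [P.norm_G]
  exact (N.le_opNorm _).trans_eq (by rw [P.norm_G])

variable [CompleteSpace E]

/-- Energy argument for `e = R d`, which unlike `d` is differentiable: `(‖e‖²)' = 2 ⟨R d, J d⟩ = 0`,
because `R J` is skew. Injectivity of `R` then gives `d = 0`. -/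
lemma eq_zero_of_mild_zero {T : ℝ} {d : ℝ → E} (hd : ContinuousOn d (Icc 0 T))
    (h : ∀ t ∈ Icc 0 T, P.R (d t) = ∫ s in (0 : ℝ)..t, P.J (d s)) :
    ∀ t ∈ Icc 0 T, d t = 0 := by
  intro t₁ ht₁
  have hT : 0 ≤ T := ht₁.1.trans ht₁.2
  -- A continuous extension to the line makes the primitive differentiable at the end points too.
  let d' : ℝ → E := IccExtend hT ((Icc 0 T).domRestrict d)
  have hd' : Continuous d' := (continuousOn_iff_continuous_domRestrict.1 hd).Icc_extend'
  have hdd : EqOn d d' (Icc 0 T) := fun t ht => by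
    simp only [d', IccExtend_of_mem hT _ ht, domRestrict_apply]
  have h' : ∀ t ∈ Icc 0 T, P.R (d' t) = ∫ s in (0 : ℝ)..t, P.J (d' s) := fun t ht => by
    rw [← hdd ht, h t ht]
    refine intervalIntegral.integral_congr fun s hs => ?_
    rw [uIcc_of_le ht.1] at hs
    simp only [hdd ⟨hs.1, hs.2.trans ht.2⟩]
  let e : ℝ → E := fun t => ∫ s in (0 : ℝ)..t, P.J (d' s)
  have he : ∀ t, HasDerivAt e (P.J (d' t)) t := fun t =>
    ((P.J.continuous.comp hd').integral_hasStrictDerivAt 0 t).hasDerivAt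
  have hn : ∀ t, HasDerivAt (fun t => inner ℝ (e t) (e t))
      (inner ℝ (e t) (P.J (d' t)) + inner ℝ (P.J (d' t)) (e t)) t := fun t => (he t).inner ℝ (he t)
  have hz : ∀ t ∈ Ico 0 T, HasDerivWithinAt (fun t => inner ℝ (e t) (e t)) (0 : ℝ) (Ici t) t := by
    intro t ht
    have h0 : inner ℝ (e t) (P.J (d' t)) + inner ℝ (P.J (d' t)) (e t) = (0 : ℝ) := by
      have : e t = P.R (d' t) := (h' t (Ico_subset_Icc_self ht)).symm
      have h2 : inner ℝ (P.R (d' t)) (P.J (d' t)) = (0 : ℝ) := by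
        have h3 : inner ℝ (P.R (d' t)) (P.J (d' t)) = -inner ℝ (P.R (d' t)) (P.J (d' t)) := by
          conv_lhs => rw [P.R_symm, P.R_J, real_inner_comm, ← neg_neg (inner ℝ _ _),
            P.J_skew, neg_neg]
        linarith
      rw [this, real_inner_comm (P.R _), h2, add_zero]
    rw [← h0]
    exact (hn t).hasDerivWithinAt
  have hconst := constant_of_has_deriv_right_zero
    (fun t _ => (hn t).continuousAt.continuousWithinAt) hz t₁ ht₁
  simp only [e, intervalIntegral.integral_same, inner_zero_left] at hconst
  rw [inner_self_eq_zero] at hconst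
  rw [← h' t₁ ht₁, ← hdd ht₁] at hconst
  exact P.R_inj (by rw [hconst, map_zero])

lemma IsMild.unique {T : ℝ} {F x y : ℝ → E} (hF : ContinuousOn F (Icc 0 T)) (hx : P.IsMild T F x)
    (hy : P.IsMild T F y) (h0 : x 0 = y 0) : EqOn x y (Icc 0 T) := by
  have key := eq_zero_of_mild_zero (P := P) (hx.cont.sub hy.cont) (fun t ht => ?_)
  · exact fun t ht => sub_eq_zero.1 (key t ht)
  · have c1 : ContinuousOn (fun s => P.J (x s) + P.R (F s)) (Icc 0 T) :=
      (P.J.continuous.comp_continuousOn hx.cont).add (P.R.continuous.comp_continuousOn hF)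
    have c2 : ContinuousOn (fun s => P.J (y s) + P.R (F s)) (Icc 0 T) :=
      (P.J.continuous.comp_continuousOn hy.cont).add (P.R.continuous.comp_continuousOn hF)
    rw [Pi.sub_apply, map_sub, hx.eq t ht, hy.eq t ht, h0, add_sub_add_left_eq_sub,
      ← intervalIntegral.integral_sub (intervalIntegrable_of_continuousOn c1 ht)
        (intervalIntegrable_of_continuousOn c2 ht)]
    simp

/-- Set `y t = x₀ + ∫₀ᵗ G (-s) F s`. The curve `G t (y t)` need not be differentiable, but `⟨y t, R
G (-t) φ⟩` is for every `φ`, as `R` turns the group into a differentiable one. The fundamental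
theorem of calculus gives the equation tested against `φ`. -/
lemma isMild_duhamel {F : ℝ → E} (hF : Continuous F) (x₀ : E) (T : ℝ) :
    P.IsMild T F fun t => P.G t (x₀ + ∫ s in (0 : ℝ)..t, P.G (-s) (F s)) := by
  have hGF : Continuous fun s => P.G (-s) (F s) := P.continuous_G_apply continuous_neg hF
  have hy : ∀ t, HasDerivAt (fun t => x₀ + ∫ s in (0 : ℝ)..t, P.G (-s) (F s))
      (P.G (-t) (F t)) t := fun t =>
    (hGF.integral_hasStrictDerivAt 0 t).hasDerivAt.const_add _
  have hyc : Continuous fun t => x₀ + ∫ s in (0 : ℝ)..t, P.G (-s) (F s) :=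
    continuous_iff_continuousAt.2 fun t => (hy t).continuousAt
  have hxc := P.continuous_G_apply continuous_id hyc
  refine ⟨hxc.continuousOn, fun t _ => ?_⟩
  refine ext_inner_right ℝ fun φ => ?_
  have hφ : ∀ t, HasDerivAt (fun t => P.R (P.G (-t) φ)) (-P.J (P.G (-t) φ)) t := fun t => by
    have hc : Continuous fun s => P.J (P.G s φ) := P.J.continuous.comp (P.continuous_G φ)
    have h1 : HasDerivAt (fun t => P.R (P.G t φ)) (P.J (P.G (-t) φ)) (-t) := by
      have : (fun t => P.R (P.G t φ)) = fun t => P.R φ + ∫ s in (0 : ℝ)..t, P.J (P.G s φ) :=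
        funext fun t => P.R_G_eq t φ
      rw [this]
      exact (hc.integral_hasStrictDerivAt 0 (-t)).hasDerivAt.const_add _
    convert! h1.scomp t (hasDerivAt_neg t) using 1
    simp
  have hd : ∀ t, HasDerivAt
      (fun t => inner ℝ (x₀ + ∫ s in (0 : ℝ)..t, P.G (-s) (F s)) (P.R (P.G (-t) φ)))
      (inner ℝ (P.J (P.G t (x₀ + ∫ s in (0 : ℝ)..t, P.G (-s) (F s))) + P.R (F t)) φ) t := by
    intro t
    convert! (hy t).inner ℝ (hφ t) using 1
    rw [inner_add_left, inner_neg_right, ← P.J_skew, P.R_symm, P.G_symm (-t), neg_neg, ← P.G_R,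
      ← P.G_J, P.G_symm t, P.G_G_neg]
  have hJc : Continuous fun s =>
      P.J (P.G s (x₀ + ∫ r in (0 : ℝ)..s, P.G (-r) (F r))) + P.R (F s) :=
    (P.J.continuous.comp hxc).add (P.R.continuous.comp hF)
  have hint := intervalIntegral.integral_eq_sub_of_hasDerivAt (a := 0) (b := t)
    (fun s _ => hd s) ((hJc.inner continuous_const).intervalIntegrable _ _)
  have hcomm : inner ℝ (∫ s in (0 : ℝ)..t,
      (P.J (P.G s (x₀ + ∫ r in (0 : ℝ)..s, P.G (-r) (F r))) + P.R (F s))) φ =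
      ∫ s in (0 : ℝ)..t,
        inner ℝ (P.J (P.G s (x₀ + ∫ r in (0 : ℝ)..s, P.G (-r) (F r))) + P.R (F s)) φ := by
    rw [real_inner_comm, ← innerSL_apply_apply ℝ, ← ContinuousLinearMap.intervalIntegral_comp_comm _
      (hJc.intervalIntegrable _ _)]
    simp only [innerSL_apply_apply, real_inner_comm]
  rw [inner_add_left, hcomm, hint]
  simp only [intervalIntegral.integral_same, add_zero, neg_zero, P.G_zero]
  rw [P.R_symm, P.G_symm, P.R_symm, P.G_R]
  ring


variable (P) in
/-- The operator `∫ s in 0..t, G (-s) N G s`. -/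
def duhamel (N : E →L[ℝ] E) (t : ℝ) : E →L[ℝ] E :=
  LinearMap.mkContinuous
    { toFun := fun x => ∫ s in (0 : ℝ)..t, P.G (-s) (N (P.G s x))
      map_add' := by
        intro x y
        rw [← intervalIntegral.integral_add
          ((P.continuous_duhamel_integrand N x).intervalIntegrable _ _)
          ((P.continuous_duhamel_integrand N y).intervalIntegrable _ _)]
        simp
      map_smul' := by
        intro c x
        simp [intervalIntegral.integral_smul] } (‖N‖ * |t|) (by
      intro x
      have := intervalIntegral.norm_integral_le_of_norm_le_const (a := 0) (b := t)
        fun s _ => P.norm_duhamel_integrand_le N x s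
      rw [sub_zero] at this
      refine this.trans_eq (by ring))

lemma duhamel_apply (N : E →L[ℝ] E) (t : ℝ) (x : E) :
    P.duhamel N t x = ∫ s in (0 : ℝ)..t, P.G (-s) (N (P.G s x)) := rfl

lemma duhamel_zero (N : E →L[ℝ] E) : P.duhamel N 0 = 0 := by
  ext x; simp [duhamel_apply]

lemma norm_duhamel_le (N : E →L[ℝ] E) (t : ℝ) : ‖P.duhamel N t‖ ≤ ‖N‖ * |t| :=
  LinearMap.mkContinuous_norm_le _ (by positivity) _

/-- The Duhamel operator is Lipschitz in operator norm although the group is only strongly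
continuous. Norm continuity passes to the adjoints, which strong continuity alone would not. -/
lemma norm_duhamel_sub_le (N : E →L[ℝ] E) (s t : ℝ) :
    ‖P.duhamel N t - P.duhamel N s‖ ≤ ‖N‖ * |t - s| := by
  refine ContinuousLinearMap.opNorm_le_bound _ (by positivity) fun x => ?_
  rw [sub_apply, duhamel_apply, duhamel_apply,
    intervalIntegral.integral_interval_sub_left
      ((P.continuous_duhamel_integrand N x).intervalIntegrable _ _)
      ((P.continuous_duhamel_integrand N x).intervalIntegrable _ _)]
  refine (intervalIntegral.norm_integral_le_of_norm_le_const
    fun s _ => P.norm_duhamel_integrand_le N x s).trans_eq (by ring)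

lemma continuous_duhamel (N : E →L[ℝ] E) : Continuous (P.duhamel N) := by
  rw [continuous_iff_continuousAt]
  intro s
  rw [ContinuousAt, tendsto_iff_norm_sub_tendsto_zero]
  refine squeeze_zero (fun _ => norm_nonneg _) (fun t => P.norm_duhamel_sub_le N s t) ?_
  have : Continuous fun t => ‖N‖ * |t - s| := by fun_prop
  simpa using this.tendsto s

/-- `x₁` solves `x₁' = J R⁻¹ x₁` and `x₂` solves `x₂' = J R⁻¹ x₂ + N x₁` on `[0, T]`. -/
structure IsCascade (P : PhaseGroup E) (N : E →L[ℝ] E) (T : ℝ) (x₁ x₂ : ℝ → E) : Prop where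
  fst : P.IsMild T (fun _ => 0) x₁
  snd : P.IsMild T (fun s => N (x₁ s)) x₂

lemma isMild_G (x : E) (T : ℝ) : P.IsMild T (fun _ => 0) fun t => P.G t x := by
  have := isMild_duhamel (P := P) (F := fun _ => 0) continuous_const x T
  simpa using this

variable (P) in
lemma isCascade (N : E →L[ℝ] E) (x₁ x₂ : E) (T : ℝ) :
    P.IsCascade N T (fun t => P.G t x₁) fun t => P.G t (x₂ + P.duhamel N t x₁) :=
  ⟨isMild_G x₁ T, isMild_duhamel (N.continuous.comp (P.continuous_G x₁)) x₂ T⟩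

lemma IsMild.eq_G {T : ℝ} {x : ℝ → E} (h : P.IsMild T (fun _ => 0) x) {t : ℝ}
    (ht : t ∈ Icc 0 T) : x t = P.G t (x 0) :=
  h.unique continuousOn_const (isMild_G (x 0) T) (by simp [P.G_zero]) ht

lemma IsCascade.snd_eq {N : E →L[ℝ] E} {T : ℝ} {x₁ x₂ : ℝ → E} (h : P.IsCascade N T x₁ x₂) {t : ℝ}
    (ht : t ∈ Icc 0 T) : x₂ t = P.G t (x₂ 0 + P.duhamel N t (x₁ 0)) := by
  have h2 : P.IsMild T (fun s => N (P.G s (x₁ 0))) x₂ :=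
    h.snd.congr (fun s hs => by simp only [h.fst.eq_G hs]) fun _ _ => rfl
  exact h2.unique (N.continuous.comp (P.continuous_G _)).continuousOn
    (P.isCascade N (x₁ 0) (x₂ 0) T).snd (by simp [P.G_zero, duhamel_zero]) ht

/-- The multiplier identity of the cascade: for `N = 0` the pairing is conserved, since `G` is
unitary and commutes with `J`; the coupling contributes the integral. -/
lemma inner_J_cascade (N : E →L[ℝ] E) (t : ℝ) (x₁ x₂ : E) :
    inner ℝ (P.G t x₁) (P.J (P.G t (x₂ + P.duhamel N t x₁))) = inner ℝ x₁ (P.J x₂) +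
      ∫ s in (0 : ℝ)..t, inner ℝ (P.G s x₁) (P.J (N (P.G s x₁))) := by
  rw [← P.G_J, P.inner_G, map_add, inner_add_right, duhamel_apply]
  congr 1
  have hc : Continuous fun s => P.J (P.G (-s) (N (P.G s x₁))) :=
    P.J.continuous.comp (P.continuous_duhamel_integrand N x₁)
  rw [← ContinuousLinearMap.intervalIntegral_comp_comm _
    ((P.continuous_duhamel_integrand N x₁).intervalIntegrable _ _), ← innerSL_apply_apply ℝ,
    ← ContinuousLinearMap.intervalIntegral_comp_comm _ (hc.intervalIntegrable _ _)]
  refine intervalIntegral.integral_congr fun s _ => ?_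
  simp only [innerSL_apply_apply, P.G_symm s, ← P.G_J]

/-- The left factors are the transposed inverse of the cascade flow applied to `(l₁, l₂)`, that is,
the evolution of the uncontrolled primal system. -/
lemma inner_cascade (N : E →L[ℝ] E) (t : ℝ) (l₁ l₂ x₁ x₂ : E) :
    inner ℝ (P.G t (l₁ - ContinuousLinearMap.adjoint (P.duhamel N t) l₂)) (P.G t x₁) +
      inner ℝ (P.G t l₂) (P.G t (x₂ + P.duhamel N t x₁)) = inner ℝ l₁ x₁ + inner ℝ l₂ x₂ := by
  rw [P.inner_G, P.inner_G, inner_sub_left, inner_add_right,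
    ContinuousLinearMap.adjoint_inner_left]
  ring

/-- The cascade flow is onto: suitable data reach `(u, 0)` and `(0, u)` at time `t`. -/
lemma eq_of_inner_cascade {N : E →L[ℝ] E} {t : ℝ} {y₁ y₂ z₁ z₂ : E}
    (h : ∀ x₁ x₂, inner ℝ y₁ (P.G t x₁) + inner ℝ y₂ (P.G t (x₂ + P.duhamel N t x₁)) =
      inner ℝ z₁ (P.G t x₁) + inner ℝ z₂ (P.G t (x₂ + P.duhamel N t x₁))) :
    y₁ = z₁ ∧ y₂ = z₂ := by
  constructor
  · refine ext_inner_right ℝ fun u => ?_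
    have := h (P.G (-t) u) (-P.duhamel N t (P.G (-t) u))
    simpa [P.G_G_neg] using this
  · refine ext_inner_right ℝ fun u => ?_
    have := h 0 (P.G (-t) u)
    simpa [P.G_G_neg] using this

end PhaseGroup

end AbstractGroup

/-! ### The wave group on the phase space `H × H` -/

section Phase

variable {H : Type u} [NormedAddCommGroup H] [InnerProductSpace ℝ H]

variable (H) in
/-- The phase space `H × H` with its Hilbert space structure. -/
abbrev Phase : Type u := WithLp 2 (H × H)

/-- The point `(a, b)` of the phase space. -/
def pt (a b : H) : Phase H := WithLp.toLp 2 (a, b)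

@[simp] lemma pt_fst (a b : H) : (pt a b).fst = a := rfl

@[simp] lemma pt_snd (a b : H) : (pt a b).snd = b := rfl

lemma Phase.ext {x y : Phase H} (h1 : x.fst = y.fst) (h2 : x.snd = y.snd) : x = y :=
  WithLp.ofLp_injective 2 (Prod.ext h1 h2)

lemma Phase.inner_eq (x y : Phase H) :
    inner ℝ x y = inner ℝ x.fst y.fst + inner ℝ x.snd y.snd := rfl

lemma Phase.norm_sq_eq (x : Phase H) : ‖x‖ ^ 2 = ‖x.fst‖ ^ 2 + ‖x.snd‖ ^ 2 :=
  WithLp.prod_norm_sq_eq_of_L2 x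

lemma continuous_pt {X : Type*} [TopologicalSpace X] {a b : X → H} {s : Set X}
    (ha : ContinuousOn a s) (hb : ContinuousOn b s) : ContinuousOn (fun t => pt (a t) (b t)) s :=
  (WithLp.prod_continuous_toLp 2 H H).comp_continuousOn (ha.prodMk hb)

/-- The operator with the matrix `a, b; c, d`. -/
def mat (a b c d : H →L[ℝ] H) : Phase H →L[ℝ] Phase H :=
  ((WithLp.prodContinuousLinearEquiv 2 ℝ H H).symm : H × H →L[ℝ] Phase H).comp
    (((a.comp (WithLp.fstL 2 ℝ H H)) + b.comp (WithLp.sndL 2 ℝ H H)).prod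
      ((c.comp (WithLp.fstL 2 ℝ H H)) + d.comp (WithLp.sndL 2 ℝ H H)))

lemma mat_apply (a b c d : H →L[ℝ] H) (x : Phase H) :
    mat a b c d x = pt (a x.fst + b x.snd) (c x.fst + d x.snd) := rfl

variable [CompleteSpace H]

lemma integral_fst {f : ℝ → Phase H} {a b : ℝ} (hf : IntervalIntegrable f volume a b) :
    (∫ s in a..b, f s).fst = ∫ s in a..b, (f s).fst :=
  ((WithLp.fstL 2 ℝ H H).intervalIntegral_comp_comm hf).symm

lemma integral_snd {f : ℝ → Phase H} {a b : ℝ} (hf : IntervalIntegrable f volume a b) :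
    (∫ s in a..b, f s).snd = ∫ s in a..b, (f s).snd :=
  ((WithLp.sndL 2 ℝ H H).intervalIntegral_comp_comm hf).symm

variable {A : H →ₗ.[ℝ] H}

lemma WaveCalculus.R_injective (W : WaveCalculus A) : Function.Injective W.R := fun x y h => by
  rw [← W.half_R x, ← W.half_R y]
  simp only [h]

/-- The wave group on the phase space. -/
def WaveCalculus.phase (W : WaveCalculus A) : PhaseGroup (Phase H) where
  R := mat W.R 0 0 W.R
  J := mat 0 (ContinuousLinearMap.id ℝ H) (-ContinuousLinearMap.id ℝ H) 0
  G t := mat (W.Cos t) (W.Sin t) (-W.Sin t) (W.Cos t)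
  R_symm x y := by simp [mat_apply, W.R_symm]
  R_inj x y h := by
    simp only [mat_apply] at h
    have h1 := congrArg WithLp.fst h
    have h2 := congrArg WithLp.snd h
    simp only [pt_fst, pt_snd, zero_apply, add_zero, zero_add] at h1 h2
    exact Phase.ext (W.R_injective h1) (W.R_injective h2)
  J_skew x y := by simp [mat_apply, add_comm]
  norm_J x := by
    rw [← sq_eq_sq₀ (norm_nonneg _) (norm_nonneg _)]
    simp [mat_apply, Phase.norm_sq_eq, add_comm]
  R_J x := by simp [mat_apply]
  G_J t x := by
    refine Phase.ext ?_ ?_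
    · simp [mat_apply]
      abel
    · simp [mat_apply]
  G_R t x := by
    simp [mat_apply, W.R_Cos, W.R_Sin]
  G_symm t x y := by
    have hC : W.Cos (-t) = W.Cos t := ContinuousLinearMap.ext (W.Cos_neg t)
    have hS : W.Sin (-t) = -W.Sin t := ContinuousLinearMap.ext (W.Sin_neg t)
    simp only [mat_apply, Phase.inner_eq, pt_fst, pt_snd, hC, hS, inner_add_left, inner_add_right,
      W.Cos_symm, W.Sin_symm, neg_apply, inner_neg_left, inner_neg_right, neg_neg]
    ring
  G_add s t x := by
    refine Phase.ext ?_ ?_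
    · simp only [mat_apply, pt_fst, pt_snd, W.Cos_add, W.Sin_add, map_add, neg_apply, map_neg]
      abel
    · simp only [mat_apply, pt_fst, pt_snd, W.Cos_add, W.Sin_add, map_add, neg_apply, map_neg]
      abel
  G_zero x := by
    refine Phase.ext ?_ ?_ <;> simp [mat_apply, W.Cos_zero, W.Sin_zero]
  continuous_G x := by
    rw [← continuousOn_univ]
    simp only [mat_apply]
    refine continuous_pt ?_ ?_ <;> rw [continuousOn_univ]
    · exact (W.continuous_Cos _).add (W.continuous_Sin _)
    · exact (W.continuous_Sin _).neg.add (W.continuous_Cos _)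
  R_G_eq t x := by
    have c1 := (W.continuous_Cos x.fst).intervalIntegrable (μ := volume) 0 t
    have c2 := (W.continuous_Cos x.snd).intervalIntegrable (μ := volume) 0 t
    have c3 : IntervalIntegrable (fun s => -W.Sin s x.fst) volume 0 t :=
      (W.continuous_Sin x.fst).neg.intervalIntegrable _ _
    have c4 := (W.continuous_Sin x.snd).intervalIntegrable (μ := volume) 0 t
    have hc : Continuous fun s => pt (-W.Sin s x.fst + W.Cos s x.snd)
        (-(W.Cos s x.fst + W.Sin s x.snd)) := by
      rw [← continuousOn_univ]
      refine continuous_pt ?_ ?_ <;> rw [continuousOn_univ]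
      · exact (W.continuous_Sin _).neg.add (W.continuous_Cos _)
      · exact ((W.continuous_Cos _).add (W.continuous_Sin _)).neg
    have e : ∀ s, mat 0 (ContinuousLinearMap.id ℝ H) (-ContinuousLinearMap.id ℝ H) 0
        (mat (W.Cos s) (W.Sin s) (-W.Sin s) (W.Cos s) x) =
        pt (-W.Sin s x.fst + W.Cos s x.snd) (-(W.Cos s x.fst + W.Sin s x.snd)) := fun s => by
      refine Phase.ext ?_ ?_ <;> simp [mat_apply]
    simp only [e]
    refine Phase.ext ?_ ?_
    · rw [WithLp.add_fst, integral_fst (hc.intervalIntegrable _ _)]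
      simp only [pt_fst]
      rw [intervalIntegral.integral_add c3 c2, intervalIntegral.integral_neg]
      simp only [mat_apply, pt_fst, map_add, zero_apply, add_zero, W.R_Cos_eq, W.R_Sin_eq]
      abel
    · rw [WithLp.add_snd, integral_snd (hc.intervalIntegrable _ _)]
      simp only [pt_snd]
      rw [intervalIntegral.integral_neg, intervalIntegral.integral_add c1 c4]
      simp only [mat_apply, pt_fst, pt_snd, map_add, zero_apply, zero_add, neg_apply, map_neg,
        W.R_Cos_eq, W.R_Sin_eq]
      abel

lemma WaveCalculus.phase_R (W : WaveCalculus A) (x : Phase H) :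
    W.phase.R x = pt (W.R x.fst) (W.R x.snd) := by
  simp [WaveCalculus.phase, mat_apply]

lemma WaveCalculus.phase_J (W : WaveCalculus A) (x : Phase H) :
    W.phase.J x = pt x.snd (-x.fst) := by
  simp [WaveCalculus.phase, mat_apply]

/-- The coupling `(a, b) ↦ (0, -K a)` of the phase spaces. -/
def coupling (K : H →L[ℝ] H) : Phase H →L[ℝ] Phase H := mat 0 0 (-K) 0

lemma coupling_apply (K : H →L[ℝ] H) (x : Phase H) : coupling K x = pt 0 (-K x.fst) := by
  simp [coupling, mat_apply]

/-- The wave equation in the phase space, by components. -/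
lemma isMild_iff (W : WaveCalculus A) {T : ℝ} {f a b : ℝ → H} (hf : ContinuousOn f (Icc 0 T)) :
    W.phase.IsMild T (fun s => pt 0 (f s)) (fun t => pt (a t) (b t)) ↔
      ContinuousOn a (Icc 0 T) ∧ ContinuousOn b (Icc 0 T) ∧
      (∀ t ∈ Icc 0 T, W.R (a t) = W.R (a 0) + ∫ s in (0 : ℝ)..t, b s) ∧
      ∀ t ∈ Icc 0 T, W.R (b t) = W.R (b 0) + ∫ s in (0 : ℝ)..t, (W.R (f s) - a s) := by
  have key : ∀ (_ : ContinuousOn a (Icc 0 T)) (_ : ContinuousOn b (Icc 0 T)), ∀ t ∈ Icc 0 T,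
      (∫ s in (0 : ℝ)..t, (W.phase.J (pt (a s) (b s)) + W.phase.R (pt 0 (f s)))) =
        pt (∫ s in (0 : ℝ)..t, b s) (∫ s in (0 : ℝ)..t, (W.R (f s) - a s)) := by
    intro ha hb t ht
    have e : ∀ s, W.phase.J (pt (a s) (b s)) + W.phase.R (pt 0 (f s)) =
        pt (b s) (W.R (f s) - a s) := fun s => by
      rw [W.phase_J, W.phase_R]
      refine Phase.ext ?_ ?_ <;> simp [sub_eq_neg_add]
    simp only [e]
    have hi : IntervalIntegrable (fun s => pt (b s) (W.R (f s) - a s)) volume 0 t :=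
      PhaseGroup.intervalIntegrable_of_continuousOn
        (continuous_pt hb ((W.R.continuous.comp_continuousOn hf).sub ha)) ht
    exact Phase.ext (integral_fst hi) (integral_snd hi)
  constructor
  · intro h
    have ha : ContinuousOn a (Icc 0 T) :=
      (WithLp.fstL 2 ℝ H H).continuous.comp_continuousOn h.cont
    have hb : ContinuousOn b (Icc 0 T) :=
      (WithLp.sndL 2 ℝ H H).continuous.comp_continuousOn h.cont
    have h' : ∀ t ∈ Icc 0 T, pt (W.R (a t)) (W.R (b t)) = pt (W.R (a 0)) (W.R (b 0)) +
        pt (∫ s in (0 : ℝ)..t, b s) (∫ s in (0 : ℝ)..t, (W.R (f s) - a s)) := fun t ht => by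
      have := h.eq t ht
      rwa [key ha hb t ht, W.phase_R, W.phase_R] at this
    exact ⟨ha, hb, fun t ht => congrArg WithLp.fst (h' t ht),
      fun t ht => congrArg WithLp.snd (h' t ht)⟩
  · rintro ⟨ha, hb, h1, h2⟩
    refine ⟨continuous_pt ha hb, fun t ht => ?_⟩
    rw [key ha hb t ht, W.phase_R, W.phase_R]
    exact Phase.ext (h1 t ht) (h2 t ht)

end Phase

/-! ### Identification of the three solution classes with mild solutions -/

section Levels

variable {H : Type u} [NormedAddCommGroup H] [InnerProductSpace ℝ H] [CompleteSpace H]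
variable {A : H →ₗ.[ℝ] H}

/-- A bijective operator is an isometry of its domain, normed by `u ↦ |S u|`, onto `H`. -/
def DomSpace.isometryEquiv (S : H →ₗ.[ℝ] H) (inv : H → H) (hmem : ∀ x, inv x ∈ S.domain)
    (hr : ∀ x, S ⟨inv x, hmem x⟩ = x) (hl : ∀ u : S.domain, inv (S u) = u) :
    DomSpace S ≃ₗᵢ[ℝ] H where
  toLinearEquiv := LinearEquiv.ofBijective (DomSpace.op S)
    ⟨fun u v h => Subtype.ext (by
      have h' : S u = S v := h
      rw [← hl u, ← hl v, h']), fun x => ⟨DomSpace.mk (inv x) (hmem x), hr x⟩⟩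
  norm_map' _ := rfl

/-- The dual of a space isometric to `H` is `H`. -/
def dualEquiv {X : Type*} [SeminormedAddCommGroup X] [NormedSpace ℝ X] (e : X ≃ₗᵢ[ℝ] H) :
    StrongDual ℝ X ≃L[ℝ] H :=
  (e.toContinuousLinearEquiv.arrowCongr (ContinuousLinearEquiv.refl ℝ ℝ)).trans
    (InnerProductSpace.toDual ℝ H).symm.toContinuousLinearEquiv

lemma inner_dualEquiv {X : Type*} [SeminormedAddCommGroup X] [NormedSpace ℝ X] (e : X ≃ₗᵢ[ℝ] H)
    (q : StrongDual ℝ X) (φ : X) : inner ℝ (dualEquiv e q) (e φ) = q φ := by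
  simp [dualEquiv]

namespace WaveCalculus

variable (W : WaveCalculus A)

/-- The isometry `A ^ (1/2)` of `H_1` onto `H`. -/
def e1 : H1 A ≃ₗᵢ[ℝ] H :=
  DomSpace.isometryEquiv (fracPow A (1 / 2)) W.R W.mem_half W.half_R W.R_half

/-- The isometry `A` of `H_2` onto `H`. -/
def e2 : H2 A ≃ₗᵢ[ℝ] H :=
  DomSpace.isometryEquiv A (fun x => W.R (W.R x)) W.mem_A W.A_R W.R_A

/-- The isomorphism `A ^ (-1/2)` of `H_{-1}` onto `H`. -/
def d1 : Hneg1 A ≃L[ℝ] H := dualEquiv W.e1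

/-- The isomorphism `A ^ (-1)` of `H_{-2}` onto `H`. -/
def d2 : Hneg2 A ≃L[ℝ] H := dualEquiv W.e2

lemma e1_mk_R (x : H) (h : W.R x ∈ (fracPow A (1 / 2)).domain) :
    W.e1 (DomSpace.mk (W.R x) h) = x := W.half_R x

lemma e2_mk {φ : H} (h : φ ∈ A.domain) : W.e2 (DomSpace.mk φ h) = A ⟨φ, h⟩ := rfl

lemma R_e1 (u : H1 A) : W.R (W.e1 u) = u.val := W.R_half u

lemma R_e1_mk {φ : H} (h : φ ∈ (fracPow A (1 / 2)).domain) :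
    W.R (W.e1 (DomSpace.mk φ h)) = φ := W.R_e1 _

lemma e1_mk_of_mem {φ : H} (h1 : φ ∈ (fracPow A (1 / 2)).domain) (h2 : φ ∈ A.domain) :
    W.e1 (DomSpace.mk φ h1) = W.R (A ⟨φ, h2⟩) := by
  refine W.R_injective ?_
  rw [W.R_e1_mk, W.R_A]

lemma inner_d1 (q : Hneg1 A) (φ : H1 A) : inner ℝ (W.d1 q) (W.e1 φ) = q φ :=
  inner_dualEquiv W.e1 q φ

lemma inner_d2 (q : Hneg2 A) (φ : H2 A) : inner ℝ (W.d2 q) (W.e2 φ) = q φ :=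
  inner_dualEquiv W.e2 q φ

end WaveCalculus

lemma inner_integral {T t : ℝ} {h : ℝ → H} (hh : ContinuousOn h (Icc 0 T)) (ht : t ∈ Icc 0 T)
    (ψ : H) : inner ℝ (∫ s in (0 : ℝ)..t, h s) ψ = ∫ s in (0 : ℝ)..t, inner ℝ (h s) ψ := by
  rw [real_inner_comm, ← innerSL_apply_apply ℝ, ← ContinuousLinearMap.intervalIntegral_comp_comm _
    (PhaseGroup.intervalIntegrable_of_continuousOn hh ht)]
  simp only [innerSL_apply_apply, real_inner_comm]

lemma eq_add_integral_iff {T t : ℝ} {h : ℝ → H} (hh : ContinuousOn h (Icc 0 T)) (ht : t ∈ Icc 0 T)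
    (x y : H) : x = y + ∫ s in (0 : ℝ)..t, h s ↔
      ∀ ψ, inner ℝ x ψ = inner ℝ y ψ + ∫ s in (0 : ℝ)..t, inner ℝ (h s) ψ := by
  simp only [← inner_integral hh ht, ← inner_add_left]
  exact ⟨fun e ψ => by rw [e], fun e => ext_inner_right ℝ e⟩

/-- Test vectors in the range of `R` suffice, because `R` is symmetric and injective. -/
lemma eq_add_integral_iff_R (W : WaveCalculus A) {T t : ℝ} {h : ℝ → H}
    (hh : ContinuousOn h (Icc 0 T)) (ht : t ∈ Icc 0 T)
    (x y : H) : x = y + ∫ s in (0 : ℝ)..t, h s ↔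
      ∀ ψ, inner ℝ x (W.R ψ) = inner ℝ y (W.R ψ) + ∫ s in (0 : ℝ)..t, inner ℝ (h s) (W.R ψ) := by
  refine ⟨fun e ψ => (eq_add_integral_iff hh ht x y).1 e _, fun e => W.R_injective ?_⟩
  simp only [← inner_integral hh ht, ← inner_add_left] at e
  exact ext_inner_right ℝ fun ψ => by rw [W.R_symm, W.R_symm, e]

/-- The coordinates are `(A^{1/2} w, w')`. The test vectors in the domain of `A` are the `R R ψ`, so
the weak equation is the `R`-multiplied one tested on the range of `R`. -/
lemma isWave1_iff (W : WaveCalculus A) {T : ℝ} {f : ℝ → H} {w : ℝ → H1 A} {q : ℝ → H}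
    (hf : ContinuousOn f (Icc 0 T)) : IsWave1 A T f w q ↔
      W.phase.IsMild T (fun s => pt 0 (f s)) (fun t => pt (W.e1 (w t)) (q t)) := by
  rw [isMild_iff W hf]
  have hcw : ContinuousOn w (Icc 0 T) ↔ ContinuousOn (fun t => W.e1 (w t)) (Icc 0 T) :=
    (W.e1.toHomeomorph.comp_continuousOn_iff w (Icc 0 T)).symm
  have key : ContinuousOn w (Icc 0 T) → ∀ t ∈ Icc 0 T,
      (W.R (q t) = W.R (q 0) + ∫ s in (0 : ℝ)..t, (W.R (f s) - W.e1 (w s)) ↔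
      ∀ φ : A.domain, inner ℝ (q t) (φ : H) = inner ℝ (q 0) (φ : H) +
        ∫ s in (0 : ℝ)..t, (inner ℝ (f s) (φ : H) - inner ℝ (w s).val (A φ))) := by
    intro hw t ht
    have hc : ContinuousOn (fun s => W.R (f s) - W.e1 (w s)) (Icc 0 T) :=
      (W.R.continuous.comp_continuousOn hf).sub (hcw.1 hw)
    have e : ∀ s ψ, inner ℝ (W.R (f s) - W.e1 (w s)) (W.R ψ) =
        inner ℝ (f s) (W.R (W.R ψ)) - inner ℝ (w s).val ψ := fun s ψ => by
      rw [inner_sub_left, W.R_symm, ← W.R_symm (W.e1 (w s)), W.R_e1]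
    rw [eq_add_integral_iff_R W hc ht]
    simp only [e, W.R_symm]
    constructor
    · intro h φ
      have := h (A φ)
      rwa [W.R_A] at this
    · intro h ψ
      have := h ⟨W.R (W.R ψ), W.mem_A ψ⟩
      rwa [W.A_R] at this
  constructor
  · intro h
    refine ⟨hcw.1 h.cont_w, h.cont_q, fun t ht => ?_, fun t ht => ?_⟩
    · rw [W.R_e1, W.R_e1]; exact h.eq_w t ht
    · exact (key h.cont_w t ht).2 fun φ => h.eq_q φ t ht
  · rintro ⟨h1, h2, h3, h4⟩
    refine ⟨hcw.2 h1, h2, fun t ht => ?_, fun φ t ht => ?_⟩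
    · rw [← W.R_e1, ← W.R_e1]; exact h3 t ht
    · exact (key (hcw.2 h1) t ht).1 (h4 t ht) φ

/-- The coordinates are `(w, A^{-1/2} w')`, and `f = A^{-1/2} F` represents a source in `H_{-1}`.
Substituting `φ = R ψ` in the first equation and `φ = R R ψ` in the second yields arbitrary test
vectors. -/
lemma isWave0_iff (W : WaveCalculus A) {T : ℝ} {F : ℝ → H1 A → ℝ} {f w : ℝ → H} {q : ℝ → Hneg1 A}
    (hf : ContinuousOn f (Icc 0 T)) (hF : ∀ s ∈ Icc 0 T, ∀ φ, F s φ = inner ℝ (f s) (W.e1 φ)) :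
    IsWave0 A T F w q ↔
      W.phase.IsMild T (fun s => pt 0 (f s)) (fun t => pt (w t) (W.d1 (q t))) := by
  rw [isMild_iff W hf]
  have hcq : ContinuousOn q (Icc 0 T) ↔ ContinuousOn (fun t => W.d1 (q t)) (Icc 0 T) :=
    (W.d1.toHomeomorph.comp_continuousOn_iff q (Icc 0 T)).symm
  have key1 : ContinuousOn q (Icc 0 T) → ∀ t ∈ Icc 0 T,
      (W.R (w t) = W.R (w 0) + ∫ s in (0 : ℝ)..t, W.d1 (q s) ↔
      ∀ (φ : H) (h1 : φ ∈ (fracPow A (1 / 2)).domain),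
        inner ℝ (w t) φ = inner ℝ (w 0) φ + ∫ s in (0 : ℝ)..t, q s (DomSpace.mk φ h1)) := by
    intro hq t ht
    rw [eq_add_integral_iff (hcq.1 hq) ht]
    constructor
    · intro h φ h1
      have := h (W.e1 (DomSpace.mk φ h1))
      simpa only [W.R_symm, W.R_e1_mk, W.inner_d1] using this
    · intro h ψ
      have := h (W.R ψ) (W.mem_half ψ)
      simpa only [W.R_symm, ← W.inner_d1, W.e1_mk_R] using this
  have key2 : ContinuousOn w (Icc 0 T) → ∀ t ∈ Icc 0 T,
      (W.R (W.d1 (q t)) = W.R (W.d1 (q 0)) + ∫ s in (0 : ℝ)..t, (W.R (f s) - w s) ↔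
      ∀ (φ : H) (h1 : φ ∈ (fracPow A (1 / 2)).domain) (h2 : φ ∈ A.domain),
        q t (DomSpace.mk φ h1) = q 0 (DomSpace.mk φ h1) +
        ∫ s in (0 : ℝ)..t, (F s (DomSpace.mk φ h1) - inner ℝ (w s) (A ⟨φ, h2⟩))) := by
    intro hw t ht
    have hc : ContinuousOn (fun s => W.R (f s) - w s) (Icc 0 T) :=
      (W.R.continuous.comp_continuousOn hf).sub hw
    have hi : ∀ φ (h1 : φ ∈ (fracPow A (1 / 2)).domain) (h2 : φ ∈ A.domain),
        ∫ s in (0 : ℝ)..t, (F s (DomSpace.mk φ h1) - inner ℝ (w s) (A ⟨φ, h2⟩)) =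
        ∫ s in (0 : ℝ)..t, inner ℝ (W.R (f s) - w s) (A ⟨φ, h2⟩) := fun φ h1 h2 => by
      refine intervalIntegral.integral_congr fun s hs => ?_
      rw [uIcc_of_le ht.1] at hs
      simp only [hF s ⟨hs.1, hs.2.trans ht.2⟩, inner_sub_left, W.R_symm, W.e1_mk_of_mem h1 h2]
    rw [eq_add_integral_iff hc ht]
    constructor
    · intro h φ h1 h2
      rw [hi φ h1 h2, ← W.inner_d1, ← W.inner_d1, W.e1_mk_of_mem h1 h2]
      simpa only [W.R_symm (W.d1 _)] using h (A ⟨φ, h2⟩)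
    · intro h ψ
      have h1 : W.R (W.R ψ) ∈ (fracPow A (1 / 2)).domain := W.mem_half _
      have := h (W.R (W.R ψ)) h1 (W.mem_A ψ)
      rw [hi, W.A_R, ← W.inner_d1, ← W.inner_d1, W.e1_mk_R] at this
      simpa only [W.R_symm (W.d1 _)] using this
  constructor
  · intro h
    exact ⟨h.cont_w, hcq.1 h.cont_q,
      fun t ht => (key1 h.cont_q t ht).2 fun φ h1 => h.eq_w φ h1 t ht,
      fun t ht => (key2 h.cont_w t ht).2 fun φ h1 h2 => h.eq_q φ h1 h2 t ht⟩
  · rintro ⟨h1, h2, h3, h4⟩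
    exact ⟨h1, hcq.2 h2, fun φ hφ t ht => (key1 (hcq.2 h2) t ht).1 (h3 t ht) φ hφ,
      fun φ hφ hφ' t ht => (key2 h1 t ht).1 (h4 t ht) φ hφ hφ'⟩

/-- The coordinates are `(A^{-1/2} w, A^{-1} w')`; the second equation needs `A φ` in `H_1`, that is
`φ = R R R ψ`. -/
lemma isWaveNeg1_iff (W : WaveCalculus A) {T : ℝ} {w : ℝ → Hneg1 A} {q : ℝ → Hneg2 A} :
    IsWaveNeg1 A T w q ↔
      W.phase.IsMild T (fun _ => 0) (fun t => pt (W.d1 (w t)) (W.d2 (q t))) := by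
  have h0 : (fun _ : ℝ => (0 : Phase H)) = fun _ => pt 0 0 := rfl
  rw [h0, isMild_iff W continuousOn_const]
  simp only [map_zero, zero_sub]
  have hcw : ContinuousOn w (Icc 0 T) ↔ ContinuousOn (fun t => W.d1 (w t)) (Icc 0 T) :=
    (W.d1.toHomeomorph.comp_continuousOn_iff w (Icc 0 T)).symm
  have hcq : ContinuousOn q (Icc 0 T) ↔ ContinuousOn (fun t => W.d2 (q t)) (Icc 0 T) :=
    (W.d2.toHomeomorph.comp_continuousOn_iff q (Icc 0 T)).symm
  have key1 : ContinuousOn q (Icc 0 T) → ∀ t ∈ Icc 0 T,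
      (W.R (W.d1 (w t)) = W.R (W.d1 (w 0)) + ∫ s in (0 : ℝ)..t, W.d2 (q s) ↔
      ∀ (φ : H) (h1 : φ ∈ (fracPow A (1 / 2)).domain) (h2 : φ ∈ A.domain),
        w t (DomSpace.mk φ h1) = w 0 (DomSpace.mk φ h1) +
          ∫ s in (0 : ℝ)..t, q s (DomSpace.mk φ h2)) := by
    intro hq t ht
    rw [eq_add_integral_iff (hcq.1 hq) ht]
    constructor
    · intro h φ h1 h2
      have := h (A ⟨φ, h2⟩)
      simpa only [W.R_symm, ← W.inner_d1, ← W.inner_d2, W.e1_mk_of_mem h1 h2, W.e2_mk] using this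
    · intro h ψ
      have h1 : W.R (W.R ψ) ∈ (fracPow A (1 / 2)).domain := W.mem_half _
      have := h (W.R (W.R ψ)) h1 (W.mem_A ψ)
      simpa only [← W.inner_d1, ← W.inner_d2, W.e1_mk_R, W.R_symm (W.d1 _), W.e2_mk, W.A_R]
        using this
  have key2 : ContinuousOn w (Icc 0 T) → ∀ t ∈ Icc 0 T,
      (W.R (W.d2 (q t)) = W.R (W.d2 (q 0)) + ∫ s in (0 : ℝ)..t, -W.d1 (w s) ↔
      ∀ (φ : H) (h2 : φ ∈ A.domain) (h3 : A ⟨φ, h2⟩ ∈ (fracPow A (1 / 2)).domain),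
        q t (DomSpace.mk φ h2) = q 0 (DomSpace.mk φ h2) -
          ∫ s in (0 : ℝ)..t, w s (DomSpace.mk (A ⟨φ, h2⟩) h3)) := by
    intro hw t ht
    have hc : ContinuousOn (fun s => -W.d1 (w s)) (Icc 0 T) := (hcw.1 hw).neg
    rw [eq_add_integral_iff hc ht]
    simp only [inner_neg_left, intervalIntegral.integral_neg, ← sub_eq_add_neg]
    constructor
    · intro h φ h2 h3
      have := h (W.e1 (DomSpace.mk _ h3))
      simpa only [W.R_symm, W.R_e1_mk, ← W.e2_mk h2, W.inner_d1, W.inner_d2] using this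
    · intro h ψ
      have h3 : A ⟨W.R (W.R (W.R ψ)), W.mem_A (W.R ψ)⟩ ∈ (fracPow A (1 / 2)).domain := by
        rw [W.A_R]; exact W.mem_half ψ
      have := h (W.R (W.R (W.R ψ))) (W.mem_A (W.R ψ)) h3
      simpa only [← W.inner_d1, ← W.inner_d2, W.e2_mk, W.A_R, W.e1_mk_R, W.R_symm (W.d2 _)]
        using this
  constructor
  · intro h
    exact ⟨hcw.1 h.cont_w, hcq.1 h.cont_q,
      fun t ht => (key1 h.cont_q t ht).2 fun φ h1 h2 => h.eq_w φ h1 h2 t ht,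
      fun t ht => (key2 h.cont_w t ht).2 fun φ h2 h3 => h.eq_q φ h2 h3 t ht⟩
  · rintro ⟨h1, h2, h3, h4⟩
    exact ⟨hcw.2 h1, hcq.2 h2, fun φ hφ hφ' t ht => (key1 (hcq.2 h2) t ht).1 (h3 t ht) φ hφ hφ',
      fun φ hφ hφ' t ht => (key2 (hcw.2 h1) t ht).1 (h4 t ht) φ hφ hφ'⟩


/-! ### The cascade systems in the phase space -/

lemma A2.val_adjOnH1 {C Pi : H →L[ℝ] H} (hC : A2 A C Pi) (φ : H1 A) :
    (adjOnH1 A C φ).val = ContinuousLinearMap.adjoint C φ.val := by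
  rw [adjOnH1, dif_pos (hC.maps_H1 φ)]; rfl

lemma A2.R_e1_adjOnH1 {C Pi : H →L[ℝ] H} (hC : A2 A C Pi) (W : WaveCalculus A) (x : H) :
    W.R (W.e1 (adjOnH1 A C (W.e1.symm x))) = ContinuousLinearMap.adjoint C (W.R x) := by
  rw [W.R_e1, hC.val_adjOnH1, ← W.R_e1, LinearIsometryEquiv.apply_symm_apply]

/-- There is a bounded operator `D`, namely `A ^ (-1/2) C A ^ (1/2)`, which represents the extension
of `C` to `H_{-1}`. -/
lemma A2.exists_extension {C Pi : H →L[ℝ] H} (hC : A2 A C Pi) (W : WaveCalculus A) :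
    ∃ D : H →L[ℝ] H, (∀ x, D (W.R x) = W.R (C x)) ∧
      ∀ (w : Hneg1 A) (φ : H1 A), w (adjOnH1 A C φ) = inner ℝ (D (W.d1 w)) (W.e1 φ) := by
  obtain ⟨K, hK⟩ := hC.bounded_H1
  -- `M = A^{1/2} C* A^{-1/2}` is bounded because `C*` is bounded on `H_1`; its adjoint is the
  -- required `D`. Linearity is verified after applying the injective `R`.
  let M : H →L[ℝ] H := LinearMap.mkContinuous
    { toFun := fun x => W.e1 (adjOnH1 A C (W.e1.symm x))
      map_add' := fun x y => W.R_injective (by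
        rw [map_add W.R, hC.R_e1_adjOnH1, hC.R_e1_adjOnH1, hC.R_e1_adjOnH1, map_add, map_add])
      map_smul' := fun c x => W.R_injective (by
        rw [map_smul W.R, hC.R_e1_adjOnH1, hC.R_e1_adjOnH1, map_smul, map_smul, RingHom.id_apply]) }
    K (fun x => by
      have := hK (W.e1.symm x)
      rw [LinearIsometryEquiv.norm_map] at this
      simpa using this)
  have hM : ∀ x, M x = W.e1 (adjOnH1 A C (W.e1.symm x)) := fun x => rfl
  refine ⟨ContinuousLinearMap.adjoint M, fun x => ?_, fun w φ => ?_⟩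
  · refine ext_inner_right ℝ fun y => ?_
    rw [ContinuousLinearMap.adjoint_inner_left, W.R_symm, hM, hC.R_e1_adjOnH1,
      ContinuousLinearMap.adjoint_inner_right, W.R_symm]
  · rw [ContinuousLinearMap.adjoint_inner_left, hM, LinearIsometryEquiv.symm_apply_apply,
      W.inner_d1]

lemma isDualNeg1_iff (W : WaveCalculus A) {C D : H →L[ℝ] H} {T : ℝ}
    (hD : ∀ (w : Hneg1 A) (φ : H1 A), w (adjOnH1 A C φ) = inner ℝ (D (W.d1 w)) (W.e1 φ))
    {w₁ : ℝ → Hneg1 A} {w₂ : ℝ → H} {q₁ : ℝ → Hneg2 A} {q₂ : ℝ → Hneg1 A} :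
    IsDualNeg1 A C T w₁ w₂ q₁ q₂ ↔ W.phase.IsCascade (coupling D) T
      (fun t => pt (W.d1 (w₁ t)) (W.d2 (q₁ t))) (fun t => pt (w₂ t) (W.d1 (q₂ t))) := by
  have key : W.phase.IsMild T (fun _ => 0) (fun t => pt (W.d1 (w₁ t)) (W.d2 (q₁ t))) →
      (IsWave0 A T (fun s φ => -w₁ s (adjOnH1 A C φ)) w₂ q₂ ↔
        W.phase.IsMild T (fun s => coupling D (pt (W.d1 (w₁ s)) (W.d2 (q₁ s))))
          (fun t => pt (w₂ t) (W.d1 (q₂ t)))) := by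
    intro h
    have hc : ContinuousOn (fun t => W.d1 (w₁ t)) (Icc 0 T) :=
      (WithLp.fstL 2 ℝ H H).continuous.comp_continuousOn h.cont
    simp only [coupling_apply, pt_fst]
    exact isWave0_iff W (f := fun s => -D (W.d1 (w₁ s)))
      (D.continuous.comp_continuousOn hc).neg fun s _ φ => by rw [hD, inner_neg_left]
  constructor
  · rintro ⟨h1, h2⟩
    have h1' := (isWaveNeg1_iff W).1 h1
    exact ⟨h1', (key h1').1 h2⟩
  · rintro ⟨h1, h2⟩
    exact ⟨(isWaveNeg1_iff W).2 h1, (key h1).2 h2⟩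

lemma isDual1_iff (W : WaveCalculus A) {C : H →L[ℝ] H} {T : ℝ}
    {w₁ : ℝ → H} {w₂ : ℝ → H1 A} {q₁ : ℝ → Hneg1 A} {q₂ : ℝ → H} :
    IsDual1 A C T w₁ w₂ q₁ q₂ ↔ W.phase.IsCascade (coupling C) T
      (fun t => pt (w₁ t) (W.d1 (q₁ t))) (fun t => pt (W.e1 (w₂ t)) (q₂ t)) := by
  have e : IsWave0 A T (fun _ _ => 0) w₁ q₁ ↔
      W.phase.IsMild T (fun _ => 0) (fun t => pt (w₁ t) (W.d1 (q₁ t))) :=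
    isWave0_iff W (f := fun _ => 0) continuousOn_const fun _ _ _ => by rw [inner_zero_left]
  have key : W.phase.IsMild T (fun _ => 0) (fun t => pt (w₁ t) (W.d1 (q₁ t))) →
      (IsWave1 A T (fun s => -C (w₁ s)) w₂ q₂ ↔
        W.phase.IsMild T (fun s => coupling C (pt (w₁ s) (W.d1 (q₁ s))))
          (fun t => pt (W.e1 (w₂ t)) (q₂ t))) := by
    intro h
    have hc : ContinuousOn w₁ (Icc 0 T) :=
      (WithLp.fstL 2 ℝ H H).continuous.comp_continuousOn h.cont
    simp only [coupling_apply, pt_fst]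
    exact isWave1_iff W (C.continuous.comp_continuousOn hc).neg
  constructor
  · rintro ⟨h1, h2⟩
    exact ⟨e.1 h1, (key (e.1 h1)).1 h2⟩
  · rintro ⟨h1, h2⟩
    exact ⟨e.2 h1, (key h1).2 h2⟩

lemma PhaseGroup.IsMild.map_R {E : Type*} [NormedAddCommGroup E] [InnerProductSpace ℝ E]
    [CompleteSpace E] {P : PhaseGroup E} {T : ℝ} {x : ℝ → E} (h : P.IsMild T (fun _ => 0) x) :
    P.IsMild T (fun _ => 0) fun t => P.R (x t) := by
  refine ⟨P.R.continuous.comp_continuousOn h.cont, fun t ht => ?_⟩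
  have hc : ContinuousOn (fun s => P.J (x s)) (Icc 0 T) := P.J.continuous.comp_continuousOn h.cont
  have := h.eq t ht
  simp only [map_zero, add_zero, ← P.R_J] at this ⊢
  rw [P.R.intervalIntegral_comp_comm (PhaseGroup.intervalIntegrable_of_continuousOn hc ht),
    ← map_add, ← this]

/-- Applying `R` rereads the first wave as `(u₁, A^{-1/2} u₁')`. The source `-C u₁` is then a
bounded function of its first component, and its norm is the weakened energy. -/
lemma isCascade_of_isWave1 (W : WaveCalculus A) {C : H →L[ℝ] H} {T : ℝ} {u₁ u₂ : ℝ → H1 A}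
    {q₁ q₂ : ℝ → H} (h1 : IsWave1 A T (fun _ => 0) u₁ q₁)
    (h2 : IsWave1 A T (fun s => -C (u₁ s).val) u₂ q₂) :
    W.phase.IsCascade (coupling C) T (fun t => W.phase.R (pt (W.e1 (u₁ t)) (q₁ t)))
      (fun t => pt (W.e1 (u₂ t)) (q₂ t)) := by
  have h1' : W.phase.IsMild T (fun _ => 0) _ :=
    ((isWave1_iff W (f := fun _ => 0) continuousOn_const).1 h1)
  have hc : ContinuousOn (fun s => -C (u₁ s).val) (Icc 0 T) := by
    simp only [← W.R_e1]
    exact ((C.comp W.R).continuous.comp_continuousOn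
      (W.e1.continuous.comp_continuousOn h1.cont_w)).neg
  refine ⟨h1'.map_R, ?_⟩
  have := (isWave1_iff W hc).1 h2
  simpa only [coupling_apply, W.phase_R, pt_fst, W.R_e1] using this

end Levels

/-! ### Functions determined by their primitives -/

section Integrals

variable {G : Type*} [NormedAddCommGroup G] [NormedSpace ℝ G]

lemma intervalIntegrable_of_memLp {T t : ℝ} {g : ℝ → G}
    (hg : MemLp g 2 (volume.restrict (Ioo 0 T))) (ht : t ∈ Icc 0 T) :
    IntervalIntegrable g volume 0 t := by
  have h1 : IntegrableOn g (Ioo 0 T) := hg.integrable one_le_two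
  rw [intervalIntegrable_iff_integrableOn_Ioo_of_le ht.1]
  exact h1.mono_set (Ioo_subset_Ioo_right ht.2)

lemma ae_eq_of_forall_integral_eq [CompleteSpace G] {T : ℝ} {g g' : ℝ → G}
    (hg : MemLp g 2 (volume.restrict (Ioo 0 T))) (hg' : MemLp g' 2 (volume.restrict (Ioo 0 T)))
    (h : ∀ t ∈ Icc 0 T, ∫ s in (0 : ℝ)..t, g s = ∫ s in (0 : ℝ)..t, g' s) :
    g =ᵐ[volume.restrict (Ioo 0 T)] g' := by
  rcases lt_or_ge 0 T with hT | hT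
  swap
  · simp [Ioo_eq_empty_of_le hT, Filter.EventuallyEq]
  have hTT : T ∈ Icc 0 T := ⟨hT.le, le_rfl⟩
  have hd := ((intervalIntegrable_of_memLp hg hTT).sub
    (intervalIntegrable_of_memLp hg' hTT)).ae_hasDerivAt_integral
  rw [Filter.EventuallyEq, ae_restrict_iff' measurableSet_Ioo]
  filter_upwards [hd] with x hx hxT
  rw [uIcc_of_le hT.le] at hx
  have h1 := hx (Ioo_subset_Icc_self hxT) 0 ⟨le_rfl, hT.le⟩
  have h2 : (fun t => ∫ s in (0 : ℝ)..t, (g - g') s) =ᶠ[nhds x] fun _ => 0 := by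
    filter_upwards [Ioo_mem_nhds hxT.1 hxT.2] with t ht
    have ht' := Ioo_subset_Icc_self ht
    simp only [Pi.sub_apply]
    rw [intervalIntegral.integral_sub (intervalIntegrable_of_memLp hg ht')
      (intervalIntegrable_of_memLp hg' ht'), h t ht', sub_self]
  have h3 := h1.unique ((hasDerivAt_const x (0 : G)).congr_of_eventuallyEq h2)
  exact sub_eq_zero.1 h3

end Integrals

/-! ### Observation in the integrated sense -/

section Observation

variable {E : Type*} [NormedAddCommGroup E] [InnerProductSpace ℝ E] [CompleteSpace E]
variable {G : Type v} [NormedAddCommGroup G] [InnerProductSpace ℝ G] [CompleteSpace G]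

/-- `g ∈ L²(0,T;G)` is the observation of `x` through the operator with graph `Γ`, in the integrated
sense. -/
structure IsObs (Γ : Submodule ℝ (E × G)) (T : ℝ) (x : ℝ → E) (g : ℝ → G) : Prop where
  memLp : MemLp g 2 (volume.restrict (Ioo 0 T))
  mem : ∀ t ∈ Icc 0 T, (∫ s in (0 : ℝ)..t, x s, ∫ s in (0 : ℝ)..t, g s) ∈ Γ

variable {Γ : Submodule ℝ (E × G)} {T : ℝ} {x y : ℝ → E} {g h : ℝ → G}

lemma IsObs.congr (hx : IsObs Γ T x g) (hxy : EqOn x y (Icc 0 T)) : IsObs Γ T y g := by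
  refine ⟨hx.memLp, fun t ht => ?_⟩
  have : ∫ s in (0 : ℝ)..t, y s = ∫ s in (0 : ℝ)..t, x s :=
    intervalIntegral.integral_congr fun s hs => by
      rw [uIcc_of_le ht.1] at hs
      exact (hxy ⟨hs.1, hs.2.trans ht.2⟩).symm
  rw [this]; exact hx.mem t ht

lemma IsObs.mono (hx : IsObs Γ T x g) {S : ℝ} (hS : S ≤ T) : IsObs Γ S x g :=
  ⟨hx.memLp.mono_measure (Measure.restrict_mono (Ioo_subset_Ioo_right hS) le_rfl),
    fun t ht => hx.mem t ⟨ht.1, ht.2.trans hS⟩⟩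

lemma IsObs.smul_add (c : ℝ) (hx : IsObs Γ T x g) (hy : IsObs Γ T y h)
    (hcx : ContinuousOn x (Icc 0 T)) (hcy : ContinuousOn y (Icc 0 T)) :
    IsObs Γ T (fun t => c • x t + y t) (fun t => c • g t + h t) := by
  refine ⟨(hx.memLp.const_smul c).add hy.memLp, fun t ht => ?_⟩
  have h1 : IntervalIntegrable (fun s => c • x s) volume 0 t :=
    (PhaseGroup.intervalIntegrable_of_continuousOn hcx ht).smul c
  have h2 : IntervalIntegrable (fun s => c • g s) volume 0 t :=
    (intervalIntegrable_of_memLp hx.memLp ht).smul c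
  rw [intervalIntegral.integral_add h1 (PhaseGroup.intervalIntegrable_of_continuousOn hcy ht),
    intervalIntegral.integral_add h2 (intervalIntegrable_of_memLp hy.memLp ht),
    intervalIntegral.integral_smul, intervalIntegral.integral_smul]
  exact Γ.add_mem (Γ.smul_mem c (hx.mem t ht)) (hy.mem t ht)

lemma IsObs.unique (hΓ : ∀ z, ((0 : E), z) ∈ Γ → z = 0) (hx : IsObs Γ T x g)
    (hx' : IsObs Γ T x h) : g =ᵐ[volume.restrict (Ioo 0 T)] h := by
  refine ae_eq_of_forall_integral_eq hx.memLp hx'.memLp fun t ht => ?_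
  have := Γ.sub_mem (hx.mem t ht) (hx'.mem t ht)
  rw [Prod.mk_sub_mk, sub_self] at this
  exact sub_eq_zero.1 (hΓ _ this)

/-- An integral from `a` is the difference of two integrals from `0`, and `Γ` is a subspace. -/
lemma IsObs.shift (hx : IsObs Γ T x g) (hcx : ContinuousOn x (Icc 0 T)) {a S : ℝ} (ha : 0 ≤ a)
    (hS : a + S ≤ T) : IsObs Γ S (fun t => x (a + t)) (fun t => g (a + t)) := by
  constructor
  · have hp : MeasurePreserving (fun t => a + t) (volume.restrict (Ioo 0 S))
        (volume.restrict (Ioo a (a + S))) := by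
      have := (measurePreserving_add_left (volume : Measure ℝ) a).restrict_preimage
        (measurableSet_Ioo (a := a) (b := a + S))
      simpa using this
    exact (hx.memLp.mono_measure (Measure.restrict_mono (Ioo_subset_Ioo ha hS)
      le_rfl)).comp_measurePreserving hp
  · intro t ht
    have m1 : a ∈ Icc 0 T := ⟨ha, by linarith [ht.1, ht.2]⟩
    have m2 : a + t ∈ Icc 0 T := ⟨by linarith [ht.1], by linarith [ht.2]⟩
    have := Γ.sub_mem (hx.mem _ m2) (hx.mem _ m1)
    rw [Prod.mk_sub_mk, intervalIntegral.integral_interval_sub_left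
      (PhaseGroup.intervalIntegrable_of_continuousOn hcx m2)
      (PhaseGroup.intervalIntegrable_of_continuousOn hcx m1),
      intervalIntegral.integral_interval_sub_left
      (intervalIntegrable_of_memLp hx.memLp m2) (intervalIntegrable_of_memLp hx.memLp m1)] at this
    rw [intervalIntegral.integral_comp_add_left, intervalIntegral.integral_comp_add_left, add_zero]
    exact this

lemma IsObs.sq_integrable (hx : IsObs Γ T x g) : IntegrableOn (fun t => ‖g t‖ ^ 2) (Ioo 0 T) :=
  hx.memLp.integrable_norm_pow two_ne_zero

lemma integral_sq_eq (hT : 0 ≤ T) (g : ℝ → G) :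
    ∫ t in (0 : ℝ)..T, ‖g t‖ ^ 2 = ∫ t in Ioo 0 T, ‖g t‖ ^ 2 := by
  rw [intervalIntegral.integral_of_le hT, integral_Ioc_eq_integral_Ioo]

lemma IsObs.integral_shift_le (hx : IsObs Γ T x g) {a S : ℝ} (ha : 0 ≤ a) (hS0 : 0 ≤ S)
    (hS : a + S ≤ T) :
    ∫ t in (0 : ℝ)..S, ‖g (a + t)‖ ^ 2 ≤ ∫ t in (0 : ℝ)..T, ‖g t‖ ^ 2 := by
  rw [intervalIntegral.integral_comp_add_left (fun t => ‖g t‖ ^ 2), add_zero,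
    intervalIntegral.integral_of_le (by linarith), integral_Ioc_eq_integral_Ioo,
    integral_sq_eq (by linarith)]
  exact setIntegral_mono_set hx.sq_integrable (Filter.Eventually.of_forall fun _ => by positivity)
    (Ioo_subset_Ioo ha hS).eventuallyLE

end Observation

/-! ### The observation operator in the phase space -/

section PhaseObservation

variable {H : Type u} [NormedAddCommGroup H] [InnerProductSpace ℝ H] [CompleteSpace H]
variable {G : Type v} [NormedAddCommGroup G] [InnerProductSpace ℝ G] [CompleteSpace G]
variable {A : H →ₗ.[ℝ] H}

/-- The graph of the observation operator in the phase space. -/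
def obsGraph (W : WaveCalculus A) (Bs : H2 A × H →L[ℝ] G) : Submodule ℝ (Phase H × G) where
  carrier := {p | ∃ h : W.R p.1.fst ∈ A.domain, Bs (DomSpace.mk _ h, p.1.snd) = p.2}
  zero_mem' := by
    have h : W.R (0 : Phase H).fst ∈ A.domain := by simp
    refine ⟨h, ?_⟩
    have e : (DomSpace.mk _ h : H2 A) = 0 := Subtype.ext (map_zero W.R)
    change Bs ((DomSpace.mk _ h : H2 A), 0) = 0
    rw [e]
    exact map_zero Bs
  add_mem' := by
    rintro p q ⟨hp, ep⟩ ⟨hq, eq⟩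
    have h : W.R (p + q).1.fst ∈ A.domain := by
      have := A.domain.add_mem hp hq
      rwa [← map_add] at this
    refine ⟨h, ?_⟩
    have e : (DomSpace.mk _ h : H2 A) = DomSpace.mk _ hp + DomSpace.mk _ hq :=
      Subtype.ext (map_add W.R _ _)
    rw [e, Prod.snd_add, ← ep, ← eq, ← map_add]
    rfl
  smul_mem' := by
    rintro c p ⟨hp, ep⟩
    have h : W.R (c • p).1.fst ∈ A.domain := by
      have := A.domain.smul_mem c hp
      rwa [← map_smul] at this
    refine ⟨h, ?_⟩
    have e : (DomSpace.mk _ h : H2 A) = c • DomSpace.mk _ hp :=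
      Subtype.ext (map_smul W.R _ _)
    rw [e, Prod.smul_snd, ← ep, ← map_smul]
    rfl

lemma obsGraph_zero (W : WaveCalculus A) (Bs : H2 A × H →L[ℝ] G) (z : G)
    (hz : ((0 : Phase H), z) ∈ obsGraph W Bs) : z = 0 := by
  obtain ⟨h, e⟩ := hz
  have e' : (DomSpace.mk _ h : H2 A) = 0 := Subtype.ext (map_zero W.R)
  rw [e'] at e
  exact e.symm.trans (map_zero Bs)

lemma isObservation_iff (W : WaveCalculus A) {Bs : H2 A × H →L[ℝ] G} {T : ℝ} {w : ℝ → H1 A}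
    {q : ℝ → H} {g : ℝ → G} (hw : ContinuousOn w (Icc 0 T)) (hq : ContinuousOn q (Icc 0 T)) :
    IsObservation Bs T w q g ↔ IsObs (obsGraph W Bs) T (fun t => pt (W.e1 (w t)) (q t)) g := by
  have key : ∀ t ∈ Icc 0 T,
      ((∃ h : (∫ s in (0 : ℝ)..t, (w s).val) ∈ A.domain,
        Bs (DomSpace.mk (∫ s in (0 : ℝ)..t, (w s).val) h, ∫ s in (0 : ℝ)..t, q s) =
          ∫ s in (0 : ℝ)..t, g s) ↔
      (∫ s in (0 : ℝ)..t, pt (W.e1 (w s)) (q s), ∫ s in (0 : ℝ)..t, g s) ∈ obsGraph W Bs) := by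
    intro t ht
    have hc1 : ContinuousOn (fun s => W.e1 (w s)) (Icc 0 T) :=
      W.e1.continuous.comp_continuousOn hw
    have hc : ContinuousOn (fun s => pt (W.e1 (w s)) (q s)) (Icc 0 T) := continuous_pt hc1 hq
    have e1 : W.R (∫ s in (0 : ℝ)..t, pt (W.e1 (w s)) (q s)).fst =
        ∫ s in (0 : ℝ)..t, (w s).val := by
      rw [integral_fst (PhaseGroup.intervalIntegrable_of_continuousOn hc ht)]
      simp only [pt_fst]
      rw [← W.R.intervalIntegral_comp_comm (PhaseGroup.intervalIntegrable_of_continuousOn hc1 ht)]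
      simp only [W.R_e1]
    have e2 : (∫ s in (0 : ℝ)..t, pt (W.e1 (w s)) (q s)).snd = ∫ s in (0 : ℝ)..t, q s :=
      integral_snd (PhaseGroup.intervalIntegrable_of_continuousOn hc ht)
    change _ ↔ ∃ h : W.R (∫ s in (0 : ℝ)..t, pt (W.e1 (w s)) (q s)).fst ∈ A.domain,
      Bs (DomSpace.mk _ h, (∫ s in (0 : ℝ)..t, pt (W.e1 (w s)) (q s)).snd) =
        ∫ s in (0 : ℝ)..t, g s
    rw [e2]
    simp only [e1]
  exact ⟨fun h => ⟨h.memLp, fun t ht => (key t ht).1 (h.eq t ht)⟩,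
    fun h => ⟨h.memLp, fun t ht => (key t ht).2 (h.mem t ht)⟩⟩

end PhaseObservation

/-- The group law of the cascade flow, from the cocycle relation `L (s + t) = L s + G (-s) L t G s`.
It allows the observation to be restarted at a later time. -/
lemma PhaseGroup.cascade_add {E : Type*} [NormedAddCommGroup E] [InnerProductSpace ℝ E]
    [CompleteSpace E] (P : PhaseGroup E) (N : E →L[ℝ] E) (s t : ℝ) (x₁ x₂ : E) :
    P.G (s + t) (x₂ + P.duhamel N (s + t) x₁) =
      P.G t (P.G s (x₂ + P.duhamel N s x₁) + P.duhamel N t (P.G s x₁)) := by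
  have hc := P.continuous_duhamel_integrand N x₁
  have h1 : P.duhamel N (s + t) x₁ =
      P.duhamel N s x₁ + P.G (-s) (P.duhamel N t (P.G s x₁)) := by
    rw [duhamel_apply, duhamel_apply, duhamel_apply,
      ← intervalIntegral.integral_add_adjacent_intervals (hc.intervalIntegrable 0 s)
        (hc.intervalIntegrable s (s + t)),
      ← ContinuousLinearMap.intervalIntegral_comp_comm _
        ((P.continuous_duhamel_integrand N (P.G s x₁)).intervalIntegrable _ _)]
    congr 1
    have := intervalIntegral.integral_comp_add_left (a := 0) (b := t)
      (fun r => P.G (-r) (N (P.G r x₁))) s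
    rw [add_zero] at this
    rw [← this]
    refine intervalIntegral.integral_congr fun r _ => ?_
    rw [neg_add, P.G_add (-s), add_comm s r, P.G_add r]
  rw [h1, add_comm s t, P.G_add, ← add_assoc, map_add (P.G s), P.G_G_neg]

/-! ### Existence of observability times -/

section ObservabilityTime

variable {H : Type u} [NormedAddCommGroup H] [InnerProductSpace ℝ H] [CompleteSpace H]
variable {G : Type v} [NormedAddCommGroup G] [InnerProductSpace ℝ G] [CompleteSpace G]
variable {A : H →ₗ.[ℝ] H} {C Pi : H →L[ℝ] H} {Bs : H2 A × H →L[ℝ] G}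

lemma WaveCalculus.pt_e1_symm (W : WaveCalculus A) (x : Phase H) :
    pt (W.e1 (W.e1.symm x.fst)) x.snd = x := by
  rw [LinearIsometryEquiv.apply_symm_apply]; rfl

lemma WaveCalculus.energy1_eq (W : WaveCalculus A) (w : H1 A) (q : H) :
    energy1 w q = ‖pt (W.e1 w) q‖ ^ 2 / 2 := by
  rw [energy1, Phase.norm_sq_eq, pt_fst, pt_snd, LinearIsometryEquiv.norm_map]

lemma WaveCalculus.energy0_eq (W : WaveCalculus A) (w : H1 A) (q : H) :
    energy0 A w.val q = ‖W.phase.R (pt (W.e1 w) q)‖ ^ 2 / 2 := by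
  rw [energy0, W.phase_R, Phase.norm_sq_eq, W.tsum_neg_half]
  simp only [pt_fst, pt_snd, W.R_e1]

/-- Admissibility of the cascade: the second component is a wave with source `-C a`, where `a` is
the first component of `G t x₁`. Each energy on the right of (A4) is bounded by the data, through
the isometry of `G` and the bound on the Duhamel operator. -/
lemma A4.exists_obs (hB : A4 A Bs) (W : WaveCalculus A) (C : H →L[ℝ] H) {T : ℝ} (hT : 0 < T) :
    ∃ M : ℝ, 0 ≤ M ∧ ∀ x₁ x₂ : Phase H, ∃ g : ℝ → G,
      IsObs (obsGraph W Bs) T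
        (fun t => W.phase.G t (x₂ + W.phase.duhamel (coupling C) t x₁)) g ∧
      ∫ t in (0 : ℝ)..T, ‖g t‖ ^ 2 ≤ M * (‖x₁‖ ^ 2 + ‖x₂‖ ^ 2) := by
  obtain ⟨c, hc, h⟩ := hB T hT
  set n := ‖coupling C‖ * T with hn
  refine ⟨c * ((1 + n ^ 2) * (2 + T) + ‖C‖ ^ 2 * T), by positivity, fun x₁ x₂ => ?_⟩
  set s := ‖x₁‖ ^ 2 + ‖x₂‖ ^ 2 with hs
  let x : ℝ → Phase H := fun t => W.phase.G t (x₂ + W.phase.duhamel (coupling C) t x₁)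
  have hx : W.phase.IsCascade (coupling C) T (fun t => W.phase.G t x₁) x :=
    W.phase.isCascade (coupling C) x₁ x₂ T
  let f : ℝ → H := fun t => -C (W.phase.G t x₁).fst
  have hf : Continuous f := (C.continuous.comp
    ((WithLp.fstL 2 ℝ H H).continuous.comp (W.phase.continuous_G x₁))).neg
  have hfb : ∀ t, ‖f t‖ ≤ ‖C‖ * ‖x₁‖ := fun t => by
    rw [norm_neg]
    refine (C.le_opNorm _).trans ?_
    gcongr
    exact (WithLp.norm_fst_le _ _).trans_eq (W.phase.norm_G t x₁)
  have hfL : MemLp f 2 (volume.restrict (Ioo 0 T)) :=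
    MemLp.of_bound hf.aestronglyMeasurable _ (Filter.Eventually.of_forall hfb)
  have hxb : ∀ t ∈ Icc 0 T, ‖x t‖ ^ 2 ≤ 2 * (1 + n ^ 2) * s := fun t ht => by
    have h1 : ‖x t‖ ≤ ‖x₂‖ + n * ‖x₁‖ := by
      simp only [x, W.phase.norm_G]
      refine (norm_add_le _ _).trans ?_
      gcongr
      refine (ContinuousLinearMap.le_opNorm _ _).trans ?_
      gcongr
      refine (PhaseGroup.norm_duhamel_le _ _).trans ?_
      rw [abs_of_nonneg ht.1, hn]
      gcongr
      exact ht.2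
    have h2 : ‖x t‖ ^ 2 ≤ (‖x₂‖ + n * ‖x₁‖) ^ 2 := by gcongr
    rw [hs]
    nlinarith [sq_nonneg (‖x₂‖ - n * ‖x₁‖), sq_nonneg (n * ‖x₂‖), sq_nonneg ‖x₁‖]
  have e : (fun t => pt (W.e1 (W.e1.symm (x t).fst)) (x t).snd) = x :=
    funext fun t => W.pt_e1_symm (x t)
  have hwave : IsWave1 A T f (fun t => W.e1.symm (x t).fst) (fun t => (x t).snd) := by
    rw [isWave1_iff W hf.continuousOn, e]
    have := hx.snd
    simpa only [coupling_apply] using this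
  obtain ⟨g, hg, hgb⟩ := h f _ _ hfL hwave
  rw [isObservation_iff W hwave.cont_w hwave.cont_q, e] at hg
  refine ⟨g, hg, hgb.trans ?_⟩
  simp only [W.energy1_eq, W.pt_e1_symm]
  rw [mul_assoc]
  refine mul_le_mul_of_nonneg_left ?_ hc.le
  have i1 : ∫ t in (0 : ℝ)..T, ‖x t‖ ^ 2 / 2 ≤ (1 + n ^ 2) * s * T := by
    have := intervalIntegral.norm_integral_le_of_norm_le_const (a := 0) (b := T)
      (f := fun t => ‖x t‖ ^ 2 / 2) (C := (1 + n ^ 2) * s) fun t ht => by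
        rw [uIoc_of_le hT.le] at ht
        rw [Real.norm_of_nonneg (by positivity)]
        linarith [hxb t (Ioc_subset_Icc_self ht)]
    rw [sub_zero, abs_of_pos hT] at this
    exact (le_abs_self _).trans this
  have i2 : ∫ t in (0 : ℝ)..T, ‖f t‖ ^ 2 ≤ ‖C‖ ^ 2 * s * T := by
    have := intervalIntegral.norm_integral_le_of_norm_le_const (a := 0) (b := T)
      (f := fun t => ‖f t‖ ^ 2) (C := ‖C‖ ^ 2 * s) fun t _ => by
        rw [Real.norm_of_nonneg (by positivity)]
        calc ‖f t‖ ^ 2 ≤ (‖C‖ * ‖x₁‖) ^ 2 := by gcongr; exact hfb t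
          _ = ‖C‖ ^ 2 * ‖x₁‖ ^ 2 := by ring
          _ ≤ _ := by rw [hs]; gcongr; linarith [sq_nonneg ‖x₂‖]
    rw [sub_zero, abs_of_pos hT] at this
    exact (le_abs_self _).trans this
  have b0 := hxb 0 ⟨le_rfl, hT.le⟩
  have b1 := hxb T ⟨hT.le, le_rfl⟩
  calc _ ≤ (1 + n ^ 2) * s + (1 + n ^ 2) * s + (1 + n ^ 2) * s * T + ‖C‖ ^ 2 * s * T := by
        gcongr <;> linarith
    _ = _ := by ring

lemma isWave1_free (W : WaveCalculus A) (x₀ : Phase H) (T : ℝ) :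
    IsWave1 A T (fun _ => 0) (fun t => W.e1.symm (W.phase.G t x₀).fst)
      (fun t => (W.phase.G t x₀).snd) := by
  rw [isWave1_iff W continuousOn_const]
  simp only [W.pt_e1_symm]
  exact PhaseGroup.isMild_G x₀ T

lemma A5.phase (hB : A5 A Bs) (W : WaveCalculus A) :
    ∃ T₀ : ℝ, 0 < T₀ ∧ ∀ T, T₀ < T → ∃ c : ℝ, 0 < c ∧ ∀ (x₀ : Phase H) (g : ℝ → G),
      IsObs (obsGraph W Bs) T (fun t => W.phase.G t x₀) g →
      c * ‖x₀‖ ^ 2 ≤ ∫ t in (0 : ℝ)..T, ‖g t‖ ^ 2 := by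
  obtain ⟨T₀, hT₀, h⟩ := hB
  refine ⟨T₀, hT₀, fun T hT => ?_⟩
  obtain ⟨c, hc, h⟩ := h T hT
  refine ⟨c / 2, by positivity, fun x₀ g hg => ?_⟩
  have hw := isWave1_free W x₀ T
  have := h _ _ g hw (by
    rw [isObservation_iff W hw.cont_w hw.cont_q]
    simpa only [W.pt_e1_symm] using hg)
  rw [W.energy1_eq, W.pt_e1_symm, W.phase.G_zero] at this
  linarith

lemma continuous_inner_fst (W : WaveCalculus A) (C : H →L[ℝ] H) (x₀ : Phase H) :
    Continuous fun t => inner ℝ (C (W.phase.G t x₀).fst) (W.phase.G t x₀).fst := by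
  have h : Continuous fun t => (W.phase.G t x₀).fst :=
    (WithLp.fstL 2 ℝ H H).continuous.comp (W.phase.continuous_G x₀)
  exact (C.continuous.comp h).inner h

/-- (A3) observes the velocity, while the coupling sees the position. The rotation `J` exchanges the
two and commutes with the group, and `C` dominates `α Π* Π` by (A2). -/
lemma A3.phase (h3 : A3 A Pi) (h2 : A2 A C Pi) (W : WaveCalculus A) :
    ∃ T₀ : ℝ, 0 < T₀ ∧ ∀ T, T₀ < T → ∃ c : ℝ, 0 < c ∧ ∀ x₀ : Phase H,
      c * ‖x₀‖ ^ 2 ≤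
        ∫ t in (0 : ℝ)..T, inner ℝ (C (W.phase.G t x₀).fst) (W.phase.G t x₀).fst := by
  obtain ⟨T₀, hT₀, h⟩ := h3
  obtain ⟨α, hα, hC⟩ := h2.partial_coercive
  refine ⟨T₀, hT₀, fun T hT => ?_⟩
  obtain ⟨c, hc, h⟩ := h T hT
  refine ⟨α * (c / 2), by positivity, fun x₀ => ?_⟩
  have h1 := h _ _ (isWave1_free W (W.phase.J x₀) T)
  rw [W.energy1_eq, W.pt_e1_symm, W.phase.G_zero, W.phase.norm_J] at h1
  simp only [W.phase.G_J] at h1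
  simp only [W.phase_J, pt_snd, map_neg, norm_neg] at h1
  calc α * (c / 2) * ‖x₀‖ ^ 2 = α * (c * (‖x₀‖ ^ 2 / 2)) := by ring
    _ ≤ α * ∫ t in (0 : ℝ)..T, ‖Pi (W.phase.G t x₀).fst‖ ^ 2 := by gcongr
    _ = ∫ t in (0 : ℝ)..T, α * ‖Pi (W.phase.G t x₀).fst‖ ^ 2 := by
      rw [intervalIntegral.integral_const_mul]
    _ ≤ _ := by
      have hc1 : Continuous fun t => α * ‖Pi (W.phase.G t x₀).fst‖ ^ 2 :=
        ((Pi.continuous.comp ((WithLp.fstL 2 ℝ H H).continuous.comp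
          (W.phase.continuous_G x₀))).norm.pow 2).const_mul α
      exact intervalIntegral.integral_mono_on (hT₀.trans hT).le (hc1.intervalIntegrable _ _)
        ((continuous_inner_fst W C x₀).intervalIntegrable _ _) fun t _ => hC _

/-- The group preserves the norm, so every window of length `τ` contributes the same lower bound. -/
lemma nat_mul_le_integral {W : WaveCalculus A} {τ c : ℝ}
    (h : ∀ x₀ : Phase H, c * ‖x₀‖ ^ 2 ≤
        ∫ t in (0 : ℝ)..τ, inner ℝ (C (W.phase.G t x₀).fst) (W.phase.G t x₀).fst)
    (x₀ : Phase H) (n : ℕ) : n * (c * ‖x₀‖ ^ 2) ≤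
        ∫ t in (0 : ℝ)..(n * τ), inner ℝ (C (W.phase.G t x₀).fst) (W.phase.G t x₀).fst := by
  induction n with
  | zero => simp
  | succ n ih =>
    have hc := continuous_inner_fst W C x₀
    have h1 := h (W.phase.G (n * τ) x₀)
    simp only [← W.phase.G_add, W.phase.norm_G] at h1
    rw [intervalIntegral.integral_comp_add_right
      (fun t => inner ℝ (C (W.phase.G t x₀).fst) (W.phase.G t x₀).fst), zero_add] at h1
    have e : ((n + 1 : ℕ) : ℝ) * τ = τ + n * τ := by push_cast; ring
    rw [e, ← intervalIntegral.integral_add_adjacent_intervals (hc.intervalIntegrable 0 (n * τ))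
      (hc.intervalIntegrable (n * τ) (τ + n * τ))]
    push_cast
    linarith

/-- For the wave coupling, the integrand of `PhaseGroup.inner_J_cascade` is `-⟨C a, a⟩`; the two
boundary terms are bounded by Cauchy–Schwarz. -/
lemma integral_inner_le (W : WaveCalculus A) (x₁ x₂ : Phase H) (t : ℝ) :
    ∫ s in (0 : ℝ)..t, inner ℝ (C (W.phase.G s x₁).fst) (W.phase.G s x₁).fst ≤
      ‖x₁‖ * (‖x₂‖ + ‖W.phase.G t (x₂ + W.phase.duhamel (coupling C) t x₁)‖) := by
  have h := W.phase.inner_J_cascade (coupling C) t x₁ x₂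
  have e : ∀ s, inner ℝ (W.phase.G s x₁) (W.phase.J (coupling C (W.phase.G s x₁))) =
      -inner ℝ (C (W.phase.G s x₁).fst) (W.phase.G s x₁).fst := fun s => by
    rw [coupling_apply, W.phase_J, Phase.inner_eq]
    simp [real_inner_comm]
  simp only [e, intervalIntegral.integral_neg] at h
  have b1 := real_inner_le_norm x₁ (W.phase.J x₂)
  have b2 := neg_le_of_abs_le (abs_real_inner_le_norm (W.phase.G t x₁)
    (W.phase.J (W.phase.G t (x₂ + W.phase.duhamel (coupling C) t x₁))))
  rw [W.phase.norm_J] at b1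
  rw [W.phase.norm_J, W.phase.norm_G] at b2
  linarith

/-- Subtracting the observation of the response to `(x₁, 0)` leaves that of the free wave from `x₂`,
to which single-equation observability applies. -/
lemma norm_sq_le_of_obs {W : WaveCalculus A} {τ c M : ℝ} (hτ : 0 < τ)
    (hM : ∀ x₁ x₂ : Phase H, ∃ g : ℝ → G,
      IsObs (obsGraph W Bs) τ
        (fun t => W.phase.G t (x₂ + W.phase.duhamel (coupling C) t x₁)) g ∧
      ∫ t in (0 : ℝ)..τ, ‖g t‖ ^ 2 ≤ M * (‖x₁‖ ^ 2 + ‖x₂‖ ^ 2))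
    (h : ∀ (x₀ : Phase H) (g : ℝ → G), IsObs (obsGraph W Bs) τ (fun t => W.phase.G t x₀) g →
      c * ‖x₀‖ ^ 2 ≤ ∫ t in (0 : ℝ)..τ, ‖g t‖ ^ 2) {x₁ x₂ : Phase H} {g : ℝ → G}
    (hg : IsObs (obsGraph W Bs) τ
        (fun t => W.phase.G t (x₂ + W.phase.duhamel (coupling C) t x₁)) g) :
    c * ‖x₂‖ ^ 2 ≤ 2 * (∫ t in (0 : ℝ)..τ, ‖g t‖ ^ 2) + 2 * M * ‖x₁‖ ^ 2 := by
  obtain ⟨h', hh', hb⟩ := hM x₁ 0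
  have c1 := (W.phase.isCascade (coupling C) x₁ x₂ τ).snd.cont
  have c2 := (W.phase.isCascade (coupling C) x₁ 0 τ).snd.cont
  have hd := IsObs.smul_add (-1) hh' hg c2 c1
  have h1 := h x₂ _ (hd.congr fun t _ => by simp)
  have i1 := (intervalIntegrable_iff_integrableOn_Ioo_of_le hτ.le).2 hg.sq_integrable
  have i2 := (intervalIntegrable_iff_integrableOn_Ioo_of_le hτ.le).2 hh'.sq_integrable
  have i3 := (intervalIntegrable_iff_integrableOn_Ioo_of_le hτ.le).2 hd.sq_integrable
  have h2 : ∫ t in (0 : ℝ)..τ, ‖(-1 : ℝ) • h' t + g t‖ ^ 2 ≤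
      ∫ t in (0 : ℝ)..τ, (2 * ‖g t‖ ^ 2 + 2 * ‖h' t‖ ^ 2) := by
    refine intervalIntegral.integral_mono_on hτ.le i3 ((i1.const_mul 2).add (i2.const_mul 2))
      fun t _ => ?_
    have : ‖(-1 : ℝ) • h' t + g t‖ ≤ ‖h' t‖ + ‖g t‖ := by
      refine (norm_add_le _ _).trans_eq ?_
      simp
    nlinarith [norm_nonneg ((-1 : ℝ) • h' t + g t), sq_nonneg (‖h' t‖ - ‖g t‖)]
  rw [intervalIntegral.integral_add (i1.const_mul 2) (i2.const_mul 2),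
    intervalIntegral.integral_const_mul, intervalIntegral.integral_const_mul] at h2
  rw [norm_zero] at hb
  linarith

/-- The weakened observability of the cascade system through its second component. -/
theorem exists_time_observability (h2 : A2 A C Pi) (h3 : A3 A Pi) (h4 : A4 A Bs) (h5 : A5 A Bs)
    (W : WaveCalculus A) :
    ∃ T₃ : ℝ, 0 < T₃ ∧ ∃ d : ℝ, 0 < d ∧ ∀ T, T₃ < T → ∀ (x₁ x₂ : Phase H) (g : ℝ → G),
      IsObs (obsGraph W Bs) T
        (fun t => W.phase.G t (x₂ + W.phase.duhamel (coupling C) t x₁)) g →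
      ‖x₁‖ ^ 2 + ‖x₂‖ ^ 2 ≤ d * ∫ t in (0 : ℝ)..T, ‖g t‖ ^ 2 := by
  obtain ⟨Ta, hTa, ha⟩ := h3.phase h2 W
  obtain ⟨Tb, hTb, hb⟩ := h5.phase W
  set τ := max Ta Tb + 1 with hτdef
  have hτ : 0 < τ := by have := le_max_left Ta Tb; linarith
  obtain ⟨c₀, hc₀, ha⟩ := ha τ (by have := le_max_left Ta Tb; linarith)
  obtain ⟨c, hc, hb⟩ := hb τ (by have := le_max_right Ta Tb; linarith)
  obtain ⟨M, hM0, hM⟩ := h4.exists_obs W C hτ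
  set K := (2 * M + 2) / c with hK
  have hKpos : 0 < K := by positivity
  -- The summand `1` ensures `n ≤ n²`, so that `8 K ≤ n c₀²` implies `8 K ≤ (n c₀)²`.
  obtain ⟨n, hn⟩ := exists_nat_gt (8 * K / c₀ ^ 2 + 1)
  have hn1 : (1 : ℝ) ≤ n := by
    have : 0 < 8 * K / c₀ ^ 2 := by positivity
    linarith
  have hnK : 8 * K ≤ (n * c₀) ^ 2 := by
    have h1 : 8 * K / c₀ ^ 2 ≤ n := by linarith
    rw [div_le_iff₀ (by positivity)] at h1
    calc 8 * K ≤ n * c₀ ^ 2 := h1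
      _ ≤ n ^ 2 * c₀ ^ 2 := by gcongr; nlinarith
      _ = _ := by ring
  have window : ∀ (x₁ x₂ : Phase H) (g : ℝ → G) (I : ℝ), IsObs (obsGraph W Bs) τ
      (fun t => W.phase.G t (x₂ + W.phase.duhamel (coupling C) t x₁)) g →
      ∫ t in (0 : ℝ)..τ, ‖g t‖ ^ 2 ≤ I → ‖x₂‖ ^ 2 ≤ K * (I + ‖x₁‖ ^ 2) := by
    intro x₁ x₂ g I hg hI
    have h := norm_sq_le_of_obs hτ hM hb hg
    have hI0 : 0 ≤ ∫ t in (0 : ℝ)..τ, ‖g t‖ ^ 2 :=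
      intervalIntegral.integral_nonneg hτ.le fun _ _ => by positivity
    rw [hK, div_mul_eq_mul_div, le_div_iff₀ hc]
    nlinarith [mul_nonneg hM0 (hI0.trans hI), sq_nonneg ‖x₁‖]
  -- Room is needed for `n` windows and one more starting at `nτ`. The constant comes from `‖x₁‖² ≤
  -- I` and `‖x₂‖² ≤ K (I + ‖x₁‖²)`.
  refine ⟨(n + 1) * τ, by positivity, 1 + 2 * K, by positivity, fun T hT x₁ x₂ g hg => ?_⟩
  set I := ∫ t in (0 : ℝ)..T, ‖g t‖ ^ 2 with hIdef
  have hnτ : 0 ≤ n * τ := by positivity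
  have hTn : n * τ + τ ≤ T := by linarith
  have hI0 : 0 ≤ I := intervalIntegral.integral_nonneg (by linarith) fun _ _ => by positivity
  have w0 := window x₁ x₂ g I (hg.mono (by linarith)) (by
    have := hg.integral_shift_le le_rfl hτ.le (by linarith)
    simpa using this)
  have wn := window (W.phase.G (n * τ) x₁)
    (W.phase.G (n * τ) (x₂ + W.phase.duhamel (coupling C) (n * τ) x₁)) (fun t => g (n * τ + t)) I
    ((hg.shift (W.phase.isCascade (coupling C) x₁ x₂ T).snd.cont hnτ hTn).congr fun t _ =>
      W.phase.cascade_add (coupling C) (n * τ) t x₁ x₂)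
    (hg.integral_shift_le hnτ hτ.le hTn)
  rw [W.phase.norm_G (n * τ) x₁] at wn
  have hlow := (nat_mul_le_integral ha x₁ n).trans (integral_inner_le W x₁ x₂ (n * τ))
  generalize ‖W.phase.G (n * τ) (x₂ + W.phase.duhamel (coupling C) (n * τ) x₁)‖ = e at wn hlow
  generalize ‖x₁‖ = a at *
  -- Squaring `n c₀ a² ≤ a (‖x₂‖ + e)` and inserting both window bounds gives `(n c₀)² a² ≤ 4 K (I +
  -- a²)`; the choice of `n` absorbs the last term.
  have ha2 : a ^ 2 ≤ I := by
    rcases eq_or_ne a 0 with rfl | ha0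
    · simpa using hI0
    have hapos : 0 < a ^ 2 := by positivity
    have hsq : (n * c₀) ^ 2 * a ^ 2 ≤ 4 * K * (I + a ^ 2) := by
      refine le_of_mul_le_mul_left ?_ hapos
      calc a ^ 2 * ((n * c₀) ^ 2 * a ^ 2) = (n * (c₀ * a ^ 2)) ^ 2 := by ring
        _ ≤ (a * (‖x₂‖ + e)) ^ 2 := by gcongr
        _ ≤ a ^ 2 * (2 * (‖x₂‖ ^ 2 + e ^ 2)) := by
          rw [mul_pow]
          gcongr
          nlinarith [sq_nonneg (‖x₂‖ - e)]
        _ ≤ a ^ 2 * (4 * K * (I + a ^ 2)) := mul_le_mul_of_nonneg_left (by linarith) hapos.le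
    have h8 : 8 * K * a ^ 2 ≤ 4 * K * (I + a ^ 2) :=
      (mul_le_mul_of_nonneg_right hnK hapos.le).trans hsq
    have h4K : 0 < 4 * K := by positivity
    exact le_of_mul_le_mul_left (by linarith) h4K
  nlinarith

theorem exists_isObservabilityTime (h2 : A2 A C Pi) (h3 : A3 A Pi) (h4 : A4 A Bs) (h5 : A5 A Bs)
    (W : WaveCalculus A) : ∃ T₃ : ℝ, IsObservabilityTime A C Bs T₃ := by
  obtain ⟨T₃, hT₃, d, hd, h⟩ := exists_time_observability h2 h3 h4 h5 W
  refine ⟨T₃, hT₃, fun T hT => ⟨d, d, hd, hd, fun u₁ u₂ q₁ q₂ g w1 w2 hg => ?_⟩⟩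
  have hcas := isCascade_of_isWave1 W w1 w2
  rw [isObservation_iff W w2.cont_w w2.cont_q] at hg
  have := h T hT _ _ g (hg.congr fun t ht => hcas.snd_eq ht)
  rw [W.energy0_eq, W.energy1_eq]
  constructor <;> nlinarith [sq_nonneg ‖W.phase.R (pt (W.e1 (u₁ 0)) (q₁ 0))‖,
    sq_nonneg ‖pt (W.e1 (u₂ 0)) (q₂ 0)‖]

end ObservabilityTime

/-! ### Duality between observation and control -/

section Control

variable {E : Type*} [NormedAddCommGroup E] [InnerProductSpace ℝ E] [CompleteSpace E]
variable {G : Type v} [NormedAddCommGroup G] [InnerProductSpace ℝ G] [CompleteSpace G]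

/-- An operator which is bounded from below has a surjective adjoint. -/
lemma exists_adjoint_eq {F : Type*} [NormedAddCommGroup F] [InnerProductSpace ℝ F]
    [CompleteSpace F] {Φ₁ Φ₂ : E →L[ℝ] F} {d : ℝ} (hd : 0 < d)
    (h : ∀ x₁ x₂, ‖x₁‖ ^ 2 + ‖x₂‖ ^ 2 ≤ d * ‖Φ₁ x₁ + Φ₂ x₂‖ ^ 2) (l₁ l₂ : E) :
    ∃ v : F, ContinuousLinearMap.adjoint Φ₁ v = l₁ ∧ ContinuousLinearMap.adjoint Φ₂ v = l₂ := by
  let Ψ : WithLp 2 (E × E) →L[ℝ] F :=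
    Φ₁.comp (WithLp.fstL 2 ℝ E E) + Φ₂.comp (WithLp.sndL 2 ℝ E E)
  have hΨ : ∀ x, Ψ x = Φ₁ x.fst + Φ₂ x.snd := fun _ => rfl
  -- Lax–Milgram for the form of `Ψ* Ψ`: if `Ψ* Ψ x = (l₁, l₂)`, then `Ψ x` is the required
  -- preimage.
  let B : WithLp 2 (E × E) →L[ℝ] WithLp 2 (E × E) →L[ℝ] ℝ := (innerSL ℝ).bilinearComp Ψ Ψ
  have hB : ∀ x y, B x y = inner ℝ (Ψ x) (Ψ y) := fun _ _ => rfl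
  have hco : IsCoercive B := by
    refine ⟨d⁻¹, inv_pos.2 hd, fun x => ?_⟩
    rw [hB, real_inner_self_eq_norm_sq, mul_assoc, ← sq, Phase.norm_sq_eq,
      inv_mul_le_iff₀ hd]
    exact h _ _
  obtain ⟨x, hx⟩ := hco.continuousLinearEquivOfBilin.surjective (pt l₁ l₂)
  have key : ∀ y, inner ℝ (Ψ x) (Ψ y) = inner ℝ (pt l₁ l₂) y := fun y => by
    rw [← hx, hco.continuousLinearEquivOfBilin_apply, hB]
  refine ⟨Ψ x, ext_inner_right ℝ fun y => ?_, ext_inner_right ℝ fun y => ?_⟩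
  · rw [ContinuousLinearMap.adjoint_inner_left]
    simpa [hΨ, Phase.inner_eq] using key (pt y 0)
  · rw [ContinuousLinearMap.adjoint_inner_left]
    simpa [hΨ, Phase.inner_eq] using key (pt 0 y)

/-- The truncation of `v` to `(0, t)`. -/
def truncate {μ : Measure ℝ} (v : Lp G 2 μ) (t : ℝ) : Lp G 2 μ :=
  ((Lp.memLp v).indicator (measurableSet_Ioo (a := 0) (b := t))).toLp _

lemma coeFn_truncate {μ : Measure ℝ} (v : Lp G 2 μ) (t : ℝ) :
    truncate v t =ᵐ[μ] (Ioo 0 t).indicator v := MemLp.coeFn_toLp _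

lemma norm_sq_eq_integral {μ : Measure ℝ} (v : Lp G 2 μ) : ‖v‖ ^ 2 = ∫ t, ‖v t‖ ^ 2 ∂μ := by
  rw [← real_inner_self_eq_norm_sq, L2.inner_def]
  simp only [real_inner_self_eq_norm_sq]

/-- Dominated convergence with majorant `‖v‖²`: near `t₀` the two indicators agree at every point
other than `t₀`, a null set. -/
lemma continuous_truncate {μ : Measure ℝ} [NullSingletonClass μ] (v : Lp G 2 μ) :
    Continuous (truncate v) := by
  rw [continuous_iff_continuousAt]
  intro t₀
  rw [ContinuousAt, tendsto_iff_norm_sub_tendsto_zero]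
  have e : ∀ t, ‖truncate v t - truncate v t₀‖ ^ 2 =
      ∫ r, ‖(Ioo 0 t).indicator v r - (Ioo 0 t₀).indicator v r‖ ^ 2 ∂μ := fun t => by
    rw [norm_sq_eq_integral]
    refine integral_congr_ae ?_
    filter_upwards [Lp.coeFn_sub (truncate v t) (truncate v t₀), coeFn_truncate v t,
      coeFn_truncate v t₀] with r h1 h2 h3
    rw [h1, Pi.sub_apply, h2, h3]
  have hlim : Filter.Tendsto
      (fun t => ∫ r, ‖(Ioo 0 t).indicator v r - (Ioo 0 t₀).indicator v r‖ ^ 2 ∂μ) (nhds t₀)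
      (nhds (∫ _, (0 : ℝ) ∂μ)) := by
    have hv := (Lp.memLp v).aestronglyMeasurable
    refine tendsto_integral_filter_of_dominated_convergence (fun r => ‖v r‖ ^ 2)
      (Filter.Eventually.of_forall fun t => ?_) (Filter.Eventually.of_forall fun t => ?_)
      ((Lp.memLp v).integrable_norm_pow two_ne_zero) ?_
    · exact ((hv.indicator measurableSet_Ioo).sub (hv.indicator measurableSet_Ioo)).norm.pow 2
    · refine Filter.Eventually.of_forall fun r => ?_
      rw [Real.norm_of_nonneg (by positivity)]
      by_cases h1 : r ∈ Ioo 0 t <;> by_cases h2 : r ∈ Ioo 0 t₀ <;> simp [h1, h2]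
    · have hne : ∀ᵐ r ∂μ, r ≠ t₀ := by simp [ae_iff, measure_singleton]
      filter_upwards [hne] with r hr
      refine tendsto_const_nhds.congr' ?_
      rcases lt_or_gt_of_ne hr with h | h
      · filter_upwards [lt_mem_nhds h] with t ht
        simp [indicator, h, ht]
      · filter_upwards [gt_mem_nhds h] with t ht
        simp [indicator, h.le.not_gt, ht.le.not_gt]
  simp only [← e, integral_zero] at hlim
  have := hlim.sqrt
  simpa [Real.sqrt_sq (norm_nonneg _)] using this

/-- The solution by transposition of the controlled system with an exact control. -/
theorem exists_control (P : PhaseGroup E) (N : E →L[ℝ] E) {T : ℝ}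
    {Φ₁ Φ₂ : E →L[ℝ] Lp G 2 (volume.restrict (Ioo 0 T))} {d : ℝ} (hd : 0 < d)
    (h : ∀ x₁ x₂, ‖x₁‖ ^ 2 + ‖x₂‖ ^ 2 ≤ d * ‖Φ₁ x₁ + Φ₂ x₂‖ ^ 2) (l₁ l₂ : E) :
    ∃ v : ℝ → G, MemLp v 2 (volume.restrict (Ioo 0 T)) ∧ ∃ y₁ y₂ : ℝ → E,
      Continuous y₁ ∧ Continuous y₂ ∧ y₁ 0 = l₁ ∧ y₂ 0 = l₂ ∧ y₁ T = 0 ∧ y₂ T = 0 ∧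
      ∀ S, 0 < S → ∀ (x₁ x₂ : E) (g : ℝ → G),
        g =ᵐ[volume.restrict (Ioo 0 (min T S))] (Φ₁ x₁ + Φ₂ x₂ : Lp G 2 _) →
        ∫ t in (0 : ℝ)..S, inner ℝ ((Ioo 0 T).indicator v t) (g t) =
          inner ℝ (y₁ S) (P.G S x₁) + inner ℝ (y₂ S) (P.G S (x₂ + P.duhamel N S x₁)) -
            (inner ℝ l₁ x₁ + inner ℝ l₂ x₂) := by
  obtain ⟨v, hv₁, hv₂⟩ := exists_adjoint_eq hd h (-l₁) (-l₂)
  refine ⟨v, Lp.memLp v, ?_⟩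
  -- The state with the free evolution removed: it accumulates the control used up to time `t`, and
  -- vanishes at `T` because `Φ* v = -(l₁, l₂)`.
  let m₁ : ℝ → E := fun t => l₁ + ContinuousLinearMap.adjoint Φ₁ (truncate v t)
  let m₂ : ℝ → E := fun t => l₂ + ContinuousLinearMap.adjoint Φ₂ (truncate v t)
  have hm₁ : Continuous m₁ :=
    continuous_const.add ((ContinuousLinearMap.continuous _).comp (continuous_truncate v))
  have hm₂ : Continuous m₂ :=
    continuous_const.add ((ContinuousLinearMap.continuous _).comp (continuous_truncate v))
  have t0 : truncate v 0 = 0 := by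
    rw [Lp.eq_zero_iff_ae_eq_zero]
    filter_upwards [coeFn_truncate v 0] with r hr
    rw [hr]; simp
  have tT : truncate v T = v := by
    refine Lp.ext ?_
    filter_upwards [coeFn_truncate v T, ae_restrict_mem measurableSet_Ioo] with r hr hr'
    rw [hr, indicator_of_mem hr']
  have hL : Continuous fun t => ContinuousLinearMap.adjoint (P.duhamel N t) (m₂ t) :=
    ((ContinuousLinearMap.adjoint (𝕜 := ℝ) (E := E) (F := E)).continuous.comp
      (PhaseGroup.continuous_duhamel N)).clm_apply hm₂
  refine ⟨fun t => P.G t (m₁ t - ContinuousLinearMap.adjoint (P.duhamel N t) (m₂ t)),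
    fun t => P.G t (m₂ t), P.continuous_G_apply continuous_id (hm₁.sub hL),
    P.continuous_G_apply continuous_id hm₂, ?_, ?_, ?_, ?_, ?_⟩
  · simp [m₁, t0, P.G_zero, PhaseGroup.duhamel_zero]
  · simp [m₂, t0, P.G_zero]
  · simp [m₁, m₂, tT, hv₁, hv₂]
  · simp [m₂, tT, hv₂]
  · intro S hS x₁ x₂ g hg
    -- Both sides are integrals over `(0, min T S)`, where `g` agrees with the observation on `(0,
    -- T)`; so `S` may lie on either side of `T`.
    have hi : ∫ t in (0 : ℝ)..S, inner ℝ ((Ioo 0 T).indicator v t) (g t) =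
        inner ℝ (truncate v S) (Φ₁ x₁ + Φ₂ x₂) := by
      rw [intervalIntegral.integral_of_le hS.le, integral_Ioc_eq_integral_Ioo, L2.inner_def]
      have e1 : ∀ t, inner ℝ ((Ioo 0 T).indicator v t) (g t) =
          (Ioo 0 T).indicator (fun t => inner ℝ (v t) (g t)) t := fun t => by
        by_cases ht : t ∈ Ioo 0 T <;> simp [ht]
      have e2 : ∫ t in Ioo 0 T, inner ℝ (truncate v S t) ((Φ₁ x₁ + Φ₂ x₂ : Lp G 2 _) t) =
          ∫ t in Ioo 0 T, (Ioo 0 S).indicator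
            (fun t => inner ℝ (v t) ((Φ₁ x₁ + Φ₂ x₂ : Lp G 2 _) t)) t := by
        refine integral_congr_ae ?_
        filter_upwards [coeFn_truncate v S] with t ht
        rw [ht]
        by_cases ht : t ∈ Ioo 0 S <;> simp [ht]
      simp only [e1]
      rw [e2, setIntegral_indicator measurableSet_Ioo, setIntegral_indicator measurableSet_Ioo,
        Ioo_inter_Ioo, Ioo_inter_Ioo, max_self, min_comm S T]
      refine integral_congr_ae ?_
      filter_upwards [hg] with t ht
      rw [ht]
    rw [hi, P.inner_cascade N S (m₁ S) (m₂ S) x₁ x₂]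
    simp only [m₁, m₂, inner_add_left, ContinuousLinearMap.adjoint_inner_left, inner_add_right]
    ring

end Control

/-! ### The observation map on the data of the cascade -/

section ObservationMap

variable {H : Type u} [NormedAddCommGroup H] [InnerProductSpace ℝ H] [CompleteSpace H]
variable {G : Type v} [NormedAddCommGroup G] [InnerProductSpace ℝ G] [CompleteSpace G]
variable {A : H →ₗ.[ℝ] H} {C Pi : H →L[ℝ] H} {Bs : H2 A × H →L[ℝ] G}

lemma IsObs.congr_ae {E : Type*} [NormedAddCommGroup E] [InnerProductSpace ℝ E] [CompleteSpace E]
    {Γ : Submodule ℝ (E × G)} {T : ℝ} {x : ℝ → E} {g h : ℝ → G} (hx : IsObs Γ T x g)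
    (hgh : g =ᵐ[volume.restrict (Ioo 0 T)] h) : IsObs Γ T x h := by
  refine ⟨hx.memLp.ae_eq hgh, fun t ht => ?_⟩
  have : ∫ s in (0 : ℝ)..t, h s = ∫ s in (0 : ℝ)..t, g s := by
    rw [intervalIntegral.integral_of_le ht.1, intervalIntegral.integral_of_le ht.1,
      integral_Ioc_eq_integral_Ioo, integral_Ioc_eq_integral_Ioo]
    exact integral_congr_ae (ae_restrict_of_ae_restrict_of_subset
      (Ioo_subset_Ioo_right ht.2) hgh.symm)
  rw [this]; exact hx.mem t ht

/-- The map from the data of the cascade system to the observation. -/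
theorem A4.exists_obsMap (hB : A4 A Bs) (W : WaveCalculus A) (C : H →L[ℝ] H) {T : ℝ} (hT : 0 < T) :
    ∃ Φ₁ Φ₂ : Phase H →L[ℝ] Lp G 2 (volume.restrict (Ioo 0 T)), ∀ x₁ x₂,
      IsObs (obsGraph W Bs) T (fun t => W.phase.G t (x₂ + W.phase.duhamel (coupling C) t x₁))
        (Φ₁ x₁ + Φ₂ x₂ : Lp G 2 (volume.restrict (Ioo 0 T))) := by
  obtain ⟨M, hM, h⟩ := hB.exists_obs W C hT
  choose g hg hb using h
  let Φ₀ : Phase H × Phase H → Lp G 2 (volume.restrict (Ioo 0 T)) := fun p =>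
    (hg p.1 p.2).memLp.toLp (g p.1 p.2)
  have hΦ₀ : ∀ p : Phase H × Phase H, IsObs (obsGraph W Bs) T
      (fun t => W.phase.G t (p.2 + W.phase.duhamel (coupling C) t p.1)) (Φ₀ p) := fun p =>
    (hg p.1 p.2).congr_ae (MemLp.coeFn_toLp _).symm
  have hcont : ∀ p : Phase H × Phase H, ContinuousOn
      (fun t => W.phase.G t (p.2 + W.phase.duhamel (coupling C) t p.1)) (Icc 0 T) := fun p =>
    (W.phase.isCascade (coupling C) p.1 p.2 T).snd.cont
  -- The observations are chosen separately for each datum; linearity comes from their almost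
  -- everywhere uniqueness.
  have hlin : ∀ (c : ℝ) (p q : Phase H × Phase H), Φ₀ (c • p + q) = c • Φ₀ p + Φ₀ q := by
    intro c p q
    refine Lp.ext ?_
    have h1 := IsObs.smul_add c (hΦ₀ p) (hΦ₀ q) (hcont p) (hcont q)
    have h2 : IsObs (obsGraph W Bs) T (fun t => c • W.phase.G t
        (p.2 + W.phase.duhamel (coupling C) t p.1) +
        W.phase.G t (q.2 + W.phase.duhamel (coupling C) t q.1)) (Φ₀ (c • p + q)) :=
      (hΦ₀ (c • p + q)).congr fun t _ => by
        simp only [Prod.fst_add, Prod.snd_add, Prod.smul_fst, Prod.smul_snd, map_add, map_smul,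
          smul_add]
        abel
    have h3 := h2.unique (obsGraph_zero W Bs) h1
    filter_upwards [h3, Lp.coeFn_add (c • Φ₀ p) (Φ₀ q), Lp.coeFn_smul c (Φ₀ p)] with t e1 e2 e3
    rw [e1, e2, Pi.add_apply, e3, Pi.smul_apply]
  have hzero : Φ₀ 0 = 0 := by simpa using hlin 1 0 0
  let Φ : Phase H × Phase H →L[ℝ] Lp G 2 (volume.restrict (Ioo 0 T)) :=
    LinearMap.mkContinuous
      { toFun := Φ₀
        map_add' := fun p q => by simpa using hlin 1 p q
        map_smul' := fun c p => by simpa [hzero] using hlin c p 0 } (√(2 * M)) (by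
      intro p
      refine abs_le_of_sq_le_sq' ?_ (by positivity) |>.2
      rw [mul_pow, Real.sq_sqrt (by positivity)]
      have e1 : ‖Φ₀ p‖ ^ 2 = ∫ t in (0 : ℝ)..T, ‖g p.1 p.2 t‖ ^ 2 := by
        rw [norm_sq_eq_integral, integral_sq_eq hT.le]
        refine integral_congr_ae ?_
        filter_upwards [MemLp.coeFn_toLp (hg p.1 p.2).memLp] with t ht
        rw [ht]
      change ‖Φ₀ p‖ ^ 2 ≤ _
      rw [e1]
      refine (hb p.1 p.2).trans ?_
      have n1 : ‖p.1‖ ^ 2 ≤ ‖p‖ ^ 2 := by gcongr; exact norm_fst_le p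
      have n2 : ‖p.2‖ ^ 2 ≤ ‖p‖ ^ 2 := by gcongr; exact norm_snd_le p
      nlinarith)
  refine ⟨Φ.comp (ContinuousLinearMap.inl ℝ _ _), Φ.comp (ContinuousLinearMap.inr ℝ _ _),
    fun x₁ x₂ => ?_⟩
  have e : Φ.comp (ContinuousLinearMap.inl ℝ _ _) x₁ + Φ.comp (ContinuousLinearMap.inr ℝ _ _) x₂ =
      Φ₀ (x₁, x₂) := by
    simp only [ContinuousLinearMap.comp_apply, ← map_add, ContinuousLinearMap.inl_apply,
      ContinuousLinearMap.inr_apply, Prod.mk_add_mk, add_zero, zero_add]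
    rfl
  rw [e]
  exact hΦ₀ (x₁, x₂)

lemma WaveCalculus.denseRange_R (W : WaveCalculus A) : DenseRange W.phase.R := by
  have h : (LinearMap.range (W.phase.R : Phase H →ₗ[ℝ] Phase H))ᗮ = ⊥ := by
    rw [eq_bot_iff]
    intro x hx
    rw [Submodule.mem_orthogonal] at hx
    rw [Submodule.mem_bot]
    refine W.phase.R_inj ?_
    rw [map_zero]
    refine ext_inner_left ℝ fun y => ?_
    rw [inner_zero_right, ← W.phase.R_symm]
    exact hx _ ⟨y, rfl⟩
  rw [← Submodule.topologicalClosure_eq_top_iff] at h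
  have h' := (Submodule.dense_iff_topologicalClosure_eq_top).2 h
  rw [LinearMap.coe_range] at h'
  exact h'

/-- The observability of the cascade system for data in `H × H_1 × H_{-1} × H`. -/
theorem IsObservabilityTime.le_obsMap {T₃ T : ℝ} (h : IsObservabilityTime A C Bs T₃) (hT : T₃ < T)
    (W : WaveCalculus A) {Φ₁ Φ₂ : Phase H →L[ℝ] Lp G 2 (volume.restrict (Ioo 0 T))}
    (hΦ : ∀ x₁ x₂,
      IsObs (obsGraph W Bs) T (fun t => W.phase.G t (x₂ + W.phase.duhamel (coupling C) t x₁))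
        (Φ₁ x₁ + Φ₂ x₂ : Lp G 2 (volume.restrict (Ioo 0 T)))) :
    ∃ d : ℝ, 0 < d ∧ ∀ x₁ x₂, ‖x₁‖ ^ 2 + ‖x₂‖ ^ 2 ≤ d * ‖Φ₁ x₁ + Φ₂ x₂‖ ^ 2 := by
  obtain ⟨hT₃, h⟩ := h
  obtain ⟨d₁, d₂, hd₁, hd₂, h⟩ := h T hT
  refine ⟨2 * (d₁ + d₂), by positivity, fun x₁ x₂ => ?_⟩
  -- Observability times are defined with first data in `H_1 × H`, which in these coordinates are
  -- the range of `R`. Both sides are continuous in `x₁`, so density suffices.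
  refine W.denseRange_R.induction_on x₁ (isClosed_le (by fun_prop) (by fun_prop)) fun y => ?_
  have w1 := isWave1_free W y T
  have hcas := W.phase.isCascade (coupling C) (W.phase.R y) x₂ T
  have w2 : IsWave1 A T (fun s => -C (W.e1.symm (W.phase.G s y).fst).val)
      (fun t => W.e1.symm
        (W.phase.G t (x₂ + W.phase.duhamel (coupling C) t (W.phase.R y))).fst)
      (fun t => (W.phase.G t (x₂ + W.phase.duhamel (coupling C) t (W.phase.R y))).snd) := by
    have hc : Continuous fun s => -C (W.e1.symm (W.phase.G s y).fst).val := by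
      simp only [← W.R_e1, LinearIsometryEquiv.apply_symm_apply]
      exact (C.continuous.comp (W.R.continuous.comp
        ((WithLp.fstL 2 ℝ H H).continuous.comp (W.phase.continuous_G y)))).neg
    rw [isWave1_iff W hc.continuousOn]
    simp only [W.pt_e1_symm]
    refine hcas.snd.congr (fun s _ => ?_) fun _ _ => rfl
    simp only
    rw [coupling_apply, W.phase.G_R, W.phase_R, pt_fst, ← W.R_e1,
      LinearIsometryEquiv.apply_symm_apply]
  have := h _ _ _ _ _ w1 w2 (by
    rw [isObservation_iff W w2.cont_w w2.cont_q]
    simp only [W.pt_e1_symm]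
    exact hΦ _ _)
  rw [W.energy0_eq, W.energy1_eq, W.pt_e1_symm, W.pt_e1_symm, W.phase.G_zero, W.phase.G_zero,
    PhaseGroup.duhamel_zero, zero_apply, add_zero, integral_sq_eq (hT₃.trans hT).le,
    ← norm_sq_eq_integral] at this
  linarith [this.1, this.2]

end ObservationMap

/-! ### Solutions by transposition and exact control -/

section Transposition

variable {H : Type u} [NormedAddCommGroup H] [InnerProductSpace ℝ H] [CompleteSpace H]
variable {G : Type v} [NormedAddCommGroup G] [InnerProductSpace ℝ G] [CompleteSpace G]
variable {A : H →ₗ.[ℝ] H} {C D : H →L[ℝ] H}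

/-! ### Unbounded control operators -/

namespace WaveCalculus

variable (W : WaveCalculus A)

/-- The first component of the isomorphism of `X_1^*` onto the square of the phase space. -/
def pos₁ (y : XposStar A) : Phase H := pt y.2.2.1 (-W.e1 y.1)

/-- The second component of the isomorphism of `X_1^*` onto the square of the phase space. -/
def pos₂ (y : XposStar A) : Phase H := pt (W.d1 y.2.2.2) (-y.2.1)

/-- The inverse of the isomorphism of `X_1^*` onto the square of the phase space. -/
def ofPos (z₁ z₂ : Phase H) : XposStar A :=
  (W.e1.symm (-z₁.snd), -z₂.snd, z₁.fst, W.d1.symm z₂.fst)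

lemma pos₁_ofPos (z₁ z₂ : Phase H) : W.pos₁ (W.ofPos z₁ z₂) = z₁ := by
  refine Phase.ext ?_ ?_ <;> simp [pos₁, ofPos]

lemma pos₂_ofPos (z₁ z₂ : Phase H) : W.pos₂ (W.ofPos z₁ z₂) = z₂ := by
  refine Phase.ext ?_ ?_ <;> simp [pos₂, ofPos]

lemma ofPos_pos (y : XposStar A) : W.ofPos (W.pos₁ y) (W.pos₂ y) = y := by
  simp [pos₁, pos₂, ofPos]

lemma ofPos_zero : W.ofPos 0 0 = 0 := by
  simp [ofPos]

lemma continuous_ofPos : Continuous fun p : Phase H × Phase H => W.ofPos p.1 p.2 := by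
  have h1 : Continuous fun x : Phase H => x.fst := (WithLp.fstL 2 ℝ H H).continuous
  have h2 : Continuous fun x : Phase H => x.snd := (WithLp.sndL 2 ℝ H H).continuous
  have := W.e1.symm.continuous
  have := W.d1.symm.continuous
  unfold ofPos
  fun_prop

lemma continuous_pos₁ : Continuous W.pos₁ := by
  have h := W.e1.continuous
  rw [← continuousOn_univ]
  refine continuous_pt ?_ ?_ <;> rw [continuousOn_univ] <;> fun_prop

lemma continuous_pos₂ : Continuous W.pos₂ := by
  have h := W.d1.continuous
  rw [← continuousOn_univ]
  refine continuous_pt ?_ ?_ <;> rw [continuousOn_univ] <;> fun_prop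

/-- The minus signs in `pos₁` and `pos₂` are chosen so that the symplectic duality product becomes
the inner product of the phase space. -/
lemma pairPos_eq (y : XposStar A) (w₁ : H) (w₂ : H1 A) (q₁ : Hneg1 A) (q₂ : H) :
    pairPos y w₁ w₂ q₁ q₂ = inner ℝ (W.pos₁ y) (pt w₁ (W.d1 q₁)) +
      inner ℝ (W.pos₂ y) (pt (W.e1 w₂) q₂) := by
  rw [Phase.inner_eq, Phase.inner_eq]
  simp only [pos₁, pos₂, pt_fst, pt_snd, inner_neg_left, W.inner_d1]
  rw [real_inner_comm _ (W.e1 _), W.inner_d1, pairPos]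
  ring

end WaveCalculus

/-- Two solutions which agree at all positive times, as seen in the phase space, agree. -/
lemma eqOn_Ici_of_phase {X : Type*} [TopologicalSpace X] {z₁ z₂ : X → Phase H}
    {z : Phase H → Phase H → X} (hz : ∀ y, z (z₁ y) (z₂ y) = y) (h₁ : Continuous z₁)
    (h₂ : Continuous z₂) {Y Y' : ℝ → X} (hY : ContinuousOn Y (Ici 0)) (hY' : ContinuousOn Y' (Ici 0))
    (h : ∀ t, 0 < t → z₁ (Y' t) = z₁ (Y t) ∧ z₂ (Y' t) = z₂ (Y t)) : EqOn Y' Y (Ici 0) := by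
  have e1 : EqOn (fun t => z₁ (Y' t)) (fun t => z₁ (Y t)) (Ici 0) :=
    EqOn.of_subset_closure (s := Ioi 0) (fun t ht => (h t ht).1) (h₁.comp_continuousOn hY')
      (h₁.comp_continuousOn hY) Ioi_subset_Ici_self (by rw [closure_Ioi])
  have e2 : EqOn (fun t => z₂ (Y' t)) (fun t => z₂ (Y t)) (Ici 0) :=
    EqOn.of_subset_closure (s := Ioi 0) (fun t ht => (h t ht).2) (h₂.comp_continuousOn hY')
      (h₂.comp_continuousOn hY) Ioi_subset_Ici_self (by rw [closure_Ioi])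
  intro t ht
  have a1 : z₁ (Y' t) = z₁ (Y t) := e1 ht
  have a2 : z₂ (Y' t) = z₂ (Y t) := e2 ht
  rw [← hz (Y' t), ← hz (Y t), a1, a2]

/-- Every pair of phase vectors is the datum of a dual solution, and the observation is unique
almost everywhere. Hence the pairings of the two states with all terminal values of dual solutions
agree. -/
lemma IsTranspositionUnbounded.unique (W : WaveCalculus A) {B : G →L[ℝ] Hneg2 A} {v : ℝ → G}
    {Y₀ : XposStar A} {Y Y' : ℝ → XposStar A} (h : IsTranspositionUnbounded A C B v Y₀ Y)
    (h' : IsTranspositionUnbounded A C B v Y₀ Y') : EqOn Y' Y (Ici 0) := by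
  refine eqOn_Ici_of_phase W.ofPos_pos W.continuous_pos₁ W.continuous_pos₂ h.1 h'.1 fun t ht => ?_
  refine PhaseGroup.eq_of_inner_cascade (P := W.phase) (N := coupling C) (t := t) fun x₁ x₂ => ?_
  let X₁ : ℝ → Phase H := fun s => W.phase.G s x₁
  let X₂ : ℝ → Phase H := fun s => W.phase.G s (x₂ + W.phase.duhamel (coupling C) s x₁)
  have e1 : ∀ s, pt (X₁ s).fst (W.d1 (W.d1.symm (X₁ s).snd)) = X₁ s := fun s => by
    rw [ContinuousLinearEquiv.apply_symm_apply]; rfl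
  have e2 : ∀ s, pt (W.e1 (W.e1.symm (X₂ s).fst)) (X₂ s).snd = X₂ s := fun s => W.pt_e1_symm _
  have hd : IsDual1 A C t (fun s => (X₁ s).fst) (fun s => W.e1.symm (X₂ s).fst)
      (fun s => W.d1.symm (X₁ s).snd) (fun s => (X₂ s).snd) := by
    rw [isDual1_iff W]
    simp only [e1, e2]
    exact W.phase.isCascade (coupling C) x₁ x₂ t
  obtain ⟨g, hg, hi⟩ := h.2 t ht _ _ _ _ hd
  obtain ⟨g', hg', hi'⟩ := h'.2 t ht _ _ _ _ hd
  rw [isObservation_iff W hd.2.cont_w hd.2.cont_q] at hg hg'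
  have hae := hg.unique (obsGraph_zero W _) hg'
  have : ∫ s in (0 : ℝ)..t, inner ℝ (v s) (g s) = ∫ s in (0 : ℝ)..t, inner ℝ (v s) (g' s) := by
    rw [intervalIntegral.integral_of_le ht.le, intervalIntegral.integral_of_le ht.le,
      integral_Ioc_eq_integral_Ioo, integral_Ioc_eq_integral_Ioo]
    refine integral_congr_ae ?_
    filter_upwards [hae] with s hs
    rw [hs]
  rw [this, hi', W.pairPos_eq, W.pairPos_eq (Y t)] at hi
  simp only [e1, e2] at hi
  linarith

theorem exists_control_unbounded (W : WaveCalculus A) {B : G →L[ℝ] Hneg2 A}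
    (h4 : A4 A (obsUnbounded B)) {T₃ : ℝ} (hobs : IsObservabilityTime A C (obsUnbounded B) T₃)
    {T : ℝ} (hT : T₃ < T) (Y₀ : XposStar A) :
    ∃ v : ℝ → G, MemLp v 2 (volume.restrict (Ioo 0 T)) ∧
      ∃ Y : ℝ → XposStar A, IsTranspositionUnbounded A C B ((Ioo 0 T).indicator v) Y₀ Y ∧
        Y 0 = Y₀ ∧ Y T = 0 := by
  obtain ⟨Φ₁, Φ₂, hΦ⟩ := h4.exists_obsMap W C (hobs.1.trans hT)
  obtain ⟨d, hd, hlow⟩ := hobs.le_obsMap hT W hΦ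
  obtain ⟨v, hv, y₁, y₂, hy₁, hy₂, y₁0, y₂0, y₁T, y₂T, hy⟩ :=
    exists_control W.phase (coupling C) hd hlow (W.pos₁ Y₀) (W.pos₂ Y₀)
  refine ⟨v, hv, fun t => W.ofPos (y₁ t) (y₂ t), ⟨?_, ?_⟩, ?_, ?_⟩
  · exact (W.continuous_ofPos.comp (hy₁.prodMk hy₂)).continuousOn
  · intro S hS w₁ w₂ q₁ q₂ hw
    have hcas := (isDual1_iff W).1 hw
    have m0 : (0 : ℝ) ∈ Icc 0 S := ⟨le_rfl, hS.le⟩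
    have mS : S ∈ Icc 0 S := ⟨hS.le, le_rfl⟩
    set x₁ : Phase H := pt (w₁ 0) (W.d1 (q₁ 0)) with hx₁
    set x₂ : Phase H := pt (W.e1 (w₂ 0)) (q₂ 0) with hx₂
    obtain ⟨M, -, hM⟩ := h4.exists_obs W C hS
    obtain ⟨g, hg, -⟩ := hM x₁ x₂
    refine ⟨g, ?_, ?_⟩
    · rw [isObservation_iff W hw.2.cont_w hw.2.cont_q]
      exact hg.congr fun t ht => (hcas.snd_eq ht).symm
    -- The observation on `(0, S)` and the value of the observation map on `(0, T)` are compared on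
    -- the common interval.
    · have hae := (hg.mono (min_le_right T S)).unique (obsGraph_zero W _)
        ((hΦ x₁ x₂).mono (min_le_left T S))
      rw [hy S hS x₁ x₂ g hae, W.pairPos_eq, W.pairPos_eq, W.pos₁_ofPos, W.pos₂_ofPos, ← hx₁, ← hx₂]
      have a1 := hcas.fst.eq_G mS
      have a2 := hcas.snd_eq mS
      rw [← a1, ← a2]
  · simp only [y₁0, y₂0, W.ofPos_pos]
  · simp only [y₁T, y₂T, W.ofPos_zero]

/-! ### Bounded control operators -/

namespace WaveCalculus

variable (W : WaveCalculus A)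

/-- The first component of the isomorphism of `X_{-1}^*` onto the square of the phase space. -/
def neg₁ (y : XnegStar A) : Phase H := pt (W.e1 y.2.2.1) (-W.e2 y.1)

/-- The second component of the isomorphism of `X_{-1}^*` onto the square of the phase space. -/
def neg₂ (y : XnegStar A) : Phase H := pt y.2.2.2 (-W.e1 y.2.1)

/-- The inverse of the isomorphism of `X_{-1}^*` onto the square of the phase space. -/
def ofNeg (z₁ z₂ : Phase H) : XnegStar A :=
  (W.e2.symm (-z₁.snd), W.e1.symm (-z₂.snd), W.e1.symm z₁.fst, z₂.fst)

lemma neg₁_ofNeg (z₁ z₂ : Phase H) : W.neg₁ (W.ofNeg z₁ z₂) = z₁ := by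
  refine Phase.ext ?_ ?_ <;> simp [neg₁, ofNeg]

lemma neg₂_ofNeg (z₁ z₂ : Phase H) : W.neg₂ (W.ofNeg z₁ z₂) = z₂ := by
  refine Phase.ext ?_ ?_ <;> simp [neg₂, ofNeg]

lemma ofNeg_neg (y : XnegStar A) : W.ofNeg (W.neg₁ y) (W.neg₂ y) = y := by
  simp [neg₁, neg₂, ofNeg]

lemma ofNeg_zero : W.ofNeg 0 0 = 0 := by
  simp [ofNeg]

lemma continuous_ofNeg : Continuous fun p : Phase H × Phase H => W.ofNeg p.1 p.2 := by
  have h1 : Continuous fun x : Phase H => x.fst := (WithLp.fstL 2 ℝ H H).continuous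
  have h2 : Continuous fun x : Phase H => x.snd := (WithLp.sndL 2 ℝ H H).continuous
  have := W.e1.symm.continuous
  have := W.e2.symm.continuous
  unfold ofNeg
  fun_prop

lemma continuous_neg₁ : Continuous W.neg₁ := by
  have h := W.e1.continuous
  have h' := W.e2.continuous
  rw [← continuousOn_univ]
  refine continuous_pt ?_ ?_ <;> rw [continuousOn_univ] <;> fun_prop

lemma continuous_neg₂ : Continuous W.neg₂ := by
  have h := W.e1.continuous
  rw [← continuousOn_univ]
  refine continuous_pt ?_ ?_ <;> rw [continuousOn_univ] <;> fun_prop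

lemma pairNeg_eq (y : XnegStar A) (w₁ : Hneg1 A) (w₂ : H) (q₁ : Hneg2 A) (q₂ : Hneg1 A) :
    pairNeg y w₁ w₂ q₁ q₂ = inner ℝ (W.neg₁ y) (pt (W.d1 w₁) (W.d2 q₁)) +
      inner ℝ (W.neg₂ y) (pt w₂ (W.d1 q₂)) := by
  rw [Phase.inner_eq, Phase.inner_eq]
  simp only [neg₁, neg₂, pt_fst, pt_snd, inner_neg_left]
  rw [real_inner_comm, W.inner_d1, real_inner_comm _ (W.e2 _), W.inner_d2,
    real_inner_comm _ (W.e1 _), W.inner_d1, pairNeg]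
  ring

end WaveCalculus

lemma IsTranspositionBounded.unique (W : WaveCalculus A)
    (hD : ∀ (w : Hneg1 A) (φ : H1 A), w (adjOnH1 A C φ) = inner ℝ (D (W.d1 w)) (W.e1 φ))
    {B : G →L[ℝ] H} {v : ℝ → G}
    {Y₀ : XnegStar A} {Y Y' : ℝ → XnegStar A} (h : IsTranspositionBounded A C B v Y₀ Y)
    (h' : IsTranspositionBounded A C B v Y₀ Y') : EqOn Y' Y (Ici 0) := by
  refine eqOn_Ici_of_phase W.ofNeg_neg W.continuous_neg₁ W.continuous_neg₂ h.1 h'.1 fun t ht => ?_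
  refine PhaseGroup.eq_of_inner_cascade (P := W.phase) (N := coupling D) (t := t) fun x₁ x₂ => ?_
  let X₁ : ℝ → Phase H := fun s => W.phase.G s x₁
  let X₂ : ℝ → Phase H := fun s => W.phase.G s (x₂ + W.phase.duhamel (coupling D) s x₁)
  have e1 : ∀ s, pt (W.d1 (W.d1.symm (X₁ s).fst)) (W.d2 (W.d2.symm (X₁ s).snd)) = X₁ s :=
    fun s => by
      rw [ContinuousLinearEquiv.apply_symm_apply, ContinuousLinearEquiv.apply_symm_apply]; rfl
  have e2 : ∀ s, pt (X₂ s).fst (W.d1 (W.d1.symm (X₂ s).snd)) = X₂ s := fun s => by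
    rw [ContinuousLinearEquiv.apply_symm_apply]; rfl
  have hd : IsDualNeg1 A C t (fun s => W.d1.symm (X₁ s).fst) (fun s => (X₂ s).fst)
      (fun s => W.d2.symm (X₁ s).snd) (fun s => W.d1.symm (X₂ s).snd) := by
    rw [isDualNeg1_iff W hD]
    simp only [e1, e2]
    exact W.phase.isCascade (coupling D) x₁ x₂ t
  have hi := h.2 t ht _ _ _ _ hd
  have hi' := h'.2 t ht _ _ _ _ hd
  rw [hi', W.pairNeg_eq, W.pairNeg_eq (Y t)] at hi
  simp only [e1, e2] at hi
  linarith

/-- The coupling of the time primitives of the solutions of the dual system in `X_{-1}`. -/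
def primitiveCoupling (W : WaveCalculus A) (C : H →L[ℝ] H) : Phase H →L[ℝ] Phase H :=
  mat 0 (W.R.comp C) 0 0

lemma primitiveCoupling_apply (W : WaveCalculus A) (C : H →L[ℝ] H) (x : Phase H) :
    primitiveCoupling W C x = pt (W.R (C x.snd)) 0 := by
  simp [primitiveCoupling, mat_apply]

/-- The time primitives of the solutions of the dual system in `X_{-1}` are the solutions of the
dual system in `X_1`. -/
lemma PhaseGroup.IsCascade.primitive {W : WaveCalculus A} (hDR : ∀ x, D (W.R x) = W.R (C x)) {T : ℝ}
    {x₁ x₂ : ℝ → Phase H} (h : W.phase.IsCascade (coupling D) T x₁ x₂) :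
    W.phase.IsCascade (coupling C) T (fun t => -W.phase.J (x₁ t))
      (fun t => -W.phase.J (x₂ t) + primitiveCoupling W C (x₁ t)) := by
  have e0 : (fun _ : ℝ => (0 : Phase H)) = fun _ => pt 0 0 := rfl
  have h1 : W.phase.IsMild T (fun _ => pt 0 0) (fun t => pt (x₁ t).fst (x₁ t).snd) := h.fst
  have h2 : W.phase.IsMild T (fun s => pt 0 (-D (x₁ s).fst))
      (fun t => pt (x₂ t).fst (x₂ t).snd) := by
    have := h.snd
    simp only [coupling_apply] at this
    exact this
  obtain ⟨ca₁, cb₁, ea₁, eb₁⟩ := (isMild_iff W continuousOn_const).1 h1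
  have hcD : ContinuousOn (fun s => -D (x₁ s).fst) (Icc 0 T) :=
    (D.continuous.comp_continuousOn ca₁).neg
  obtain ⟨ca₂, cb₂, ea₂, eb₂⟩ := (isMild_iff W hcD).1 h2
  have z1 : (fun t => -W.phase.J (x₁ t)) = fun t => pt (-(x₁ t).snd) (x₁ t).fst := by
    funext t
    rw [W.phase_J]
    refine Phase.ext ?_ ?_ <;> simp
  -- The primitives are `p₁ = -A⁻¹ w₁'` and `p₂ = -A⁻¹ (w₂' + C p₁)`, so that `p₁' = w₁` and `p₂' =
  -- w₂`. The first component here is `A^{1/2} p₂`, and the coupling term is `-A^{-1/2} C p₁`.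
  have z2 : (fun t => -W.phase.J (x₂ t) + primitiveCoupling W C (x₁ t)) =
      fun t => pt (W.R (C (x₁ t).snd) - (x₂ t).snd) (x₂ t).fst := by
    funext t
    rw [W.phase_J, primitiveCoupling_apply]
    refine Phase.ext ?_ ?_
    · simp [sub_eq_neg_add]
    · simp
  rw [z2]
  refine ⟨?_, ?_⟩
  · rw [z1, e0, isMild_iff W continuousOn_const]
    refine ⟨cb₁.neg, ca₁, fun t ht => ?_, fun t ht => ?_⟩
    · rw [map_neg, map_neg, eb₁ t ht]
      simp [intervalIntegral.integral_neg, add_comm]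
    · rw [ea₁ t ht]
      simp
  · have e1 : (fun s => coupling C (-W.phase.J (x₁ s))) = fun s => pt 0 (C (x₁ s).snd) := by
      funext s
      rw [congrFun z1 s, coupling_apply, pt_fst, map_neg, neg_neg]
    have cC : ContinuousOn (fun s => C (x₁ s).snd) (Icc 0 T) := C.continuous.comp_continuousOn cb₁
    have cDa : ContinuousOn (fun s => D (x₁ s).fst) (Icc 0 T) := D.continuous.comp_continuousOn ca₁
    have cRDa : ContinuousOn (fun s => W.R (D (x₁ s).fst)) (Icc 0 T) :=
      W.R.continuous.comp_continuousOn cDa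
    rw [e1, isMild_iff W cC]
    refine ⟨(W.R.continuous.comp_continuousOn cC).sub cb₂, ca₂, fun t ht => ?_, fun t ht => ?_⟩
    · have i1 := intervalIntegrable_of_continuousOn ca₁ ht
      have i2 := intervalIntegrable_of_continuousOn ca₂ ht
      have i3 := intervalIntegrable_of_continuousOn cRDa ht
      -- The intertwining relation `D R = R C` turns the integrated equation of the first wave into
      -- an integral of `R D` that cancels the source in the second.
      have k1 : W.R (W.R (C (x₁ t).snd)) =
          W.R (W.R (C (x₁ 0).snd)) - ∫ s in (0 : ℝ)..t, W.R (D (x₁ s).fst) := by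
        have := eb₁ t ht
        simp only [map_zero, zero_sub, intervalIntegral.integral_neg] at this
        rw [← hDR, this, map_add, map_neg, ← D.intervalIntegral_comp_comm i1, hDR, map_add, map_neg,
          ← W.R.intervalIntegral_comp_comm (intervalIntegrable_of_continuousOn cDa ht),
          sub_eq_add_neg]
      have k2 := eb₂ t ht
      simp only [map_neg] at k2
      have i4 : IntervalIntegrable (fun s => -W.R (D (x₁ s).fst)) volume 0 t := i3.neg
      rw [intervalIntegral.integral_sub i4 i2, intervalIntegral.integral_neg] at k2
      rw [map_sub, map_sub, k1, k2]
      abel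
    · rw [ea₂ t ht]
      simp

/-- For bounded `B` the observation depends only on the continuous velocity, so the integrated
definition is the pointwise one. -/
lemma ae_eq_of_isObs_bounded {W : WaveCalculus A} {B : G →L[ℝ] H} {T : ℝ} {z : ℝ → Phase H}
    {g : ℝ → G} (hz : ContinuousOn z (Icc 0 T))
    (hg : IsObs (obsGraph W (obsBounded A B)) T z g) :
    g =ᵐ[volume.restrict (Ioo 0 T)] fun t => ContinuousLinearMap.adjoint B (z t).snd := by
  have hc : ContinuousOn (fun t => (z t).snd) (Icc 0 T) :=
    (WithLp.sndL 2 ℝ H H).continuous.comp_continuousOn hz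
  have hc' : ContinuousOn (fun t => ContinuousLinearMap.adjoint B (z t).snd) (Icc 0 T) :=
    (ContinuousLinearMap.continuous _).comp_continuousOn hc
  have hm : MemLp (fun t => ContinuousLinearMap.adjoint B (z t).snd) 2
      (volume.restrict (Ioo 0 T)) := by
    obtain ⟨M, hM⟩ := isCompact_Icc.exists_bound_of_continuousOn hc'
    refine MemLp.of_bound ((hc'.mono Ioo_subset_Icc_self).aestronglyMeasurable measurableSet_Ioo) M ?_
    filter_upwards [ae_restrict_mem measurableSet_Ioo] with t ht
    exact hM t (Ioo_subset_Icc_self ht)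
  refine ae_eq_of_forall_integral_eq hg.memLp hm fun t ht => ?_
  obtain ⟨_, e⟩ := hg.mem t ht
  rw [ContinuousLinearMap.intervalIntegral_comp_comm _
    (PhaseGroup.intervalIntegrable_of_continuousOn hc ht),
    ← integral_snd (PhaseGroup.intervalIntegrable_of_continuousOn hz ht)]
  exact e.symm

theorem exists_control_bounded (W : WaveCalculus A) (hDR : ∀ x, D (W.R x) = W.R (C x))
    (hD : ∀ (w : Hneg1 A) (φ : H1 A), w (adjOnH1 A C φ) = inner ℝ (D (W.d1 w)) (W.e1 φ))
    {B : G →L[ℝ] H}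
    (h4 : A4 A (obsBounded A B)) {T₃ : ℝ} (hobs : IsObservabilityTime A C (obsBounded A B) T₃)
    {T : ℝ} (hT : T₃ < T) (Y₀ : XnegStar A) :
    ∃ v : ℝ → G, MemLp v 2 (volume.restrict (Ioo 0 T)) ∧
      ∃ Y : ℝ → XnegStar A, IsTranspositionBounded A C B ((Ioo 0 T).indicator v) Y₀ Y ∧
        Y 0 = Y₀ ∧ Y T = 0 := by
  obtain ⟨Ψ₁, Ψ₂, hΨ⟩ := h4.exists_obsMap W C (hobs.1.trans hT)
  obtain ⟨d, hd, hΨlow⟩ := hobs.le_obsMap hT W hΨ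
  set Q := primitiveCoupling W C with hQ
  -- The data of the primitive are `(-J x₁, -J x₂ + Q x₁)`; precomposition with this map makes the
  -- velocity observation `Ψ` return `B* w₂`.
  let Φ₁ := Ψ₁.comp (-W.phase.J) + Ψ₂.comp Q
  let Φ₂ := Ψ₂.comp (-W.phase.J)
  have hΦ : ∀ x₁ x₂, Φ₁ x₁ + Φ₂ x₂ = Ψ₁ (-W.phase.J x₁) + Ψ₂ (-W.phase.J x₂ + Q x₁) := by
    intro x₁ x₂
    simp only [Φ₁, Φ₂, add_apply, ContinuousLinearMap.comp_apply, neg_apply, map_add, map_neg]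
    abel
  -- The change of data is triangular with isometric diagonal `-J`, hence bounded below, with a
  -- constant depending on `‖Q‖`.
  have hlow : ∀ x₁ x₂, ‖x₁‖ ^ 2 + ‖x₂‖ ^ 2 ≤
      ((3 + 2 * ‖Q‖ ^ 2) * d) * ‖Φ₁ x₁ + Φ₂ x₂‖ ^ 2 := by
    intro x₁ x₂
    have h := hΨlow (-W.phase.J x₁) (-W.phase.J x₂ + Q x₁)
    rw [← hΦ, norm_neg, W.phase.norm_J] at h
    have h2 : ‖x₂‖ ≤ ‖-W.phase.J x₂ + Q x₁‖ + ‖Q‖ * ‖x₁‖ := by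
      calc ‖x₂‖ = ‖(-W.phase.J x₂ + Q x₁) - Q x₁‖ := by
            rw [add_sub_cancel_right, norm_neg, W.phase.norm_J]
        _ ≤ _ := (norm_sub_le _ _).trans (by gcongr; exact Q.le_opNorm _)
    have h3 : ‖x₂‖ ^ 2 ≤ 2 * ‖-W.phase.J x₂ + Q x₁‖ ^ 2 + 2 * (‖Q‖ ^ 2 * ‖x₁‖ ^ 2) := by
      have : ‖x₂‖ ^ 2 ≤ (‖-W.phase.J x₂ + Q x₁‖ + ‖Q‖ * ‖x₁‖) ^ 2 := by gcongr
      nlinarith [sq_nonneg (‖-W.phase.J x₂ + Q x₁‖ - ‖Q‖ * ‖x₁‖)]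
    calc ‖x₁‖ ^ 2 + ‖x₂‖ ^ 2
        ≤ (3 + 2 * ‖Q‖ ^ 2) * (‖x₁‖ ^ 2 + ‖-W.phase.J x₂ + Q x₁‖ ^ 2) := by
          nlinarith [sq_nonneg ‖x₁‖, sq_nonneg ‖-W.phase.J x₂ + Q x₁‖,
            mul_nonneg (sq_nonneg ‖Q‖) (sq_nonneg ‖-W.phase.J x₂ + Q x₁‖)]
      _ ≤ (3 + 2 * ‖Q‖ ^ 2) * (d * ‖Φ₁ x₁ + Φ₂ x₂‖ ^ 2) := by gcongr
      _ = _ := by ring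
  obtain ⟨v, hv, y₁, y₂, hy₁, hy₂, y₁0, y₂0, y₁T, y₂T, hy⟩ :=
    exists_control W.phase (coupling D) (by positivity) hlow (W.neg₁ Y₀) (W.neg₂ Y₀)
  refine ⟨v, hv, fun t => W.ofNeg (y₁ t) (y₂ t), ⟨?_, ?_⟩, ?_, ?_⟩
  · exact (W.continuous_ofNeg.comp (hy₁.prodMk hy₂)).continuousOn
  · intro S hS w₁ w₂ q₁ q₂ hw
    have hcas := (isDualNeg1_iff W hD).1 hw
    have mS : S ∈ Icc 0 S := ⟨hS.le, le_rfl⟩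
    set x₁ : Phase H := pt (W.d1 (w₁ 0)) (W.d2 (q₁ 0)) with hx₁
    set x₂ : Phase H := pt (w₂ 0) (W.d1 (q₂ 0)) with hx₂
    have hprim := (W.phase.isCascade (coupling D) x₁ x₂ T).primitive hDR
    -- The observation map gives the velocity observation of the primitive, and that velocity is
    -- `w₂` on the common interval.
    have hae : (fun t => ContinuousLinearMap.adjoint B (w₂ t))
        =ᵐ[volume.restrict (Ioo 0 (min T S))]
        (Φ₁ x₁ + Φ₂ x₂ : Lp G 2 (volume.restrict (Ioo 0 T))) := by
      have hobs' := hΨ (-W.phase.J x₁) (-W.phase.J x₂ + Q x₁)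
      rw [← hΦ] at hobs'
      have hobs'' := ae_eq_of_isObs_bounded hprim.snd.cont (hobs'.congr fun t ht => by
        have := hprim.snd_eq ht
        simp only [W.phase.G_zero, PhaseGroup.duhamel_zero, zero_apply, add_zero] at this
        exact this.symm)
      have h1 := ae_restrict_of_ae_restrict_of_subset
        (Ioo_subset_Ioo_right (min_le_left T S)) hobs''
      filter_upwards [h1, ae_restrict_mem measurableSet_Ioo] with t ht ht'
      rw [ht]
      have ht2 : t ∈ Icc 0 S := ⟨ht'.1.le, ht'.2.le.trans (min_le_right T S)⟩
      have := congrArg WithLp.fst (hcas.snd_eq ht2)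
      rw [pt_fst, ← hx₁, ← hx₂] at this
      rw [this, W.phase_J, primitiveCoupling_apply]
      simp
    rw [hy S hS x₁ x₂ _ hae, W.pairNeg_eq, W.pairNeg_eq, W.neg₁_ofNeg, W.neg₂_ofNeg, ← hx₁, ← hx₂]
    have a1 := hcas.fst.eq_G mS
    have a2 := hcas.snd_eq mS
    rw [← a1, ← a2]
  · simp only [y₁0, y₂0, W.ofNeg_neg]
  · simp only [y₁T, y₂T, W.ofNeg_zero]

end Transposition

end Cascade

end

theorem theorem2p32 {H : Type*} [NormedAddCommGroup H] [InnerProductSpace ℝ H] [CompleteSpace H]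
    {G : Type*} [NormedAddCommGroup G] [InnerProductSpace ℝ G] [CompleteSpace G]
    (A : H →ₗ.[ℝ] H) (C Pi : H →L[ℝ] H)
    (hA1 : Cascade.A1 A) (hA2 : Cascade.A2 A C Pi) (hA3 : Cascade.A3 A Pi) :
    -- bounded control operators
    (∀ B : G →L[ℝ] H,
      Cascade.A4 A (Cascade.obsBounded A B) → Cascade.A5 A (Cascade.obsBounded A B) →
      (∃ T₃ : ℝ, Cascade.IsObservabilityTime A C (Cascade.obsBounded A B) T₃) ∧
      ∀ T₃ : ℝ, Cascade.IsObservabilityTime A C (Cascade.obsBounded A B) T₃ →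
        ∀ T : ℝ, T₃ < T → ∀ Y₀ : Cascade.XnegStar A,
          ∃ v : ℝ → G, MemLp v 2 (volume.restrict (Ioo 0 T)) ∧
            ∃ Y : ℝ → Cascade.XnegStar A,
              Cascade.IsTranspositionBounded A C B ((Ioo 0 T).indicator v) Y₀ Y ∧
              (∀ Y' : ℝ → Cascade.XnegStar A,
                Cascade.IsTranspositionBounded A C B ((Ioo 0 T).indicator v) Y₀ Y' →
                EqOn Y' Y (Ici 0)) ∧
              Y 0 = Y₀ ∧ Y T = 0) ∧
    -- unbounded control operators
    (∀ B : G →L[ℝ] Cascade.Hneg2 A,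
      Cascade.A4 A (Cascade.obsUnbounded B) → Cascade.A5 A (Cascade.obsUnbounded B) →
      (∃ T₃ : ℝ, Cascade.IsObservabilityTime A C (Cascade.obsUnbounded B) T₃) ∧
      ∀ T₃ : ℝ, Cascade.IsObservabilityTime A C (Cascade.obsUnbounded B) T₃ →
        ∀ T : ℝ, T₃ < T → ∀ Y₀ : Cascade.XposStar A,
          ∃ v : ℝ → G, MemLp v 2 (volume.restrict (Ioo 0 T)) ∧
            ∃ Y : ℝ → Cascade.XposStar A,
              Cascade.IsTranspositionUnbounded A C B ((Ioo 0 T).indicator v) Y₀ Y ∧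
              (∀ Y' : ℝ → Cascade.XposStar A,
                Cascade.IsTranspositionUnbounded A C B ((Ioo 0 T).indicator v) Y₀ Y' →
                EqOn Y' Y (Ici 0)) ∧
              Y 0 = Y₀ ∧ Y T = 0) := by
  obtain ⟨W⟩ := hA1.waveCalculus
  obtain ⟨D, hDR, hD⟩ := hA2.exists_extension W
  refine ⟨fun B h4 h5 => ⟨Cascade.exists_isObservabilityTime hA2 hA3 h4 h5 W, ?_⟩,
    fun B h4 h5 => ⟨Cascade.exists_isObservabilityTime hA2 hA3 h4 h5 W, ?_⟩⟩
  · intro T₃ hobs T hT Y₀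
    obtain ⟨v, hv, Y, hY, h0, hTY⟩ := Cascade.exists_control_bounded W hDR hD h4 hobs hT Y₀
    exact ⟨v, hv, Y, hY, fun Y' hY' => hY.unique W hD hY', h0, hTY⟩
  · intro T₃ hobs T hT Y₀
    obtain ⟨v, hv, Y, hY, h0, hTY⟩ := Cascade.exists_control_unbounded W h4 hobs hT Y₀
    exact ⟨v, hv, Y, hY, fun Y' hY' => hY.unique W hY', h0, hTY⟩
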